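/- Let $\mathfrak A$ be a countably infinite alphabet. A letter is multiple in a word if it occurs in it at least twice. Let $\tau_1$ be the congruence on the free monoid $\mathfrak A^*$ induced by the relations $a=a^2$, $a\in\mathfrak A$. For $\mathbf u,\mathbf v\in\mathfrak A^*$ put $\mathbf u\,\lambda\,\mathbf v$ if $\mathbf u\,\tau_1\,\mathbf v$, the words $\mathbf u,\mathbf v$ have the same multiple letters, and for each multiple letter its first two occurrences are adjacent in $\mathbf u$ if and only if they are adjacent in $\mathbf v$; $\lambda$ is a congruence. For $W\subseteq\mathfrak A^*/\lambda$ let $M_\lambda(W)$ be the Rees quotient of $\mathfrak A^*/\lambda$ over the ideal of all elements that are not factors of an element of $W$. For distinct letters $a,b,t,s$ denote the $\lambda$-class $\{a\}$ of a letter by $a$, the $\lambda$-class $\{a^2,a^3,\dots\}$ by $a^+$, and the product in $\mathfrak A^*/\lambda$ by juxtaposition. A variety is a class of monoids closed under homomorphic images, submonoids and direct products; $\operatorname{var}M$ is the variety generated by a monoid $M$, $\operatorname{var}\Sigma$ the variety defined by a set $\Sigma$ of identities, $\vee$ the join of varieties, and $\overline{\mathbb V}$ the variety of monoids anti-isomorphic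 to members of $\mathbb V$. Let $E=\langle e,c\mid e^2=e,\ c^2=ec=0,\ ce=c\rangle$, $B_0=\langle e,f,c\mid e^2=e,\ f^2=f,\ ef=fe=0,\ ec=cf=c\rangle$, let $E^1,B_0^1$ be these semigroups with an identity element adjoined, and put $\mathbb E=\operatorname{var}E^1$, $\mathbb B_0=\operatorname{var}B_0^1$. Put \[\mathbb F=\operatorname{var}\{x^2y^2\approx y^2x^2,\ xytxy\approx yxtxy,\ xtxs\approx xtxsx\},\] let \[\Phi=\{xtx\approx xtx^2,\ x^2y^2\approx y^2x^2,\ xytxy\approx yxtxy,\ xt_1xt_2t_3x\approx xt_1xt_2xt_3x\},\] and put \[\mathbb H=\operatorname{var}\bigl(\Phi\cup\{x^2yty\approx xyxty\approx yx^2ty\}\bigr),\qquad \mathbb I=\operatorname{var}\bigl(\Phi\cup\{xtxysy\approx xtyxsy\}\bigr),\] \[\mathbb J=\operatorname{var}\bigl(\Phi\cup\{x\,y_{1\pi}\cdots y_{n\pi}\,x\,t_1y_1\cdots t_ny_n\approx x^2\,y_{1\pi}\cdots y_{n\pi}\,t_1y_1\cdots t_ny_n\mid n\ge 0,\ \pi\in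 S_n\}\bigr).\] Theorem. The subvarieties of $\mathbb J$ that are not contained in $\mathbb B_0$ are exactly $\mathbb F$, $\mathbb F\vee\overline{\mathbb E}$, $\mathbb H$, $\mathbb I$ and $\mathbb J$, and (i) $\mathbb F=\operatorname{var}M_\lambda(\{ata^+\})$; (ii) $\mathbb F\vee\overline{\mathbb E}=\operatorname{var}M_\lambda(\{ata^+,\,a^+t\})=\operatorname{var}M_\lambda(\{a^+ta^+\})$; (iii) $\mathbb H=\operatorname{var}M_\lambda(\{abta^+sb^+\})$; (iv) $\mathbb I$ is generated by the monoid $M_\lambda(\{ba^+sb^+\})$, which has 19 elements; (v) $\mathbb J$ is generated by the monoid $M_\lambda(\{atba^+sb^+\})$, which has 34 elements. -/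

import Mathlib

universe u

namespace LimitVar

/-! ## Varieties of monoids -/

/-- A variety of monoids: a class of monoids closed under homomorphic images, submonoids and
arbitrary direct products. -/
@[ext]
structure MonoidVariety : Type (u + 1) where
  Mem : (M : Type u) → [Monoid M] → Prop
  image_mem : ∀ {M N : Type u} [Monoid M] [Monoid N] (f : M →* N),
    Function.Surjective f → Mem M → Mem N
  submonoid_mem : ∀ {M : Type u} [Monoid M] (S : Submonoid M), Mem M → Mem S
  pi_mem : ∀ {ι : Type u} (M : ι → Type u) [∀ i, Monoid (M i)],
    (∀ i, Mem (M i)) → Mem (∀ i, M i)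

namespace MonoidVariety

/-- Inclusion of varieties. -/
instance : LE MonoidVariety.{u} := ⟨fun V W => ∀ (M : Type u) [Monoid M], V.Mem M → W.Mem M⟩

/-- The smallest variety containing all members of a class `K` of monoids. -/
def generate (K : (M : Type u) → [Monoid M] → Prop) : MonoidVariety.{u} where
  Mem N _ := ∀ V : MonoidVariety.{u}, (∀ (M : Type u) [Monoid M], K M → V.Mem M) → V.Mem N
  image_mem f hf h V hV := V.image_mem f hf (h V hV)
  submonoid_mem S h V hV := V.submonoid_mem S (h V hV)
  pi_mem M _ h V hV := V.pi_mem M fun i => h i V hV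

/-- The join of two varieties: the smallest variety containing both. -/
instance : Max MonoidVariety.{u} :=
  ⟨fun V W => generate fun M _ => V.Mem M ∨ W.Mem M⟩

/-- The variety generated by one (small) monoid. -/
def var (M : Type) [Monoid M] : MonoidVariety.{u} where
  Mem N _ := ∀ V : MonoidVariety.{u}, V.Mem (ULift.{u} M) → V.Mem N
  image_mem f hf h V hV := V.image_mem f hf (h V hV)
  submonoid_mem S h V hV := V.submonoid_mem S (h V hV)
  pi_mem M _ h V hV := V.pi_mem M fun i => h i V hV

/-- The dual variety: all monoids anti-isomorphic to a member of `V`. -/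
def dual (V : MonoidVariety.{u}) : MonoidVariety.{u} where
  Mem M _ := ∃ (N : Type u) (_ : Monoid N), V.Mem N ∧ Nonempty (M ≃* Nᵐᵒᵖ)
  image_mem := by
    rintro M N _ _ f hf ⟨P, _, hP, ⟨e⟩⟩
    refine ⟨Nᵐᵒᵖ, inferInstance,
      V.image_mem ((MonoidHom.op (f.comp e.symm.toMonoidHom)).comp
        (MulEquiv.opOp P).toMonoidHom) ?_ hP, ⟨MulEquiv.opOp N⟩⟩
    intro y
    obtain ⟨m, hm⟩ := hf y.unop
    refine ⟨(e m).unop, ?_⟩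
    apply MulOpposite.unop_injective
    simp [hm]
  submonoid_mem := by
    rintro M _ S ⟨P, _, hP, ⟨e⟩⟩
    let T : Submonoid P := (S.map e.toMonoidHom).unop
    refine ⟨T, inferInstance, V.submonoid_mem T hP, ⟨?_⟩⟩
    refine MulEquiv.mk' ⟨fun s => MulOpposite.op ⟨(e s.1).unop, ⟨s.1, s.2, rfl⟩⟩,
      fun t => ⟨e.symm (MulOpposite.op t.unop.1), ?_⟩, ?_, ?_⟩ ?_
    · obtain ⟨s, hs, h⟩ := t.unop.2
      have : e.symm (MulOpposite.op t.unop.1) = s := by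
        rw [MulEquiv.symm_apply_eq]; exact h.symm
      rw [this]; exact hs
    · intro s; simp
    · intro t; simp
    · intro s t
      apply MulOpposite.unop_injective
      apply Subtype.ext
      simp
  pi_mem := by
    intro ι M _ h
    choose P hm hP e using h
    refine ⟨∀ i, P i, inferInstance, V.pi_mem P hP, ⟨?_⟩⟩
    refine MulEquiv.mk' ⟨fun x => MulOpposite.op fun i => ((e i).some (x i)).unop,
      fun y i => (e i).some.symm (MulOpposite.op (y.unop i)), ?_, ?_⟩ ?_
    · intro x; simp
    · intro y; simp
    · intro x y
      apply MulOpposite.unop_injective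
      funext i
      simp

end MonoidVariety

/-! ## Identities -/

/-- An identity `p.1 ≈ p.2` in the letters of a countably infinite alphabet (indexed by `ℕ`)
holds in `M` if both sides agree under every substitution of elements of `M` for letters. -/
def Satisfies (M : Type u) [Monoid M] (p : FreeMonoid ℕ × FreeMonoid ℕ) : Prop :=
  ∀ φ : ℕ → M, FreeMonoid.lift φ p.1 = FreeMonoid.lift φ p.2

/-- The variety of all monoids satisfying the identities in `Γ`. -/
def varIds (Γ : Set (FreeMonoid ℕ × FreeMonoid ℕ)) : MonoidVariety.{u} where
  Mem M _ := ∀ p ∈ Γ, Satisfies M p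
  image_mem := by
    intro M N _ _ f hf h p hp φ
    choose g hg using hf
    have hφ : FreeMonoid.lift φ = f.comp (FreeMonoid.lift fun n => g (φ n)) := by
      ext n; simp [hg]
    rw [hφ, MonoidHom.comp_apply, MonoidHom.comp_apply, h p hp]
  submonoid_mem := by
    intro M _ S h p hp φ
    have hφ : S.subtype.comp (FreeMonoid.lift φ) = FreeMonoid.lift fun n => (φ n : M) := by
      ext n; simp
    apply Subtype.ext
    have := h p hp fun n => (φ n : M)
    rw [← hφ] at this
    exact this
  pi_mem := by
    intro ι M _ h p hp φ
    funext i
    have hφ : (Pi.evalMonoidHom M i).comp (FreeMonoid.lift φ)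
        = FreeMonoid.lift fun n => φ n i := by
      ext n; simp
    have := h i p hp fun n => φ n i
    rw [← hφ] at this
    exact this

/-- The letter with index `n`, as a word. -/
abbrev v (n : ℕ) : FreeMonoid ℕ := FreeMonoid.of n

abbrev x : FreeMonoid ℕ := v 0
abbrev y : FreeMonoid ℕ := v 1
abbrev t : FreeMonoid ℕ := v 2
abbrev s : FreeMonoid ℕ := v 3
abbrev t₁ : FreeMonoid ℕ := v 4
abbrev t₂ : FreeMonoid ℕ := v 5
abbrev t₃ : FreeMonoid ℕ := v 6

/-- The variety `𝔽`. -/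
def varF : MonoidVariety.{u} := varIds
  {(x ^ 2 * y ^ 2, y ^ 2 * x ^ 2), (x * y * t * x * y, y * x * t * x * y),
    (x * t * x * s, x * t * x * s * x)}

/-- The variety `ℍ`. -/
def varH : MonoidVariety.{u} := varIds
  {(x * t * x, x * t * x ^ 2), (x ^ 2 * y ^ 2, y ^ 2 * x ^ 2),
    (x * y * t * x * y, y * x * t * x * y),
    (x * t₁ * x * t₂ * t₃ * x, x * t₁ * x * t₂ * x * t₃ * x),
    (x ^ 2 * y * t * y, x * y * x * t * y), (x * y * x * t * y, y * x ^ 2 * t * y)}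

/-- The variety `𝕀`. -/
def varI : MonoidVariety.{u} := varIds
  {(x * t * x, x * t * x ^ 2), (x ^ 2 * y ^ 2, y ^ 2 * x ^ 2),
    (x * y * t * x * y, y * x * t * x * y),
    (x * t₁ * x * t₂ * t₃ * x, x * t₁ * x * t₂ * x * t₃ * x),
    (x * t * x * y * s * y, x * t * y * x * s * y)}

/-- The letter `x` of the words `wWord n π` and `wWord' n π`. -/
abbrev wx : FreeMonoid ℕ := v 0
/-- The letters `y₁, y₂, …` of the words `wWord n π` and `wWord' n π`. -/
abbrev wy (i : ℕ) : FreeMonoid ℕ := v (2 * i + 1)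
/-- The letters `t₁, t₂, …` of the words `wWord n π` and `wWord' n π`. -/
abbrev wt (i : ℕ) : FreeMonoid ℕ := v (2 * i + 2)

/-- The word `x y_{1π} ⋯ y_{nπ} x t₁ y₁ ⋯ tₙ yₙ`. -/
def wWord (n : ℕ) (π : Equiv.Perm (Fin n)) : FreeMonoid ℕ :=
  wx * (List.ofFn fun i => wy (π i)).prod * wx * (List.ofFn fun i : Fin n => wt i * wy i).prod

/-- The word `x² y_{1π} ⋯ y_{nπ} t₁ y₁ ⋯ tₙ yₙ`. -/
def wWord' (n : ℕ) (π : Equiv.Perm (Fin n)) : FreeMonoid ℕ :=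
  wx ^ 2 * (List.ofFn fun i => wy (π i)).prod * (List.ofFn fun i : Fin n => wt i * wy i).prod

/-- The variety `𝕁`. -/
def varJ : MonoidVariety.{u} := varIds
  ({(x * t * x, x * t * x ^ 2), (x ^ 2 * y ^ 2, y ^ 2 * x ^ 2),
    (x * y * t * x * y, y * x * t * x * y),
    (x * t₁ * x * t₂ * t₃ * x, x * t₁ * x * t₂ * x * t₃ * x)} ∪
    {p | ∃ (n : ℕ) (π : Equiv.Perm (Fin n)), p = (wWord n π, wWord' n π)})

/-! ## The monoids `E¹` and `B₀¹` -/

/-- The monoid `E¹`, where `E = ⟨e, c ∣ e² = e, c² = ec = 0, ce = c⟩ = {e, c, 0}`. -/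
inductive E1 : Type
  | one | e | c | zero

/-- The multiplication of `E¹`. -/
def E1.mul : E1 → E1 → E1
  | .one, m => m
  | m, .one => m
  | .e, .e => .e
  | .c, .e => .c
  | _, _ => .zero

instance : Monoid E1 where
  mul := E1.mul
  one := .one
  mul_assoc := by rintro ⟨⟩ ⟨⟩ ⟨⟩ <;> rfl
  one_mul := by rintro ⟨⟩ <;> rfl
  mul_one := by rintro ⟨⟩ <;> rfl

/-- The monoid `B₀¹`, where
`B₀ = ⟨e, f, c ∣ e² = e, f² = f, ef = fe = 0, ec = cf = c⟩ = {e, f, c, 0}`. -/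
inductive B01 : Type
  | one | e | f | c | zero

/-- The multiplication of `B₀¹`. -/
def B01.mul : B01 → B01 → B01
  | .one, m => m
  | m, .one => m
  | .e, .e => .e
  | .f, .f => .f
  | .e, .c => .c
  | .c, .f => .c
  | _, _ => .zero

instance : Monoid B01 where
  mul := B01.mul
  one := .one
  mul_assoc := by rintro ⟨⟩ ⟨⟩ ⟨⟩ <;> rfl
  one_mul := by rintro ⟨⟩ <;> rfl
  mul_one := by rintro ⟨⟩ <;> rfl

/-- The variety `𝔼 = var E¹`. -/
def varE : MonoidVariety.{u} := MonoidVariety.var E1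

/-- The variety `𝔹₀ = var B₀¹`. -/
def varB0 : MonoidVariety.{u} := MonoidVariety.var B01

/-! ## The congruence `λ` on the free monoid -/

/-- The congruence `τ₁` generated by the relations `a = a²` for all letters `a`. -/
def tauOne : Con (FreeMonoid ℕ) := conGen fun u w => ∃ a : ℕ, u = v a ∧ w = v a ^ 2

/-- The set of letters that occur at least twice in `u`. -/
def mulLetters (u : FreeMonoid ℕ) : Set ℕ := {a | 2 ≤ u.toList.count a}

/-- The letter `a` occurs at least twice in `u`, and its first two occurrences are adjacent. -/
def FirstTwoAdjacent (a : ℕ) (u : FreeMonoid ℕ) : Prop :=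
  ∃ p r : List ℕ, u.toList = p ++ a :: a :: r ∧ a ∉ p

/-- The relation `γ`. -/
def GammaRel (u w : FreeMonoid ℕ) : Prop := tauOne u w ∧ mulLetters u = mulLetters w

/-- The relation `λ`. -/
def LambdaRel (u w : FreeMonoid ℕ) : Prop :=
  GammaRel u w ∧ ∀ a ∈ mulLetters u, FirstTwoAdjacent a u ↔ FirstTwoAdjacent a w

/-- Auxiliary congruence: same first letter, same last letter, same content. -/
def endsCon : Con (FreeMonoid ℕ) where
  r u w := u.toList.head? = w.toList.head? ∧ u.toList.getLast? = w.toList.getLast? ∧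
    ∀ a, a ∈ u.toList ↔ a ∈ w.toList
  iseqv := ⟨fun _ => ⟨rfl, rfl, fun _ => Iff.rfl⟩,
    fun h => ⟨h.1.symm, h.2.1.symm, fun a => (h.2.2 a).symm⟩,
    fun h k => ⟨h.1.trans k.1, h.2.1.trans k.2.1, fun a => (h.2.2 a).trans (k.2.2 a)⟩⟩
  mul' := by
    rintro u w u' w' ⟨h1, h2, h3⟩ ⟨k1, k2, k3⟩
    simp only [FreeMonoid.toList_mul, List.head?_append, List.getLast?_append, List.mem_append,
      h1, h2, h3, k1, k2, k3, implies_true, and_self]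

theorem tauOne_ends {u w : FreeMonoid ℕ} (h : tauOne u w) : endsCon u w := by
  have : tauOne ≤ endsCon := by
    refine Con.conGen_le.2 ?_
    rintro _ _ ⟨a, rfl, rfl⟩
    refine ⟨?_, ?_, ?_⟩ <;> simp [pow_two]
  exact this h

theorem firstTwoAdjacent_cons (a b : ℕ) (l : List ℕ) :
    FirstTwoAdjacent a (FreeMonoid.ofList (b :: l)) ↔
      (b = a ∧ l.head? = some a) ∨ (b ≠ a ∧ FirstTwoAdjacent a (FreeMonoid.ofList l)) := by
  constructor
  · rintro ⟨p, r, h, hp⟩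
    simp only [FreeMonoid.toList_ofList] at h
    cases p with
    | nil => simp at h; left; simp [h]
    | cons c p =>
      simp only [List.cons_append, List.cons.injEq] at h
      simp only [List.mem_cons, not_or] at hp
      exact Or.inr ⟨fun hb => hp.1 (hb ▸ h.1), p, r, h.2, hp.2⟩
  · rintro (⟨rfl, h⟩ | ⟨hb, p, r, h, hp⟩)
    · cases l with
      | nil => simp at h
      | cons c l => simp at h; subst h; exact ⟨[], l, rfl, by simp⟩
    · refine ⟨b :: p, r, ?_, ?_⟩
      · simpa using h
      · simp [hp, hb.symm]

theorem FirstTwoAdjacent.mem_mul {a : ℕ} {u : FreeMonoid ℕ} (h : FirstTwoAdjacent a u) :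
    a ∈ mulLetters u := by
  obtain ⟨p, r, h, -⟩ := h
  simp [mulLetters, h]
  omega

theorem firstTwoAdjacent_mul (a : ℕ) (u w : FreeMonoid ℕ) :
    FirstTwoAdjacent a (u * w) ↔ FirstTwoAdjacent a u ∨
      (u.toList.count a = 1 ∧ u.toList.getLast? = some a ∧ w.toList.head? = some a) ∨
      (u.toList.count a = 0 ∧ FirstTwoAdjacent a w) := by
  suffices H : ∀ l : List ℕ, FirstTwoAdjacent a (FreeMonoid.ofList l * w) ↔
      FirstTwoAdjacent a (FreeMonoid.ofList l) ∨
        (l.count a = 1 ∧ l.getLast? = some a ∧ w.toList.head? = some a) ∨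
        (l.count a = 0 ∧ FirstTwoAdjacent a w) from H u.toList
  intro l
  induction l with
  | nil =>
    have h : ¬ FirstTwoAdjacent a (FreeMonoid.ofList []) := by
      intro h; simpa [mulLetters] using h.mem_mul
    have e : (FreeMonoid.ofList [] : FreeMonoid ℕ) * w = w := rfl
    rw [e]
    simp only [h]
    simp
  | cons b l ih =>
    have e : (FreeMonoid.ofList (b :: l) : FreeMonoid ℕ) * w
        = FreeMonoid.ofList (b :: (FreeMonoid.ofList l * w).toList) := rfl
    have e' : FreeMonoid.ofList (FreeMonoid.ofList l * w).toList = FreeMonoid.ofList l * w := rfl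
    rw [e, firstTwoAdjacent_cons, e', ih, firstTwoAdjacent_cons]
    by_cases hb : b = a
    · subst hb
      cases l with
      | nil => simp
      | cons c l =>
        have hl : ∀ m : List ℕ, m.getLast? = some b → b ∈ m := fun m hm =>
          List.mem_of_getLast? hm
        have key : ¬ (List.count b (c :: l) = 0 ∧ (c :: l).getLast? = some b) := by
          rintro ⟨h1, h2⟩
          exact List.count_eq_zero.1 h1 (hl _ h2)
        have e1 : (b :: c :: l).getLast? = (c :: l).getLast? := by simp [List.getLast?_cons_cons]
        simp only [FreeMonoid.toList_ofList, FreeMonoid.toList_mul, e1, List.count_cons_self]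
        simp only [List.cons_append, List.head?_cons, true_and, ne_eq, not_true_eq_false,
          false_and, or_false, Nat.add_eq_right, Nat.add_eq_zero_iff, one_ne_zero, and_false]
        constructor
        · intro h; exact Or.inl h
        · rintro (h | h)
          · exact h
          · exact absurd ⟨h.1, h.2.1⟩ key
    · cases l with
      | nil => simp [hb]
      | cons c l => simp [hb, List.getLast?_cons_cons]

theorem count_of_rel {u w : FreeMonoid ℕ} (h : GammaRel u w) (a : ℕ) :
    (u.toList.count a = 0 ↔ w.toList.count a = 0) ∧
      (u.toList.count a = 1 ↔ w.toList.count a = 1) := by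
  have h1 := (tauOne_ends h.1).2.2 a
  have h2 : a ∈ mulLetters u ↔ a ∈ mulLetters w := by rw [h.2]
  simp only [mulLetters, Set.mem_ofPred_eq] at h2
  rw [← List.count_pos_iff, ← List.count_pos_iff] at h1
  omega

/-- `λ` as a congruence on the free monoid. -/
def lam : Con (FreeMonoid ℕ) where
  r := LambdaRel
  iseqv := by
    refine ⟨fun u => ⟨⟨tauOne.refl u, rfl⟩, fun _ _ => Iff.rfl⟩, fun h => ?_, fun h k => ?_⟩
    · exact ⟨⟨tauOne.symm h.1.1, h.1.2.symm⟩, fun a ha => (h.2 a (h.1.2 ▸ ha)).symm⟩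
    · exact ⟨⟨tauOne.trans h.1.1 k.1.1, h.1.2.trans k.1.2⟩,
        fun a ha => (h.2 a ha).trans (k.2 a (h.1.2 ▸ ha))⟩
  mul' := by
    rintro u u' w w' ⟨h, h'⟩ ⟨k, k'⟩
    have full : ∀ {p q : FreeMonoid ℕ}, GammaRel p q →
        (∀ a ∈ mulLetters p, FirstTwoAdjacent a p ↔ FirstTwoAdjacent a q) →
        ∀ a, FirstTwoAdjacent a p ↔ FirstTwoAdjacent a q := fun hpq H a =>
      ⟨fun ha => (H a ha.mem_mul).1 ha, fun ha => (H a (hpq.2 ▸ ha.mem_mul)).2 ha⟩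
    refine ⟨⟨tauOne.mul h.1 k.1, ?_⟩, fun a _ => ?_⟩
    · ext a
      have h1 := count_of_rel h a
      have k1 := count_of_rel k a
      simp only [mulLetters, Set.mem_ofPred_eq, FreeMonoid.toList_mul, List.count_append]
      omega
    · rw [firstTwoAdjacent_mul, firstTwoAdjacent_mul, full h h' a, full k k' a,
        (count_of_rel h a).1, (count_of_rel h a).2, (tauOne_ends h.1).2.1, (tauOne_ends k.1).1]

/-! ## The monoids `M_τ(W)` -/

/-- `q ≤_τ p`: the `τ`-word `q` is a factor of the `τ`-word `p`. -/
def TauLE {τ : Con (FreeMonoid ℕ)} (q p : τ.Quotient) : Prop :=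
  ∃ l r : τ.Quotient, p = l * q * r

/-- The closure of a set of `τ`-words under `≤_τ`. -/
def tauClosure {τ : Con (FreeMonoid ℕ)} (W : Set τ.Quotient) : Set τ.Quotient :=
  {q | ∃ p ∈ W, TauLE q p}

/-- The Rees congruence of the ideal that is complementary to the `≤_τ`-closure of `W`. -/
def reesCon {τ : Con (FreeMonoid ℕ)} (W : Set τ.Quotient) : Con τ.Quotient where
  r p q := p = q ∨ (p ∉ tauClosure W ∧ q ∉ tauClosure W)
  iseqv := by
    refine ⟨fun _ => Or.inl rfl, ?_, ?_⟩
    · rintro p q (h | h)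
      · exact Or.inl h.symm
      · exact Or.inr h.symm
    · rintro p q r (rfl | h) (rfl | k)
      · exact Or.inl rfl
      · exact Or.inr k
      · exact Or.inr h
      · exact Or.inr ⟨h.1, k.2⟩
  mul' := by
    have left : ∀ p q : τ.Quotient, p ∉ tauClosure W → p * q ∉ tauClosure W := by
      rintro p q hp ⟨w, hw, l, r, rfl⟩
      exact hp ⟨_, hw, l, q * r, by simp only [mul_assoc]⟩
    have right : ∀ p q : τ.Quotient, q ∉ tauClosure W → p * q ∉ tauClosure W := by
      rintro p q hp ⟨w, hw, l, r, rfl⟩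
      exact hp ⟨_, hw, l * p, r, by simp only [mul_assoc]⟩
    rintro p q p' q' (rfl | h) (rfl | k)
    · exact Or.inl rfl
    · exact Or.inr ⟨right _ _ k.1, right _ _ k.2⟩
    · exact Or.inr ⟨left _ _ h.1, left _ _ h.2⟩
    · exact Or.inr ⟨left _ _ h.1, left _ _ h.2⟩

/-- The monoid `M_τ(W)`: the Rees quotient of the monoid of `τ`-words over the ideal of all
`τ`-words outside the `≤_τ`-closure of `W`. -/
abbrev MTau (τ : Con (FreeMonoid ℕ)) (W : Set τ.Quotient) : Type := (reesCon W).Quotient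

/-- The monoid `M_λ(W)`. -/
abbrev MLam (W : Set lam.Quotient) : Type := MTau lam W

/-- The `λ`-word `{n}` of a letter `n`. -/
def letter (n : ℕ) : lam.Quotient := (v n : FreeMonoid ℕ)

/-- The `λ`-word `n⁺ = {n², n³, …}` of a letter `n`. -/
def plus (n : ℕ) : lam.Quotient := ((v n ^ 2 : FreeMonoid ℕ) : lam.Quotient)

end LimitVar

namespace LimitVar

/-! ## Derivations in word theories -/

/-! A variety of monoids is determined by its identities (`le_of_holds`, Birkhoff's theorem), so
everything reduces to describing, for each of the five varieties, which pairs of words are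
identities. The description uses simple letters (those occurring once) as markers. `SameF` fixes the
content, the multiple letters, and the position of first and second occurrences relative to the
simple letters; `SameL` does the same for last occurrences. `SameI`, `SameH` and `SameJ` say that
the patterns `y⋯x⋯x⋯s⋯y`, `x⋯y⋯t⋯x⋯s⋯y` and `x⋯t⋯y⋯x⋯s⋯y` are present in both words or in neither;
these patterns are the copies of the `λ`-words `ba⁺sb⁺`, `abta⁺sb⁺` and `atba⁺sb⁺`. An identity
holds in `𝔽` iff `SameF`; in `𝔽 ∨ 𝔼̄` iff also `SameL`; in `ℍ` iff moreover `SameH`; in `𝕀` iff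
`SameF`, `SameL` and `SameI`; in `𝕁` iff `SameJ` holds in addition to these three.

Sufficiency is `Solvable.complete`. The identities of a subvariety of `𝕁` are closed under a few
rewriting rules (`WordTheory`). One word is turned into the other from left to right, by moving the
required letter forward past multiple letters. Such a move can be blocked only by a simple letter,
and then the blocked configuration is one of the three patterns, present in one word and absent from
the other, which contradicts the invariants. For `𝔽` all multiple letters are first appended to both
words, which reduces it to `𝕁` (`holds_varF_iff`).

Necessity comes from the monoids `M_λ(W)`. A substitution that erases all but a few letters sends
one side of an identity into a factor of an element of `W`; the other side must then fall into the
same `λ`-class, and the invariants are read off from that class (`sameF_of_sim`, `sameL_of_sim`,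
`sameI_of_sim`, `sameH_of_sim`, `sameJ_of_sim`). That `M_λ(W)` lies in its variety is checked on the
positions of letters in the words of the class. Both directions together show that `M_λ(W)`
generates the variety.

For the classification let `V` be a subvariety of `𝕁`. If some identity of `V` violates `SameF`,
then `V` satisfies `xtx ≈ x²tx`; this allows all multiple letters to be doubled, no pattern
survives, and `V` lies in `𝔹₀` (`le_varB0`). Otherwise `𝔽` is contained in `V`. Now `SameL`,
`SameH`, `SameI`, `SameJ` are tested in this order. As long as they hold, `V` contains the next
variety of the list; the first one violated gives, by substituting elements for the letters of the
pattern, the law that puts `V` inside the variety reached so far. -/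

/-- Rules for deducing identities between words that hold in every subvariety of `𝕁`. -/
structure WordTheory (E : List ℕ → List ℕ → Prop) : Prop where
  refl : ∀ u, E u u
  symm : ∀ {u w}, E u w → E w u
  trans : ∀ {u v w}, E u v → E v w → E u w
  dbl : ∀ {p q : List ℕ} {x : ℕ}, x ∈ p → E (p ++ x :: q) (p ++ x :: x :: q)
  comm : ∀ {p q : List ℕ} {x y : ℕ}, x ∈ p → y ∈ p → E (p ++ x :: y :: q) (p ++ y :: x :: q)
  ins : ∀ {p q : List ℕ} {x : ℕ}, 2 ≤ p.count x → x ∈ q → E (p ++ q) (p ++ x :: q)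
  swap : ∀ (p q r : List ℕ) (x y : ℕ),
    E (p ++ x :: y :: (q ++ x :: y :: r)) (p ++ y :: x :: (q ++ x :: y :: r))
  merge : ∀ {p q r : List ℕ} {x : ℕ}, (∀ y ∈ r, y ∈ q) →
    E (p ++ x :: (r ++ x :: q)) (p ++ x :: x :: (r ++ q))

theorem exists_last_occurrence {z : ℕ} {p : List ℕ} (h : z ∈ p) :
    ∃ p₁ p₂, p = p₁ ++ z :: p₂ ∧ z ∉ p₂ := by
  obtain ⟨a, b, h1, h2⟩ := List.eq_append_cons_of_mem (List.mem_reverse.2 h)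
  refine ⟨b.reverse, a.reverse, ?_, by simpa using h2⟩
  have := congrArg List.reverse h1
  simpa using this

theorem exists_first_occurrence {z : ℕ} {p : List ℕ} (h : z ∈ p) :
    ∃ p₁ p₂, p = p₁ ++ z :: p₂ ∧ z ∉ p₁ := by
  obtain ⟨a, b, h1, h2⟩ := List.eq_append_cons_of_mem h
  exact ⟨a, b, h1, h2⟩

namespace WordTheory

/-- Double the nonfirst occurrence of `z`, then push the new copy over `y`: by `comm` if `y` has
occurred before, by `merge` if `y` occurs later. -/
theorem copy_over_letter {E : List ℕ → List ℕ → Prop} (h : WordTheory E) {p q : List ℕ} {z y : ℕ}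
    (hz : z ∈ p) (hy : y ∈ p ∨ y ∈ q) :
    E (p ++ z :: y :: q) (p ++ z :: y :: z :: q) := by
  refine h.trans (h.dbl hz) ?_
  rcases hy with hy | hy
  · have := h.comm (p := p ++ [z]) (q := q) (x := z) (y := y) (by simp) (by simp [hy])
    simpa using this
  · have := h.merge (p := p) (q := q) (r := [y]) (x := z) (by simpa using hy)
    exact h.symm (by simpa using this)

/-- The copy of `z` travels over `r` one letter at a time; each intermediate copy is removed again
once the next one is in place. -/
theorem copy_over {E : List ℕ → List ℕ → Prop} (h : WordTheory E) {q : List ℕ} {z : ℕ} :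
    ∀ {r p : List ℕ}, z ∈ p → (∀ y ∈ r, 2 ≤ (p ++ z :: (r ++ q)).count y) →
      E (p ++ z :: (r ++ q)) (p ++ z :: (r ++ z :: q)) := by
  intro r
  induction r with
  | nil => intro p hz _; exact h.dbl hz
  | cons y r ih =>
    intro p hz hr
    -- The suffix is kept general because the step is applied before the final copy is made (`s =
    -- q`) and, reversed, after it (`s = z :: q`).
    have h1 : ∀ s : List ℕ, (∀ c ∈ q, c ∈ s) →
        E (p ++ z :: y :: (r ++ s)) (p ++ z :: y :: z :: (r ++ s)) := by
      intro s hs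
      apply h.copy_over_letter hz
      have := hr y (by simp)
      by_contra! hc
      have h2 : y ∉ q := fun hq => hc.2 (by simp [hs y hq])
      have h3 : y ∉ r := fun hq => hc.2 (by simp [hq])
      have h4 : z ≠ y := fun e => hc.1 (e ▸ hz)
      simp [List.count_append, List.count_eq_zero.2 h2,
        List.count_eq_zero.2 h3, List.count_eq_zero.2 hc.1, h4] at this
    have h2 := ih (p := p ++ [z, y]) (by simp) (by
      intro c hc
      have := hr c (by simp [hc])
      simp only [List.count_append, List.count_cons, List.cons_append, List.append_assoc,
        List.nil_append] at this ⊢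
      omega)
    refine h.trans (h1 q fun _ => id) (h.trans (by simpa using h2) ?_)
    exact h.symm (by simpa using h1 (z :: q) (by simp +contextual))

/-- Insertion of a further occurrence of a letter that has occurred at least twice. -/
theorem insert {E : List ℕ → List ℕ → Prop} (h : WordTheory E) {p q : List ℕ} {z : ℕ}
    (hz : 2 ≤ p.count z)
    (hq : z ∈ q ∨ ∃ p₁ p₂, p = p₁ ++ z :: p₂ ∧ z ∉ p₂ ∧ ∀ y ∈ p₂, 2 ≤ (p ++ q).count y) :
    E (p ++ q) (p ++ z :: q) := by
  rcases hq with hq | ⟨p₁, p₂, rfl, h2, h3⟩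
  · exact h.ins hz hq
  · have h1 : z ∈ p₁ := by
      rw [← List.count_pos_iff]
      simp [List.count_append, List.count_eq_zero.2 h2] at hz
      simpa using hz
    have := h.copy_over (q := q) (r := p₂) h1 (by simpa using h3)
    simpa using this

theorem insert_end {E : List ℕ → List ℕ → Prop} (h : WordTheory E) {p r q : List ℕ} {y : ℕ}
    (hy : y ∈ r) (hc : 2 ≤ (p ++ r).count y) (hr : ∀ c ∈ r, 2 ≤ (p ++ (r ++ q)).count c) :
    E (p ++ (r ++ q)) (p ++ (r ++ y :: q)) := by
  have := h.insert (p := p ++ r) (q := q) (z := y) hc (by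
    obtain ⟨a, b, rfl, hb⟩ := exists_last_occurrence hy
    refine Or.inr ⟨p ++ a, b, by simp, hb, fun c hc => ?_⟩
    simpa using hr c (by simp [hc]))
  simpa using this

theorem insert_end_list {E : List ℕ → List ℕ → Prop} (h : WordTheory E) {p r q : List ℕ}
    (hr : ∀ c ∈ r, 2 ≤ (p ++ (r ++ q)).count c) :
    ∀ {m : List ℕ}, (∀ y ∈ m, y ∈ r ∧ 2 ≤ (p ++ r).count y) →
      E (p ++ (r ++ q)) (p ++ (r ++ (m ++ q))) := by
  intro m
  induction m with
  | nil => intro _; exact h.refl _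
  | cons y m ih =>
    intro hm
    refine h.trans (ih fun c hc => hm c (by simp [hc])) ?_
    refine h.insert_end (hm y (by simp)).1 (hm y (by simp)).2 fun c hc => ?_
    have := hr c hc
    simp only [List.count_append] at this ⊢
    omega

/-- The second occurrence of a letter can be moved to the first one if all letters between them
are multiple. -/
theorem merge_of_multiple {E : List ℕ → List ℕ → Prop} (h : WordTheory E) {p q r : List ℕ} {x : ℕ}
    (hr : ∀ y ∈ r, 2 ≤ (p ++ x :: (r ++ x :: q)).count y) :
    E (p ++ x :: (r ++ x :: q)) (p ++ x :: x :: (r ++ q)) := by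
  -- `merge` needs every letter of `r` to recur in the suffix. The letters of `r` missing from `q`
  -- are multiple, so they can be inserted in front of `q` on both sides, and removed afterwards.
  set m := r.filter (· ∉ q) with hm
  have hmr : ∀ y ∈ m, y ∈ r ∧ y ∉ q := by
    intro y hy
    simpa [hm] using hy
  have h1 : E (p ++ x :: (r ++ x :: q)) (p ++ x :: (r ++ x :: (m ++ q))) := by
    have := h.insert_end_list (p := p ++ [x]) (r := r ++ [x]) (q := q) (m := m) ?_ ?_
    · simpa using this
    · intro c hc
      simp only [List.mem_append, List.mem_singleton] at hc
      rcases hc with hc | rfl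
      · simpa using hr c hc
      · simp [List.count_append]; omega
    · intro y hy
      refine ⟨by simp [(hmr y hy).1], ?_⟩
      have := hr y (hmr y hy).1
      simp only [List.count_append, List.count_cons, List.count_eq_zero.2 (hmr y hy).2,
        List.count_nil] at this ⊢
      omega
  have h2 : E (p ++ x :: x :: (r ++ q)) (p ++ x :: x :: (r ++ (m ++ q))) := by
    have := h.insert_end_list (p := p ++ [x, x]) (r := r) (q := q) (m := m) ?_ ?_
    · simpa using this
    · intro c hc
      have := hr c hc
      simp only [List.count_append, List.count_cons, List.append_assoc, List.cons_append,
        List.nil_append] at this ⊢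
      omega
    · intro y hy
      refine ⟨(hmr y hy).1, ?_⟩
      have := hr y (hmr y hy).1
      simp only [List.count_append, List.count_cons, List.count_eq_zero.2 (hmr y hy).2,
        List.count_nil] at this ⊢
      omega
  refine h.trans h1 (h.trans ?_ (h.symm h2))
  have := h.merge (p := p) (q := m ++ q) (r := r) (x := x) (by
    intro y hy
    by_cases hq : y ∈ q
    · simp [hq]
    · simp [hm, hy, hq])
  simpa using this

end WordTheory

/-! ### Swaps of adjacent letters and the simple letters that obstruct them -/

namespace WordTheory

theorem two_le_count_of_mem {c : ℕ} {w : List ℕ} (h : c ∈ w) (h1 : w.count c ≠ 1) :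
    2 ≤ w.count c := by
  have := List.count_pos_iff.2 h
  omega

/-- If a copy of `y` can be put in front of the next `z` in both words, the rule `swap` applies
between them. -/
theorem swap_of_insert {E : List ℕ → List ℕ → Prop} (h : WordTheory E) {p a b : List ℕ} {y z : ℕ}
    (h1 : E (p ++ y :: z :: (a ++ z :: b)) (p ++ y :: z :: (a ++ y :: z :: b)))
    (h2 : E (p ++ z :: y :: (a ++ z :: b)) (p ++ z :: y :: (a ++ y :: z :: b))) :
    E (p ++ y :: z :: (a ++ z :: b)) (p ++ z :: y :: (a ++ z :: b)) :=
  h.trans h1 (h.trans (h.swap p a b y z) (h.symm h2))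

/-- A nonfirst occurrence of `z` is adjacent to an occurrence of `y` that is not the last one:
they commute unless a simple letter separates the last `z` from the next `y`. -/
theorem swap_nonfirst {E : List ℕ → List ℕ → Prop} (h : WordTheory E) {p q : List ℕ} {y z : ℕ}
    (hz : z ∈ p) (hy : y ∈ q) :
    E (p ++ z :: y :: q) (p ++ y :: z :: q) ∨
      ∃ s q₁ q₂, q = q₁ ++ s :: q₂ ∧ (p ++ z :: y :: q).count s = 1 ∧ z ∉ q₂ ∧ y ∉ q₁ := by
  rcases eq_or_ne z y with rfl | hne
  · exact Or.inl (h.refl _)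
  obtain ⟨a, b, rfl, ha⟩ := exists_first_occurrence hy
  have hz' := List.count_pos_iff.2 hz
  by_cases hs : ∃ s a₁ a₂, a = a₁ ++ s :: a₂ ∧ (p ++ z :: y :: (a ++ y :: b)).count s = 1 ∧
      z ∉ a₂ ++ y :: b
  · obtain ⟨s, a₁, a₂, rfl, h1, h2⟩ := hs
    refine Or.inr ⟨s, a₁, a₂ ++ y :: b, by simp, by simpa using h1, h2, fun hc => ha (by simp [hc])⟩
  · left
    -- The list `l` stands for both orders of the pair `z`, `y`: in either word a copy of `z` can be
    -- inserted in front of the next `y`, because no simple letter lies between.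
    have key : ∀ l : List ℕ, 1 ≤ l.count z → (∀ c, 2 ≤ (p ++ z :: y :: (a ++ y :: b)).count c →
        2 ≤ (p ++ (l ++ (a ++ y :: b))).count c) →
        (z ∈ y :: b ∨ z ∈ a ∨ ∃ l₁ l₂, l = l₁ ++ z :: l₂ ∧ z ∉ l₂ ∧
          ∀ c ∈ l₂, 2 ≤ (p ++ z :: y :: (a ++ y :: b)).count c) →
        E (p ++ (l ++ (a ++ y :: b))) (p ++ (l ++ (a ++ z :: y :: b))) := by
      intro l hl hc hcase
      have := h.insert (p := p ++ (l ++ a)) (q := y :: b) (z := z)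
        (by simp only [List.count_append]; omega) ?_
      · simpa using this
      by_cases hb : z ∈ y :: b
      · exact Or.inl hb
      right
      by_cases hza : z ∈ a
      · obtain ⟨a₁, a₂, rfl, h2⟩ := exists_last_occurrence hza
        refine ⟨p ++ (l ++ a₁), a₂, by simp, h2, fun c hca => ?_⟩
        have h3 := hc c (two_le_count_of_mem (by simp [hca]) (fun h1 => by
          obtain ⟨a₃, a₄, rfl⟩ := List.append_of_mem hca
          refine hs ⟨c, a₁ ++ z :: a₃, a₄, by simp, h1, ?_⟩
          simp at h2 hb ⊢
          tauto))
        simpa using h3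
      · obtain ⟨l₁, l₂, rfl, h2, h3⟩ := (hcase.resolve_left hb).resolve_left hza
        refine ⟨p ++ l₁, l₂ ++ a, by simp, by simp [h2, hza], fun c hca => ?_⟩
        have h4 := hc c (by
          rcases List.mem_append.1 hca with hca | hca
          · exact h3 c hca
          · refine two_le_count_of_mem (by simp [hca]) (fun h1 => ?_)
            obtain ⟨a₃, a₄, rfl⟩ := List.append_of_mem hca
            refine hs ⟨c, a₃, a₄, by simp, h1, ?_⟩
            simp at hza hb ⊢
            tauto)
        simpa using h4
    have h1 := key [z, y] (by simp) (by simp) (Or.inr (Or.inr ⟨[], [y], by simp, by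
      simpa using hne, by
        simp [List.count_append, List.count_cons]; omega⟩))
    have h2 := key [y, z] (by simp [List.count_cons]) (by
      intro c hc
      simp only [List.count_append, List.count_cons, List.cons_append, List.nil_append] at hc ⊢
      omega) (Or.inr (Or.inr ⟨[y], [], by simp, by simp, by simp⟩))
    exact h.swap_of_insert (by simpa using h1) (by simpa using h2)

/-- Both `y` and `z` occur later and the next `y` precedes the next `z`: they commute unless a
simple letter separates the last `y` from the next `z`. -/
theorem swap_of_later {E : List ℕ → List ℕ → Prop} (h : WordTheory E) {p a b : List ℕ} {y z : ℕ}
    (ha : z ∉ a) (hya : y ∈ a) (hyz : y ≠ z) :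
    (E (p ++ y :: z :: (a ++ z :: b)) (p ++ z :: y :: (a ++ z :: b))) ∨
      ∃ s a₁ a₂, a = a₁ ++ s :: a₂ ∧ (p ++ y :: z :: (a ++ z :: b)).count s = 1 ∧
        y ∉ a₂ ++ z :: b ∧ y ∈ a₁ := by
  obtain ⟨a₁, a₂, rfl, h2⟩ := exists_last_occurrence hya
  by_cases hs : y ∉ b ∧ ∃ c ∈ a₂, (p ++ y :: z :: (a₁ ++ y :: a₂ ++ z :: b)).count c = 1
  · obtain ⟨hb, c, hc, h1⟩ := hs
    obtain ⟨a₃, a₄, rfl⟩ := List.append_of_mem hc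
    refine Or.inr ⟨c, a₁ ++ y :: a₃, a₄, by simp, h1, ?_, by simp⟩
    simp at h2 ⊢
    tauto
  · left
    have key : ∀ l : List ℕ, 1 ≤ l.count y → (∀ c, 2 ≤ (p ++ y :: z :: (a₁ ++ y :: a₂ ++ z :: b)).count c →
        2 ≤ (p ++ (l ++ (a₁ ++ y :: a₂ ++ z :: b))).count c) →
        E (p ++ (l ++ (a₁ ++ y :: a₂ ++ z :: b))) (p ++ (l ++ (a₁ ++ y :: a₂ ++ y :: z :: b))) := by
      intro l hl hc
      have := h.insert (p := p ++ (l ++ (a₁ ++ y :: a₂))) (q := z :: b) (z := y)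
        (by simp only [List.count_append, List.count_cons_self]; omega) ?_
      · simpa using this
      by_cases hb : y ∈ b
      · simp [hb]
      · refine Or.inr ⟨p ++ (l ++ a₁), a₂, by simp, h2, fun c hca => ?_⟩
        have := hc c (two_le_count_of_mem (by simp [hca]) (fun h1 => hs ⟨hb, c, hca, h1⟩))
        simpa using this
    have h1 := key [y, z] (by simp) (by simp)
    have h2 := key [z, y] (by simp [List.count_cons]) (by
      intro c hc
      simp only [List.count_append, List.count_cons, List.cons_append, List.nil_append] at hc ⊢
      omega)
    exact h.swap_of_insert (by simpa using h1) (by simpa using h2)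

end WordTheory

/-! ## Invariants of words -/

/-- The part of a word before the first occurrence of a letter. -/
def bef (t : ℕ) (u : List ℕ) : List ℕ := u.takeWhile (· ≠ t)

/-- The part of a word after the first occurrence of a letter. -/
def aft (t : ℕ) (u : List ℕ) : List ℕ := (u.dropWhile (· ≠ t)).tail

theorem bef_append_cons {t : ℕ} {p : List ℕ} (h : t ∉ p) (q : List ℕ) :
    bef t (p ++ t :: q) = p := by
  induction p with
  | nil => simp [bef]
  | cons c p ih =>
    simp only [List.mem_cons, not_or] at h
    have h1 : c ≠ t := fun e => h.1 e.symm
    have := ih h.2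
    simp only [bef] at this ⊢
    simpa [h1] using this

theorem aft_append_cons {t : ℕ} {p : List ℕ} (h : t ∉ p) (q : List ℕ) :
    aft t (p ++ t :: q) = q := by
  induction p with
  | nil => simp [aft]
  | cons c p ih =>
    simp only [List.mem_cons, not_or] at h
    have h1 : c ≠ t := fun e => h.1 e.symm
    have := ih h.2
    simp only [aft] at this ⊢
    simpa [h1] using this

theorem bef_append_of_not_mem {t : ℕ} {p : List ℕ} (h : t ∉ p) (q : List ℕ) :
    bef t (p ++ q) = p ++ bef t q := by
  induction p with
  | nil => simp
  | cons c p ih =>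
    simp only [List.mem_cons, not_or] at h
    have h1 : c ≠ t := fun e => h.1 e.symm
    have := ih h.2
    simp only [bef] at this ⊢
    simpa [h1] using this

theorem bef_append_of_mem {t : ℕ} {p : List ℕ} (h : t ∈ p) (q : List ℕ) :
    bef t (p ++ q) = bef t p := by
  obtain ⟨a, b, rfl, ha⟩ := exists_first_occurrence h
  rw [List.append_assoc, List.cons_append, bef_append_cons ha, bef_append_cons ha]

theorem eq_bef_append_aft {t : ℕ} {u : List ℕ} (h : t ∈ u) :
    u = bef t u ++ t :: aft t u := by
  obtain ⟨a, b, rfl, ha⟩ := exists_first_occurrence h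
  rw [bef_append_cons ha, aft_append_cons ha]

theorem not_mem_bef (t : ℕ) (u : List ℕ) : t ∉ bef t u := by
  intro h
  have := List.mem_takeWhile_imp h
  simp at this

/-- Same content, same simple letters, and the same position of the first and second occurrences
of the letters relative to the simple letters. -/
structure SameF (u w : List ℕ) : Prop where
  mem : ∀ x, x ∈ u ↔ x ∈ w
  two : ∀ x, 2 ≤ u.count x ↔ 2 ≤ w.count x
  bef_mem : ∀ t x, (u.count t = 1 ∧ x ∈ bef t u) ↔ (w.count t = 1 ∧ x ∈ bef t w)
  bef_two : ∀ t x, (u.count t = 1 ∧ 2 ≤ (bef t u).count x) ↔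
    (w.count t = 1 ∧ 2 ≤ (bef t w).count x)

/-- Same position of the last occurrences relative to the simple letters. -/
def SameL (u w : List ℕ) : Prop :=
  ∀ t x, (u.count t = 1 ∧ x ∈ aft t u) ↔ (w.count t = 1 ∧ x ∈ aft t w)

/-- `s` is a simple letter after the last occurrence of the multiple letter `x` and between the
first and the second occurrence of `y`. -/
def Sep (x y s : ℕ) (u : List ℕ) : Prop :=
  u.count s = 1 ∧ 2 ≤ u.count x ∧ x ∉ aft s u ∧ (bef s u).count y = 1 ∧ y ∈ aft s u

/-- The pattern `y ⋯ x ⋯ x ⋯ s ⋯ y`. -/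
def PatI (x y s : ℕ) (u : List ℕ) : Prop := Sep x y s u ∧ x ∉ bef y u

/-- The pattern `x ⋯ y ⋯ t ⋯ x ⋯ s ⋯ y`. -/
def PatH (x y t s : ℕ) (u : List ℕ) : Prop :=
  Sep x y s u ∧ u.count t = 1 ∧ (bef t u).count x = 1 ∧ y ∈ bef t u ∧ y ∉ bef x u

/-- The pattern `x ⋯ t ⋯ y ⋯ x ⋯ s ⋯ y`. -/
def PatJ (x y t s : ℕ) (u : List ℕ) : Prop :=
  Sep x y s u ∧ u.count t = 1 ∧ (bef t u).count x = 1 ∧ y ∉ bef t u ∧ (bef y u).count x = 1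

def SameI (u w : List ℕ) : Prop := ∀ x y s, PatI x y s u ↔ PatI x y s w
def SameH (u w : List ℕ) : Prop := ∀ x y t s, PatH x y t s u ↔ PatH x y t s w
def SameJ (u w : List ℕ) : Prop := ∀ x y t s, PatJ x y t s u ↔ PatJ x y t s w

namespace SameF

variable {u v w : List ℕ}

theorem symm (h : SameF u w) : SameF w u :=
  ⟨fun x => (h.mem x).symm, fun x => (h.two x).symm, fun t x => (h.bef_mem t x).symm,
    fun t x => (h.bef_two t x).symm⟩

theorem trans (h : SameF u v) (k : SameF v w) : SameF u w :=
  ⟨fun x => (h.mem x).trans (k.mem x), fun x => (h.two x).trans (k.two x),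
    fun t x => (h.bef_mem t x).trans (k.bef_mem t x),
    fun t x => (h.bef_two t x).trans (k.bef_two t x)⟩

theorem count_eq_one (h : SameF u w) (x : ℕ) : u.count x = 1 ↔ w.count x = 1 := by
  have h1 := h.mem x
  have h2 := h.two x
  rw [← List.count_pos_iff, ← List.count_pos_iff] at h1
  omega

theorem mem_bef (h : SameF u w) {t : ℕ} (ht : u.count t = 1) (x : ℕ) :
    x ∈ bef t u ↔ x ∈ bef t w := by
  have h1 := h.bef_mem t x
  have h2 := h.count_eq_one t
  tauto

theorem two_bef (h : SameF u w) {t : ℕ} (ht : u.count t = 1) (x : ℕ) :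
    2 ≤ (bef t u).count x ↔ 2 ≤ (bef t w).count x := by
  have h1 := h.bef_two t x
  have h2 := h.count_eq_one t
  tauto

theorem bef_count_eq_one (h : SameF u w) {t : ℕ} (ht : u.count t = 1) (x : ℕ) :
    (bef t u).count x = 1 ↔ (bef t w).count x = 1 := by
  have h1 := h.mem_bef ht x
  have h2 := h.two_bef ht x
  rw [← List.count_pos_iff, ← List.count_pos_iff] at h1
  omega

theorem mem_aft (h : SameF u w) (h' : SameL u w) {t : ℕ} (ht : u.count t = 1) (x : ℕ) :
    x ∈ aft t u ↔ x ∈ aft t w := by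
  have h1 := h' t x
  have h2 := h.count_eq_one t
  tauto

theorem sep (h : SameF u w) (h' : SameL u w) {x y s : ℕ} (hs : Sep x y s u) : Sep x y s w := by
  obtain ⟨h1, h2, h3, h4, h5⟩ := hs
  exact ⟨(h.count_eq_one s).1 h1, (h.two x).1 h2, fun k => h3 ((h.mem_aft h' h1 x).2 k),
    (h.bef_count_eq_one h1 y).1 h4, (h.mem_aft h' h1 y).1 h5⟩

end SameF

/-- A word theory together with invariants that determine the identities of the theory. -/
structure Solvable (E C : List ℕ → List ℕ → Prop) : Prop extends WordTheory E where
  c_symm : ∀ {u w}, C u w → C w u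
  c_trans : ∀ {u v w}, C u v → C v w → C u w
  sound : ∀ {u w}, E u w → C u w
  sameF : ∀ {u w}, C u w → SameF u w
  sameL : ∀ {u w}, C u w → SameL u w
  -- Whenever a swap is obstructed by simple letters, either the obstruction is a pattern preserved
  -- by `C`, or the theory has a law that performs the swap anyway. This field treats a second
  -- occurrence next to a first one, the next field two first occurrences.
  second_first : (∀ {u w}, C u w → SameJ u w) ∨
    ∀ (p q : List ℕ) (y z : ℕ), z ∈ p → y ∈ q → E (p ++ z :: y :: q) (p ++ y :: z :: q)
  first_first : (∀ {u w}, C u w → SameI u w) ∨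
    ((∀ {u w}, C u w → SameH u w) ∧
      ∀ (p q : List ℕ) (x y : ℕ), y ∈ q → E (p ++ x :: x :: y :: q) (p ++ y :: x :: x :: q)) ∨
    ∀ (p q : List ℕ) (x y : ℕ), x ∈ q → y ∈ q → E (p ++ x :: y :: q) (p ++ y :: x :: q)

/-! ### Swaps that the invariants make possible -/

namespace Solvable

open WordTheory

/-- By `swap_of_later` the swap is obstructed only by a simple `s` lying after the last occurrence
of one of the two letters and before the second occurrence of the other. Since the target word has
its first `z` before its first `y`, the words then differ in pattern I, or in pattern H if a simple
letter also separates the first two occurrences of the former letter. -/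
theorem swap_first_first {E C : List ℕ → List ℕ → Prop} (h : Solvable E C) {p q r v : List ℕ}
    {y z : ℕ} (hC : C (r ++ y :: z :: q) (p ++ z :: v)) (hyz : y ≠ z) (hyq : y ∈ q) (hzq : z ∈ q)
    (hyr : y ∉ r) (hzr : z ∉ r) (hyp : y ∉ p) (hzp : z ∉ p) :
    E (r ++ y :: z :: q) (r ++ z :: y :: q) := by
  have hF := h.sameF hC
  have hL := h.sameL hC
  set W := r ++ y :: z :: q with hW
  set V := p ++ z :: v with hV
  have hyV : y ∈ V := (hF.mem y).1 (by simp [hW])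
  have by_W : bef y W = r := bef_append_cons hyr _
  have bz_W : bef z W = r ++ [y] := by
    rw [show W = (r ++ [y]) ++ z :: q by simp [hW]]
    exact bef_append_cons (by simp [hzr, hyz.symm]) _
  have bz_V : bef z V = p := bef_append_cons hzp _
  have by_V : z ∈ bef y V := by
    rw [show V = (p ++ [z]) ++ v by simp [hV], bef_append_of_not_mem (by simp [hyp, hyz])]
    simp
  have bef_aft : ∀ s q₁ q₂, W.count s = 1 → q = q₁ ++ s :: q₂ →
      bef s W = r ++ y :: z :: q₁ ∧ aft s W = q₂ := by
    rintro s q₁ q₂ h1 rfl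
    have h2 : s ∉ r ++ y :: z :: q₁ := by
      intro hs
      have := List.count_pos_iff.2 hs
      simp only [hW, List.count_append, List.count_cons, beq_self_eq_true, if_true] at h1 this
      omega
    rw [show W = (r ++ y :: z :: q₁) ++ s :: q₂ by simp [hW]]
    exact ⟨bef_append_cons h2 _, aft_append_cons h2 _⟩
  have first : (∃ a b, q = a ++ z :: b ∧ z ∉ a ∧ y ∈ a) ∨ ∃ a b, q = a ++ y :: b ∧ y ∉ a ∧ z ∈ a := by
    obtain ⟨a, b, hab, ha⟩ := exists_first_occurrence hzq
    by_cases hya : y ∈ a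
    · exact Or.inl ⟨a, b, hab, ha, hya⟩
    · subst hab
      obtain ⟨c, d, hcd, hc⟩ := exists_first_occurrence (p := b) (z := y) (by
        simpa [hya, hyz] using hyq)
      exact Or.inr ⟨a ++ z :: c, d, by simp [hcd], by simp [hya, hyz, hc], by simp⟩
  have multiple : ∀ {c : ℕ} {a : List ℕ}, (∀ t ∈ a, W.count t ≠ 1) → (∀ t ∈ a, t ∈ q) → c ∈ a →
      2 ≤ W.count c := fun h1 h2 hc =>
    two_le_count_of_mem (by simp [hW, h2 _ hc]) (h1 _ hc)
  rcases first with ⟨a, b, hq, hza, hya⟩ | ⟨a, b, hq, hya, hza⟩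
  · rcases h.toWordTheory.swap_of_later (p := r) (b := b) hza hya hyz with
      h1 | ⟨s, a₁, a₂, ha, hs, hy2, hy1⟩
    · rwa [← hq] at h1
    rw [← hq, ← hW] at hs
    obtain ⟨hbs, has⟩ := bef_aft s a₁ (a₂ ++ z :: b) hs (by simp [hq, ha])
    have hza1 : z ∉ a₁ := fun hc => hza (by simp [ha, hc])
    have sepW : Sep y z s W := by
      refine ⟨hs, ?_, by rwa [has], ?_, by simp [has]⟩
      · have := List.count_pos_iff.2 hyq
        simp only [hW, List.count_append, List.count_cons, beq_self_eq_true, if_true]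
        omega
      · rw [hbs]
        simp [List.count_append, List.count_eq_zero.2 hzr,
          List.count_eq_zero.2 hza1, hyz]
    have sepV := hF.sep hL sepW
    rcases h.first_first with hI | ⟨hH, hσ⟩ | hσ
    -- In `V` the first `z` precedes every `y`, so `V` has pattern I; in `W` a `y` stands directly
    -- before the first `z`, so `W` does not.
    · have := (hI hC y z s).2 ⟨sepV, by rwa [bz_V]⟩
      exact absurd this.2 (by simp [bz_W])
    · obtain ⟨c, d, hcd, hyc⟩ := exists_first_occurrence hy1
      by_cases ht : ∃ t ∈ c, W.count t = 1
      · obtain ⟨t, htc, ht⟩ := ht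
        obtain ⟨c₁, c₂, rfl⟩ := List.append_of_mem htc
        obtain ⟨hbt, hat⟩ := bef_aft t c₁ (c₂ ++ y :: d ++ s :: (a₂ ++ z :: b)) ht
          (by simp [hq, ha, hcd])
        have hyc1 : y ∉ c₁ := fun hc => hyc (by simp [hc])
        have := (hH hC y z t s).1 ⟨sepW, ht, by
          rw [hbt]
          simp [List.count_append, List.count_eq_zero.2 hyr,
            List.count_eq_zero.2 hyc1, hyz.symm], by simp [hbt], by rwa [by_W]⟩
        exact absurd by_V this.2.2.2.2
      · push Not at ht
        have hq' : q = c ++ y :: (d ++ s :: (a₂ ++ z :: b)) := by simp [hq, ha, hcd]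
        have hc2 : ∀ t ∈ c, 2 ≤ W.count t := fun t ht' =>
          multiple ht (fun _ h => by simp [hq', h]) ht'
        have hz2 : 2 ≤ W.count z := by
          have := List.count_pos_iff.2 hzq
          simp only [hW, List.count_append, List.count_cons, beq_self_eq_true, if_true]
          omega
        -- Without a simple letter in `c` the first two occurrences of `y` can be made adjacent in
        -- both words, and `hσ` moves `z` over `yy`.
        have e1 := h.merge_of_multiple (p := r) (r := z :: c) (q := d ++ s :: (a₂ ++ z :: b))
          (x := y) (by
            rw [hW, hq'] at hc2 hz2
            intro t ht
            rcases List.mem_cons.1 ht with rfl | ht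
            · simpa using hz2
            · simpa using hc2 t ht)
        have e2 := h.merge_of_multiple (p := r ++ [z]) (r := c) (q := d ++ s :: (a₂ ++ z :: b))
          (x := y) (by
            rw [hW, hq'] at hc2
            intro t ht
            have := hc2 t ht
            simp only [List.count_append, List.count_cons, List.count_nil] at this ⊢
            omega)
        have e3 := hσ r (c ++ (d ++ s :: (a₂ ++ z :: b))) y z (by simp)
        rw [hW, hq']
        exact h.trans (by simpa using e1) (h.trans (by simpa using e3) (h.symm (by simpa using e2)))
    · exact hσ _ _ _ _ hyq hzq
  · rcases h.toWordTheory.swap_of_later (p := r) (b := b) hya hza hyz.symm with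
      h1 | ⟨s, a₁, a₂, ha, hs, hz2, hz1⟩
    · rw [← hq] at h1
      exact h.symm h1
    have hWc : ∀ c, W.count c = (r ++ z :: y :: q).count c := by
      intro c
      simp only [hW, List.count_append, List.count_cons]
      omega
    rw [← hq, ← hWc] at hs
    obtain ⟨hbs, has⟩ := bef_aft s a₁ (a₂ ++ y :: b) hs (by simp [hq, ha])
    have hya1 : y ∉ a₁ := fun hc => hya (by simp [ha, hc])
    have sepW : Sep z y s W := by
      refine ⟨hs, ?_, by rwa [has], ?_, by simp [has]⟩
      · have := List.count_pos_iff.2 hzq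
        simp only [hW, List.count_append, List.count_cons, beq_self_eq_true, if_true]
        omega
      · rw [hbs]
        simp [List.count_append, List.count_eq_zero.2 hyr,
          List.count_eq_zero.2 hya1, hyz.symm]
    have sepV := hF.sep hL sepW
    rcases h.first_first with hI | ⟨hH, hσ⟩ | hσ
    · have := (hI hC z y s).1 ⟨sepW, by rwa [by_W]⟩
      exact absurd by_V this.2
    · obtain ⟨c, d, hcd, hzc⟩ := exists_first_occurrence hz1
      by_cases ht : ∃ t ∈ c, W.count t = 1
      · obtain ⟨t, htc, ht⟩ := ht
        obtain ⟨c₁, c₂, rfl⟩ := List.append_of_mem htc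
        obtain ⟨hbt, hat⟩ := bef_aft t c₁ (c₂ ++ z :: d ++ s :: (a₂ ++ y :: b)) ht
          (by simp [hq, ha, hcd])
        have hzc1 : z ∉ c₁ := fun hc => hzc (by simp [hc])
        have := (hH hC z y t s).2 ⟨sepV, (hF.count_eq_one t).1 ht, (hF.bef_count_eq_one ht z).1 (by
          rw [hbt]
          simp [List.count_append, List.count_eq_zero.2 hzr,
            List.count_eq_zero.2 hzc1, hyz]), (hF.mem_bef ht y).1 (by simp [hbt]), by rwa [bz_V]⟩
        exact absurd this.2.2.2.2 (by simp [bz_W])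
      · push Not at ht
        have hq' : q = c ++ z :: (d ++ s :: (a₂ ++ y :: b)) := by simp [hq, ha, hcd]
        have hc2 : ∀ t ∈ c, 2 ≤ W.count t := fun t ht' =>
          multiple ht (fun _ h => by simp [hq', h]) ht'
        have hy2 : 2 ≤ W.count y := by
          have := List.count_pos_iff.2 hyq
          simp only [hW, List.count_append, List.count_cons, beq_self_eq_true, if_true]
          omega
        have e1 := h.merge_of_multiple (p := r) (r := y :: c) (q := d ++ s :: (a₂ ++ y :: b))
          (x := z) (by
            rw [hW, hq'] at hc2 hy2
            intro t ht
            have h2 : 2 ≤ (r ++ y :: z :: (c ++ z :: (d ++ s :: (a₂ ++ y :: b)))).count t := by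
              rcases List.mem_cons.1 ht with rfl | ht
              · exact hy2
              · exact hc2 t ht
            simp only [List.count_append, List.count_cons, List.cons_append] at h2 ⊢
            omega)
        have e2 := h.merge_of_multiple (p := r ++ [y]) (r := c) (q := d ++ s :: (a₂ ++ y :: b))
          (x := z) (by
            rw [hW, hq'] at hc2
            intro t ht
            simpa using hc2 t ht)
        have e3 := hσ r (c ++ (d ++ s :: (a₂ ++ y :: b))) z y (by simp)
        rw [hW, hq']
        exact h.symm (h.trans (by simpa using e1) (h.trans (by simpa using e3)
          (h.symm (by simpa using e2))))
    · exact hσ _ _ _ _ hyq hzq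

end Solvable

namespace Solvable

open WordTheory

/-- A third or later `y` can be deleted and reinserted behind `z`. A second `y` can be merged into
the first one if no simple letter separates them. Otherwise a simple `t` separates them, and an
obstructing `s` would complete pattern J in the target word only. The bound `hpr` says that the
target has no more `y` before its first `z`. -/
theorem swap_nonfirst_first {E C : List ℕ → List ℕ → Prop} (h : Solvable E C)
    {p q r v : List ℕ} {y z : ℕ} (hC : C (r ++ y :: z :: q) (p ++ z :: v)) (hyr : y ∈ r)
    (hzr : z ∉ r) (hzq : z ∈ q) (hzp : z ∉ p) (hpr : p.count y ≤ r.count y) :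
    E (r ++ y :: z :: q) (r ++ z :: y :: q) := by
  have hF := h.sameF hC
  have hL := h.sameL hC
  have hyz : y ≠ z := fun e => hzr (e ▸ hyr)
  rcases Nat.lt_or_ge 1 (r.count y) with h2 | h2
  · refine h.trans (h.copy_over_letter hyr (Or.inr hzq)) (h.symm ?_)
    exact h.ins (p := r) (q := z :: y :: q) h2 (by simp)
  obtain ⟨r₁, r₂, hr, hyr2⟩ := exists_last_occurrence hyr
  have hyr1 : y ∉ r₁ := by
    intro hc
    have := List.count_pos_iff.2 hc
    simp [hr, List.count_append] at h2
    omega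
  have hr1 : r.count y = 1 := by have := List.count_pos_iff.2 hyr; omega
  set W := r ++ y :: z :: q with hW
  set V := p ++ z :: v with hV
  by_cases ht : ∃ t ∈ r₂, W.count t = 1
  swap
  · push Not at ht
    have hc2 : ∀ t ∈ r₂, 2 ≤ W.count t := fun t hc =>
      two_le_count_of_mem (by simp [hW, hr, hc]) (ht t hc)
    have hz2 : 2 ≤ W.count z := by
      have := List.count_pos_iff.2 hzq
      simp only [hW, List.count_append, List.count_cons, beq_self_eq_true, if_true]
      omega
    have e1 := h.merge_of_multiple (p := r₁) (r := r₂) (q := z :: q) (x := y) (by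
      rw [hW, hr] at hc2
      intro t ht
      simpa using hc2 t ht)
    have e2 := h.merge_of_multiple (p := r₁) (r := r₂ ++ [z]) (q := q) (x := y) (by
      rw [hW, hr] at hc2 hz2
      intro t ht
      have h2 : 2 ≤ (r₁ ++ y :: r₂ ++ y :: z :: q).count t := by
        simp only [List.mem_append, List.mem_singleton] at ht
        rcases ht with ht | rfl
        · exact hc2 t ht
        · exact hz2
      simp only [List.count_append, List.count_cons, List.count_nil] at h2 ⊢
      omega)
    rw [hW, hr]
    exact h.trans (by simpa using e1) (h.symm (by simpa using e2))
  obtain ⟨t, htr, ht⟩ := ht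
  rcases h.second_first with hJ | hσ
  swap
  · exact hσ _ _ _ _ hyr hzq
  rcases h.swap_nonfirst (y := z) hyr hzq with h1 | ⟨s, q₁, q₂, hq, hs, hyq2, hzq1⟩
  · exact h1
  exfalso
  have hsW : s ∉ r ++ y :: z :: q₁ := by
    intro hc
    have := List.count_pos_iff.2 hc
    simp only [hq, List.count_append, List.count_cons, beq_self_eq_true, if_true] at hs this
    omega
  have hWs : W = (r ++ y :: z :: q₁) ++ s :: q₂ := by simp [hW, hq]
  have hbs : bef s W = r ++ y :: z :: q₁ := by rw [hWs, bef_append_cons hsW]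
  have has : aft s W = q₂ := by rw [hWs, aft_append_cons hsW]
  obtain ⟨r₃, r₄, hr2⟩ := List.append_of_mem htr
  have hWt : W = (r₁ ++ y :: r₃) ++ t :: (r₄ ++ y :: z :: q) := by simp [hW, hr, hr2]
  have htW : t ∉ r₁ ++ y :: r₃ := by
    intro hc
    have := List.count_pos_iff.2 hc
    rw [hWt] at ht
    simp only [List.count_append, List.count_cons, beq_self_eq_true, if_true] at ht this
    omega
  have hbt : bef t W = r₁ ++ y :: r₃ := by rw [hWt, bef_append_cons htW]
  have hzs : z ∈ q₂ := by
    have : z ∈ q₁ ++ s :: q₂ := hq ▸ hzq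
    have hsz : z ≠ s := by rintro rfl; exact hsW (by simp)
    simpa [hzq1, hsz] using this
  have sepW : Sep y z s W := by
    refine ⟨hs, ?_, by rwa [has], ?_, by rwa [has]⟩
    · simp only [hW, List.count_append, List.count_cons, beq_self_eq_true, if_true]
      omega
    · rw [hbs]
      simp [List.count_append, List.count_eq_zero.2 hzr, List.count_eq_zero.2 hzq1, hyz]
  have hr3 : y ∉ r₃ := fun hc => hyr2 (by simp [hr2, hc])
  have hbty : (bef t W).count y = 1 := by
    rw [hbt]
    simp [List.count_append, List.count_eq_zero.2 hyr1, List.count_eq_zero.2 hr3]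
  have hbtz : z ∉ bef t W := by
    rw [hbt]
    intro hc
    refine hzr ?_
    rw [hr, hr2]
    simp at hc ⊢
    tauto
  have htV := (hF.count_eq_one t).1 ht
  have hbtzV : z ∉ bef t V := fun hc => hbtz ((hF.mem_bef ht z).2 hc)
  have hbtyV := (hF.bef_count_eq_one ht y).1 hbty
  have htp : t ∈ p := by
    by_contra htp
    refine hbtzV ?_
    have htz : t ≠ z := by
      rintro rfl
      exact hzr (by simp [hr, hr2])
    rw [show V = (p ++ [z]) ++ v by simp [hV], bef_append_of_not_mem (by simp [htp, htz])]
    simp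
  have hyp : 1 ≤ p.count y := by
    rw [hV, bef_append_of_mem htp] at hbtyV
    have : (bef t p).count y ≤ p.count y := (List.takeWhile_sublist _).count_le y
    omega
  -- Exactly one `y` precedes the first `z` in `V`, but two do in `W`.
  have := (hJ hC y z t s).2 ⟨hF.sep hL sepW, htV, hbtyV, hbtzV, by
    rw [hV, bef_append_cons hzp]
    omega⟩
  have h3 := this.2.2.2.2
  rw [show W = (r ++ [y]) ++ z :: q by simp [hW],
    bef_append_cons (by simp [hzr, hyz.symm])] at h3
  simp [List.count_append] at h3
  omega

/-- The counterpart of `swap_nonfirst_first`: now the second `z` moves left over a first occurrence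
of `y`. An obstruction gives pattern J in the given word, while the target has two `z` before its
first `y`. -/
theorem swap_first_second {E C : List ℕ → List ℕ → Prop} (h : Solvable E C)
    {p q r₁ r₂ v : List ℕ} {y z t : ℕ} (hC : C (r₁ ++ z :: r₂ ++ y :: z :: q) (p ++ z :: v))
    (hyr : y ∉ r₁ ++ z :: r₂) (hyq : y ∈ q) (hyp : y ∉ p) (hzr1 : z ∉ r₁) (hzr2 : z ∉ r₂)
    (hzp : p.count z = 1) (htr : t ∈ r₂) (ht : (r₁ ++ z :: r₂ ++ y :: z :: q).count t = 1) :
    E (r₁ ++ z :: r₂ ++ y :: z :: q) (r₁ ++ z :: r₂ ++ z :: y :: q) := by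
  have hF := h.sameF hC
  have hL := h.sameL hC
  have hyz : y ≠ z := fun e => hyr (by simp [e])
  have hzr : z ∈ r₁ ++ z :: r₂ := by simp
  have hzc : (r₁ ++ z :: r₂).count z = 1 := by
    simp [List.count_append, List.count_eq_zero.2 hzr1, List.count_eq_zero.2 hzr2]
  rcases h.second_first with hJ | hσ
  swap
  · exact h.symm (hσ _ _ _ _ hzr hyq)
  rcases h.swap_nonfirst (y := y) hzr hyq with h1 | ⟨s, q₁, q₂, hq, hs, hzq2, hyq1⟩
  · exact h.symm h1
  exfalso
  set r := r₁ ++ z :: r₂ with hr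
  set W := r ++ y :: z :: q with hW
  set V := p ++ z :: v with hV
  have hWc : ∀ c, W.count c = (r ++ z :: y :: q).count c := by
    intro c
    simp only [hW, List.count_append, List.count_cons]
    omega
  rw [← hWc] at hs
  have hsW : s ∉ r ++ y :: z :: q₁ := by
    intro hc
    have := List.count_pos_iff.2 hc
    simp only [hW, hq, List.count_append, List.count_cons, beq_self_eq_true, if_true] at hs this
    omega
  have hWs : W = (r ++ y :: z :: q₁) ++ s :: q₂ := by simp [hW, hq]
  have hbs : bef s W = r ++ y :: z :: q₁ := by rw [hWs, bef_append_cons hsW]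
  have has : aft s W = q₂ := by rw [hWs, aft_append_cons hsW]
  obtain ⟨r₃, r₄, hr2⟩ := List.append_of_mem htr
  have hWt : W = (r₁ ++ z :: r₃) ++ t :: (r₄ ++ y :: z :: q) := by simp [hW, hr, hr2]
  have htW : t ∉ r₁ ++ z :: r₃ := by
    intro hc
    have := List.count_pos_iff.2 hc
    rw [hWt] at ht
    simp only [List.count_append, List.count_cons, beq_self_eq_true, if_true] at ht this
    omega
  have hbt : bef t W = r₁ ++ z :: r₃ := by rw [hWt, bef_append_cons htW]
  have hys : y ∈ q₂ := by
    have : y ∈ q₁ ++ s :: q₂ := hq ▸ hyq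
    have hsz : y ≠ s := by rintro rfl; exact hsW (by simp)
    simpa [hyq1, hsz] using this
  have sepW : Sep z y s W := by
    refine ⟨hs, ?_, by rwa [has], ?_, by rwa [has]⟩
    · simp only [hW, List.count_append, List.count_cons, beq_self_eq_true, if_true]
      omega
    · rw [hbs]
      simp [List.count_append, List.count_eq_zero.2 hyr, List.count_eq_zero.2 hyq1, hyz.symm]
  have hr3 : z ∉ r₃ := fun hc => hzr2 (by simp [hr2, hc])
  have := (hJ hC z y t s).1 ⟨sepW, ht, by
    rw [hbt]
    simp [List.count_append, List.count_eq_zero.2 hzr1, List.count_eq_zero.2 hr3], by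
    rw [hbt]
    intro hc
    refine hyr ?_
    rw [hr, hr2]
    simp at hc ⊢
    tauto, by rw [hW, bef_append_cons hyr, hzc]⟩
  have h3 := this.2.2.2.2
  rw [show V = (p ++ [z]) ++ v by simp [hV], bef_append_of_not_mem (by simp [hyp, hyz])] at h3
  simp [List.count_append] at h3
  omega

end Solvable

/-! ### Turning one word into another with the same invariants -/

namespace Solvable

open WordTheory

/-- `z` moves left by one swap at a time. Soundness of `E` for `C` keeps the comparison with the
target word valid after each swap. -/
theorem move_first {E C : List ℕ → List ℕ → Prop} (h : Solvable E C) {p v : List ℕ} {z : ℕ}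
    (hzp : z ∉ p) : ∀ {u q : List ℕ}, C (p ++ (u ++ z :: q)) (p ++ z :: v) → z ∉ u → z ∈ q →
      (∀ c ∈ u, 2 ≤ (p ++ (u ++ z :: q)).count c) →
        E (p ++ (u ++ z :: q)) (p ++ z :: (u ++ q)) := by
  intro u
  induction u using List.reverseRecOn with
  | nil => intro q _ _ _ _; exact h.refl _
  | append_singleton a y ih =>
    intro q hC hzu hzq hu
    simp only [List.mem_append, List.mem_singleton, not_or] at hzu
    have hC' : C ((p ++ a) ++ y :: z :: q) (p ++ z :: v) := by simpa using hC
    have hyz : y ≠ z := fun e => hzu.2 e.symm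
    have step : E ((p ++ a) ++ y :: z :: q) ((p ++ a) ++ z :: y :: q) := by
      have hzr : z ∉ p ++ a := by simp [hzp, hzu.1]
      by_cases hy : y ∈ p ++ a
      · exact h.swap_nonfirst_first hC' hy hzr hzq hzp (by simp [List.count_append])
      · have h2 := hu y (by simp)
        have hyp : y ∉ p := fun hc => hy (by simp [hc])
        have hya : y ∉ a := fun hc => hy (by simp [hc])
        refine h.swap_first_first hC' hyz ?_ hzq hy hzr hyp hzp
        rw [← List.count_pos_iff]
        simp [List.count_append, List.count_eq_zero.2 hyp, List.count_eq_zero.2 hya,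
          hyz.symm] at h2
        simpa using h2
    have := ih (q := y :: q) (h.c_trans (h.c_symm (h.sound (by simpa using step))) (by simpa using hC))
      hzu.1 (by simp [hzq]) (by
        intro c hc
        have := hu c (by simp [hc])
        simp only [List.count_append, List.count_cons, List.count_nil] at this ⊢
        omega)
    exact h.trans (by simpa using step) (by simpa using this)

/-- As in `move_first`. Letters that have occurred before are passed by `comm`; the simple `t`
between the first `z` and the present place is what `swap_first_second` needs for the remaining
ones. -/
theorem move_second {E C : List ℕ → List ℕ → Prop} (h : Solvable E C) {p₁ p₂ v : List ℕ}
    {z t : ℕ} (hz1 : z ∉ p₁) (hz2 : z ∉ p₂) (htp : t ∈ p₂) :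
    ∀ {u q : List ℕ}, C (p₁ ++ z :: p₂ ++ (u ++ z :: q)) (p₁ ++ z :: p₂ ++ z :: v) → z ∉ u →
      (p₁ ++ z :: p₂ ++ (u ++ z :: q)).count t = 1 →
      (∀ c ∈ u, 2 ≤ (p₁ ++ z :: p₂ ++ (u ++ z :: q)).count c) →
        E (p₁ ++ z :: p₂ ++ (u ++ z :: q)) (p₁ ++ z :: p₂ ++ z :: (u ++ q)) := by
  intro u
  induction u using List.reverseRecOn with
  | nil => intro q _ _ _ _; exact h.refl _
  | append_singleton a y ih =>
    intro q hC hzu ht hu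
    simp only [List.mem_append, List.mem_singleton, not_or] at hzu
    have hC' : C (p₁ ++ z :: (p₂ ++ a) ++ y :: z :: q) (p₁ ++ z :: p₂ ++ z :: v) := by
      simpa using hC
    have hyz : y ≠ z := fun e => hzu.2 e.symm
    have step : E (p₁ ++ z :: (p₂ ++ a) ++ y :: z :: q) (p₁ ++ z :: (p₂ ++ a) ++ z :: y :: q) := by
      by_cases hy : y ∈ p₁ ++ z :: (p₂ ++ a)
      · exact h.comm hy (by simp)
      · have h2 := hu y (by simp)
        have hy' : y ∉ p₁ ++ z :: p₂ := fun hc => hy (by simp at hc ⊢; tauto)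
        have hya : y ∉ a := fun hc => hy (by simp [hc])
        refine h.swap_first_second hC' hy ?_ hy' hz1 (by simp [hz2, hzu.1])
          (by simp [List.count_append, List.count_eq_zero.2 hz1, List.count_eq_zero.2 hz2])
          (t := t) (by simp [htp]) (by simpa using ht)
        rw [← List.count_pos_iff]
        rw [List.count_append, List.count_eq_zero.2 hy'] at h2
        simp [List.count_append, List.count_eq_zero.2 hya, hyz.symm] at h2
        simpa using h2
    have := ih (q := y :: q) (h.c_trans (h.c_symm (h.sound (by simpa using step))) (by simpa using hC))
      hzu.1 (by
        simp only [List.count_append, List.count_cons, List.count_nil] at ht ⊢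
        omega) (by
        intro c hc
        have := hu c (by simp [hc])
        simp only [List.count_append, List.count_cons, List.count_nil] at this ⊢
        omega)
    exact h.trans (by simpa using step) (by simpa using this)

/-- Each letter of `u` is a redundant occurrence that `insert` removes. The condition is required of
every word equivalent to `X`, because it must still be available after earlier deletions. -/
theorem delete_prefix {E C : List ℕ → List ℕ → Prop} (h : Solvable E C) {p w X : List ℕ}
    (hX : ∀ y u, C (p ++ y :: (u ++ w)) X → 2 ≤ p.count y ∧
      ∀ p₁ p₂, p = p₁ ++ y :: p₂ → y ∉ p₂ → y ∉ u ++ w →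
        ∀ c ∈ p₂, (p ++ y :: (u ++ w)).count c ≠ 1) :
    ∀ {u : List ℕ}, C (p ++ (u ++ w)) X → E (p ++ (u ++ w)) (p ++ w) := by
  intro u
  induction u with
  | nil => intro _; exact h.refl _
  | cons y u ih =>
    intro hC
    obtain ⟨h1, h2⟩ := hX y u hC
    have step : E (p ++ (u ++ w)) (p ++ y :: (u ++ w)) := by
      refine h.insert h1 ?_
      by_cases hy : y ∈ u ++ w
      · exact Or.inl hy
      obtain ⟨p₁, p₂, hp, hp2⟩ := exists_last_occurrence (z := y) (p := p)
        (List.count_pos_iff.1 (by omega))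
      refine Or.inr ⟨p₁, p₂, hp, hp2, fun c hc => ?_⟩
      have hcy : y ≠ c := by rintro rfl; exact hp2 hc
      have h3 := two_le_count_of_mem (w := p ++ y :: (u ++ w)) (by simp [hp, hc])
        (h2 p₁ p₂ hp hp2 hy c hc)
      simpa [List.count_append, List.count_cons, hcy] using h3
    exact h.trans (h.symm step) (ih (h.c_trans (h.sound step) hC))

theorem aft_of_mem_prefix {c : ℕ} {p₁ p₂ w : List ℕ}
    (h : (p₁ ++ c :: p₂ ++ w).count c = 1) : aft c (p₁ ++ c :: p₂ ++ w) = p₂ ++ w := by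
  have hc : c ∉ p₁ := by
    intro hc
    have := List.count_pos_iff.2 hc
    simp only [List.count_append, List.count_cons, beq_self_eq_true, if_true] at h
    omega
  rw [List.append_assoc, List.cons_append, aft_append_cons hc]

/-- The invariants determine the identities. -/
theorem complete {E C : List ℕ → List ℕ → Prop} (h : Solvable E C) :
    ∀ {v p u : List ℕ}, C (p ++ u) (p ++ v) → E (p ++ u) (p ++ v) := by
  intro v
  induction v with
  | nil =>
    intro p u hC
    have := h.delete_prefix (p := p) (w := []) (X := p) (u := u) ?_ (by simpa using hC)
    · simpa using this
    intro y u hC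
    have hF := h.sameF hC
    have hy : y ∈ p := (hF.mem y).1 (by simp)
    have hy' := List.count_pos_iff.2 hy
    refine ⟨(hF.two y).1 (by simp [List.count_append]; omega), ?_⟩
    rintro p₁ p₂ rfl h1 h2 c hc h3
    obtain ⟨p₃, p₄, rfl⟩ := List.append_of_mem hc
    have e1 : p₁ ++ y :: (p₃ ++ c :: p₄) ++ y :: (u ++ [])
        = (p₁ ++ y :: p₃) ++ c :: p₄ ++ y :: u := by simp
    have e2 : p₁ ++ y :: (p₃ ++ c :: p₄) = (p₁ ++ y :: p₃) ++ c :: p₄ ++ [] := by simp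
    have h4 := (hF.count_eq_one c).1 h3
    have h5 := (hF.mem_aft (h.sameL hC) h3 y).1 (by
      rw [e1] at h3 ⊢
      rw [aft_of_mem_prefix h3]
      simp)
    rw [e2] at h4 h5
    rw [aft_of_mem_prefix h4] at h5
    exact h1 (by simp at h5 ⊢; tauto)
  | cons z v ih =>
    intro p u hC
    have hF := h.sameF hC
    have hL := h.sameL hC
    -- It is enough to produce the next letter `z` of the target right after the common prefix `p`;
    -- the induction continues with `p ++ [z]`.
    suffices hs : ∃ u', E (p ++ u) (p ++ z :: u') by
      obtain ⟨u', hu⟩ := hs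
      have := ih (p := p ++ [z]) (u := u') (by
        simpa using h.c_trans (h.c_symm (h.sound hu)) hC)
      exact h.trans hu (by simpa using this)
    by_cases hz1 : (p ++ z :: v).count z = 1
    · have hzp : z ∉ p := by
        intro hc
        have := List.count_pos_iff.2 hc
        simp [List.count_append] at hz1
        omega
      have hzu : z ∈ u := by
        have := (hF.mem z).2 (by simp)
        simpa [hzp] using this
      obtain ⟨a, b, rfl⟩ := List.append_of_mem hzu
      refine ⟨b, h.delete_prefix (p := p) (w := z :: b) (X := p ++ z :: v) (u := a) ?_ hC⟩
      intro y u hC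
      have hF := h.sameF hC
      have hz2 := (hF.count_eq_one z).2 hz1
      have hzu : z ∉ p ++ y :: u := by
        intro hc
        have := List.count_pos_iff.2 hc
        simp only [List.count_append, List.count_cons, beq_self_eq_true, if_true] at hz2 this
        omega
      have e : p ++ y :: (u ++ z :: b) = (p ++ y :: u) ++ z :: b := by simp
      have hb : bef z (p ++ y :: (u ++ z :: b)) = p ++ y :: u := by rw [e, bef_append_cons hzu]
      have ha : aft z (p ++ y :: (u ++ z :: b)) = b := by rw [e, aft_append_cons hzu]
      have hy : y ∈ p := by
        have := (hF.mem_bef hz2 y).1 (by simp [hb])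
        rwa [bef_append_cons hzp] at this
      have hy' := List.count_pos_iff.2 hy
      refine ⟨?_, ?_⟩
      · have := (hF.two_bef hz2 y).1 (by rw [hb]; simp [List.count_append]; omega)
        rwa [bef_append_cons hzp] at this
      rintro p₁ p₂ rfl h1 h2 c hc h3
      obtain ⟨p₃, p₄, rfl⟩ := List.append_of_mem hc
      have e1 : p₁ ++ y :: (p₃ ++ c :: p₄) ++ y :: (u ++ z :: b)
          = (p₁ ++ y :: p₃) ++ c :: p₄ ++ y :: (u ++ z :: b) := by simp
      have e2 : p₁ ++ y :: (p₃ ++ c :: p₄) ++ z :: v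
          = (p₁ ++ y :: p₃) ++ c :: p₄ ++ z :: v := by simp
      have h4 := (hF.count_eq_one c).1 h3
      have h5 := (hF.mem_aft (h.sameL hC) h3 y).1 (by
        rw [e1] at h3 ⊢
        rw [aft_of_mem_prefix h3]
        simp)
      rw [e2] at h4 h5
      rw [aft_of_mem_prefix h4] at h5
      have h6 := (hF.mem_aft (h.sameL hC) hz2 y).2 (by
        rw [aft_append_cons hzp]
        simp at h5 h1 h2
        tauto)
      rw [ha] at h6
      exact h2 (by simp [h6])
    have hz2 : 2 ≤ (p ++ u).count z := by
      refine (hF.two z).2 (two_le_count_of_mem (by simp) hz1)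
    -- A third or later `z` can simply be inserted. If it does not recur in `u`, a simple letter
    -- after the last `z` of `p` would contradict `SameL`.
    rcases Nat.lt_or_ge 1 (p.count z) with hp | hp
    · refine ⟨u, h.insert hp ?_⟩
      by_cases hzu : z ∈ u
      · exact Or.inl hzu
      obtain ⟨p₁, p₂, rfl, hp2⟩ := exists_last_occurrence (z := z) (p := p)
        (List.count_pos_iff.1 (by omega))
      refine Or.inr ⟨p₁, p₂, rfl, hp2, fun c hc => two_le_count_of_mem (by simp [hc]) fun h3 => ?_⟩
      obtain ⟨p₃, p₄, rfl⟩ := List.append_of_mem hc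
      have e1 : p₁ ++ z :: (p₃ ++ c :: p₄) ++ u = (p₁ ++ z :: p₃) ++ c :: p₄ ++ u := by simp
      have e2 : p₁ ++ z :: (p₃ ++ c :: p₄) ++ z :: v
          = (p₁ ++ z :: p₃) ++ c :: p₄ ++ z :: v := by simp
      have h4 := (hF.count_eq_one c).1 h3
      have h5 := (hF.mem_aft hL h3 z).2 (by
        rw [e2] at h4 ⊢
        rw [aft_of_mem_prefix h4]
        simp)
      rw [e1] at h3 h5
      rw [aft_of_mem_prefix h3] at h5
      simp at h5 hp2
      tauto
    have hzu : z ∈ u := by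
      rw [← List.count_pos_iff]
      rw [List.count_append] at hz2
      omega
    obtain ⟨a, q, rfl, hza⟩ := exists_first_occurrence hzu
    -- A simple `c` before this `z` would see one occurrence of `z` fewer in front of it than in the
    -- target. As `z` occurs at most once in `p`, `SameF` detects this.
    have ha : ∀ c ∈ a, 2 ≤ (p ++ (a ++ z :: q)).count c := by
      intro c hc
      refine two_le_count_of_mem (by simp [hc]) fun h3 => ?_
      obtain ⟨a₁, a₂, rfl⟩ := List.append_of_mem hc
      have hcp : c ∉ p ++ a₁ := by
        intro hc
        have := List.count_pos_iff.2 hc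
        simp only [List.count_append, List.count_cons, beq_self_eq_true, if_true] at h3 this
        omega
      have hcz : z ≠ c := by rintro rfl; exact hza hc
      have hb : bef c (p ++ (a₁ ++ c :: a₂ ++ z :: q)) = p ++ a₁ := by
        rw [show p ++ (a₁ ++ c :: a₂ ++ z :: q) = (p ++ a₁) ++ c :: (a₂ ++ z :: q) by simp,
          bef_append_cons hcp]
      have hb' : bef c (p ++ z :: v) = (p ++ [z]) ++ bef c v := by
        rw [show p ++ z :: v = (p ++ [z]) ++ v by simp, bef_append_of_not_mem]
        simp at hcp ⊢
        exact ⟨hcp.1, hcz.symm⟩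
      have hza1 : z ∉ a₁ := fun hc => hza (by simp [hc])
      rcases Nat.eq_zero_or_pos (p.count z) with hp0 | hp0
      · have := (hF.mem_bef h3 z).2 (by simp [hb'])
        rw [hb] at this
        have := List.count_eq_zero.1 hp0
        simp_all
      · have := (hF.two_bef h3 z).2 (by rw [hb']; simp [List.count_append]; omega)
        rw [hb, List.count_append, List.count_eq_zero.2 hza1] at this
        omega
    rcases Nat.eq_zero_or_pos (p.count z) with hp0 | hp0
    · refine ⟨_, h.move_first (List.count_eq_zero.1 hp0) hC hza ?_ ha⟩
      rw [← List.count_pos_iff]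
      simp [List.count_append, hp0, List.count_eq_zero.2 hza] at hz2
      simpa using hz2
    · obtain ⟨p₁, p₂, rfl, hp1⟩ := exists_first_occurrence (List.count_pos_iff.1 hp0)
      have hp2 : z ∉ p₂ := by
        intro hc
        have := List.count_pos_iff.2 hc
        simp [List.count_append] at hp
        omega
      by_cases ht : ∃ t ∈ p₂, (p₁ ++ z :: p₂ ++ (a ++ z :: q)).count t = 1
      · obtain ⟨t, htp, ht⟩ := ht
        exact ⟨_, h.move_second hp1 hp2 htp hC hza ht ha⟩
      -- No simple letter separates the first `z` from the place wanted for the second one, so both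
      -- positions of the second `z` reduce to the one adjacent to the first.
      · push Not at ht
        refine ⟨a ++ q, ?_⟩
        have h2 : ∀ c ∈ p₂ ++ a, 2 ≤ (p₁ ++ z :: p₂ ++ (a ++ z :: q)).count c := by
          intro c hc
          rcases List.mem_append.1 hc with hc | hc
          · exact two_le_count_of_mem (by simp [hc]) (ht c hc)
          · exact ha c hc
        have e1 := h.merge_of_multiple (p := p₁) (r := p₂ ++ a) (q := q) (x := z) (by
          intro c hc
          simpa using h2 c hc)
        have e2 := h.merge_of_multiple (p := p₁) (r := p₂) (q := a ++ q) (x := z) (by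
          intro c hc
          have := h2 c (by simp [hc])
          simp only [List.count_append, List.count_cons] at this ⊢
          omega)
        exact h.trans (by simpa using e1) (h.symm (by simpa using e2))

end Solvable

/-! ## Varieties and identities -/

namespace MonoidVariety

theorem le_antisymm' {V W : MonoidVariety.{u}} (h : V ≤ W) (k : W ≤ V) : V = W := by
  ext M inst
  exact ⟨h M, k M⟩

theorem le_trans' {V W X : MonoidVariety.{u}} (h : V ≤ W) (k : W ≤ X) : V ≤ X :=
  fun M _ hM => k M (h M hM)

theorem le_refl' (V : MonoidVariety.{u}) : V ≤ V := fun _ _ hM => hM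

theorem le_sup_left' (V W : MonoidVariety.{u}) : V ≤ V ⊔ W :=
  fun _ _ hM _ hX => hX _ (Or.inl hM)

theorem le_sup_right' (V W : MonoidVariety.{u}) : W ≤ V ⊔ W :=
  fun _ _ hM _ hX => hX _ (Or.inr hM)

theorem sup_le' {V W X : MonoidVariety.{u}} (h : V ≤ X) (k : W ≤ X) : V ⊔ W ≤ X :=
  fun _ _ hM => hM X fun N _ hN => hN.elim (h N) (k N)

theorem mem_var (M : Type) [Monoid M] : (var M : MonoidVariety.{u}).Mem (ULift.{u} M) :=
  fun _ h => h

theorem var_le {M : Type} [Monoid M] {V : MonoidVariety.{u}} (h : V.Mem (ULift.{u} M)) :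
    var M ≤ V := fun _ _ hN => hN V h

theorem mem_of_equiv (V : MonoidVariety.{u}) {M N : Type u} [Monoid M] [Monoid N] (e : M ≃* N)
    (h : V.Mem M) : V.Mem N := V.image_mem e.toMonoidHom e.surjective h

end MonoidVariety

/-- The value of a word under a substitution. -/
def ev {M : Type*} [Monoid M] (φ : ℕ → M) (u : List ℕ) : M := (u.map φ).prod

section ev

variable {M : Type*} [Monoid M] (φ : ℕ → M)

theorem ev_nil : ev φ [] = 1 := rfl

theorem ev_cons (a : ℕ) (u : List ℕ) : ev φ (a :: u) = φ a * ev φ u := by simp [ev]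

theorem ev_append (u w : List ℕ) : ev φ (u ++ w) = ev φ u * ev φ w := by simp [ev]

theorem lift_eq_ev (p : FreeMonoid ℕ) : FreeMonoid.lift φ p = ev φ p.toList := by
  simp [ev, FreeMonoid.lift_apply]

end ev

/-- The identity `u ≈ w` holds in every member of `V`. -/
def Holds (V : MonoidVariety.{u}) (u w : List ℕ) : Prop :=
  ∀ (M : Type u) [Monoid M], V.Mem M → ∀ φ : ℕ → M, ev φ u = ev φ w

theorem Holds.mono {V W : MonoidVariety.{u}} (h : V ≤ W) {u w : List ℕ} (k : Holds W u w) :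
    Holds V u w := fun M _ hM => k M (h M hM)

/-- The class of monoids satisfying `u ≈ w` is itself a variety, hence contains the variety
generated by `M` as soon as it contains `M`. -/
theorem holds_var_iff {M : Type} [Monoid M] {u w : List ℕ} :
    Holds (MonoidVariety.var M : MonoidVariety.{u}) u w ↔ ∀ φ : ℕ → M, ev φ u = ev φ w := by
  have down : ∀ (φ : ℕ → ULift.{u} M) (u : List ℕ),
      (ev φ u).down = ev (fun n => (φ n).down) u := by
    intro φ u
    induction u with
    | nil => rfl
    | cons a u ih => rw [ev_cons, ev_cons, ← ih]; rfl
  constructor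
  · intro h φ
    have := h _ (MonoidVariety.mem_var M) fun n => ULift.up (φ n)
    have := congrArg ULift.down this
    rwa [down, down] at this
  · intro h N _ hN φ
    have := hN (varIds {(FreeMonoid.ofList u, FreeMonoid.ofList w)}) (by
      rintro p rfl φ
      apply ULift.down_injective
      rw [lift_eq_ev, lift_eq_ev, down, down]
      exact h _)
    have := this _ rfl φ
    rwa [lift_eq_ev, lift_eq_ev] at this

/-- Birkhoff's theorem: a variety is determined by its identities. -/
theorem le_of_holds {V W : MonoidVariety.{u}} (h : ∀ u w, Holds W u w → Holds V u w) : V ≤ W := by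
  classical
  intro M _ hM
  -- The image of `FreeMonoid M` in the product of all its quotients that lie in `W` is again in
  -- `W`; the aim is to show that `M` is a homomorphic image of it.
  let ι := {c : Con (FreeMonoid M) // W.Mem c.Quotient}
  let f : FreeMonoid M →* (∀ c : ι, c.1.Quotient) := MonoidHom.pi fun c => c.1.mk'
  have hf : W.Mem (MonoidHom.mrange f) := W.submonoid_mem _ (W.pi_mem _ fun c => c.2)
  have hker : W.Mem (Con.ker f).Quotient := W.mem_of_equiv (Con.quotientKerEquivRange f).symm hf
  have hle : Con.ker f ≤ Con.ker (FreeMonoid.lift (id : M → M)) := by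
    intro a b hab
    rw [Con.ker_rel] at hab ⊢
    -- Only finitely many elements of `M` occur in the two words. Replacing each by its index in
    -- `ls` turns the pair into an identity over `ℕ`.
    set ls : List M := a.toList ++ b.toList with hls
    let g : ℕ → M := fun n => ls.getD n 1
    have hg : ∀ m ∈ ls, g (ls.idxOf m) = m := by
      intro m hm
      have := List.idxOf_lt_length_iff.2 hm
      change ls.getD (ls.idxOf m) 1 = m
      rw [List.getD_eq_getElem _ _ this]
      exact List.getElem_idxOf this
    have hfac : ∀ c : FreeMonoid M, (∀ m ∈ c.toList, m ∈ ls) →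
        FreeMonoid.lift (id : M → M) c = ev g (c.toList.map ls.idxOf) := by
      intro c hc
      rw [FreeMonoid.lift_apply, ev, List.map_map]
      congr 1
      exact List.map_congr_left fun m hm => (hg m (hc m hm)).symm
    rw [hfac a (by simp +contextual [hls]), hfac b (by simp +contextual [hls])]
    refine h _ _ ?_ M hM g
    intro N _ hN φ
    let k : FreeMonoid M →* N := FreeMonoid.lift fun m => φ (ls.idxOf m)
    have hk : W.Mem (Con.ker k).Quotient :=
      W.mem_of_equiv (Con.quotientKerEquivRange k).symm (W.submonoid_mem _ hN)
    have h1 : (Con.ker k).mk' a = (Con.ker k).mk' b := congrFun hab ⟨Con.ker k, hk⟩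
    have h2 : k a = k b := (Con.eq _).1 h1
    simpa [k, FreeMonoid.lift_apply, ev, Function.comp_def] using h2
  refine W.image_mem (Con.lift (Con.ker f) (FreeMonoid.lift (id : M → M)) hle) ?_ hker
  intro m
  exact ⟨((FreeMonoid.of m : FreeMonoid M) : (Con.ker f).Quotient), by simp⟩

/-! ## The identities of `𝕁` and its subvarieties -/

/-- The identities `Φ`. -/
structure PhiLaws (M : Type*) [Monoid M] : Prop where
  xtx : ∀ x t : M, x * t * x = x * t * x ^ 2
  sq_comm : ∀ x y : M, x ^ 2 * y ^ 2 = y ^ 2 * x ^ 2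
  xytxy : ∀ x y t : M, x * y * t * x * y = y * x * t * x * y
  fill : ∀ x t₁ t₂ t₃ : M, x * t₁ * x * t₂ * t₃ * x = x * t₁ * x * t₂ * x * t₃ * x

/-- The infinite series of identities of `𝕁`. -/
def WLaw (M : Type*) [Monoid M] : Prop :=
  ∀ (n : ℕ) (π : Equiv.Perm (Fin n)) (x : M) (y t : Fin n → M),
    x * (List.ofFn fun i => y (π i)).prod * x * (List.ofFn fun i => t i * y i).prod =
      x ^ 2 * (List.ofFn fun i => y (π i)).prod * (List.ofFn fun i => t i * y i).prod

/-- `xtxysy ≈ xtyxsy` -/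
def ILaw (M : Type*) [Monoid M] : Prop :=
  ∀ x t y s : M, x * t * x * y * s * y = x * t * y * x * s * y

/-- `x²yty ≈ yx²ty` -/
def HLaw (M : Type*) [Monoid M] : Prop :=
  ∀ x y t : M, x ^ 2 * y * t * y = y * x ^ 2 * t * y

/-- `xytxsy ≈ yxtxsy` -/
def ELaw (M : Type*) [Monoid M] : Prop :=
  ∀ x y t s : M, x * y * t * x * s * y = y * x * t * x * s * y

theorem mem_varJ {M : Type u} [Monoid M] : varJ.Mem M ↔ PhiLaws M ∧ WLaw M := by
  constructor
  · intro h
    refine ⟨⟨fun X T => ?_, fun X Y => ?_, fun X Y T => ?_, fun X T₁ T₂ T₃ => ?_⟩,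
      fun n π X Y T => ?_⟩
    · have := h (x * t * x, x * t * x ^ 2) (by simp) fun n => [X, 1, T].getD n 1
      simpa using this
    · have := h (x ^ 2 * y ^ 2, y ^ 2 * x ^ 2) (by simp) fun n => [X, Y].getD n 1
      simpa using this
    · have := h (x * y * t * x * y, y * x * t * x * y) (by simp) fun n => [X, Y, T].getD n 1
      simpa using this
    · have := h (x * t₁ * x * t₂ * t₃ * x, x * t₁ * x * t₂ * x * t₃ * x) (by simp)
        fun n => [X, 1, 1, 1, T₁, T₂, T₃].getD n 1
      simpa using this
    -- Letter `0` is `x`, letter `2i + 1` is `yᵢ` and letter `2i + 2` is `tᵢ`, so `(k - 1) / 2`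
    -- recovers the index and the parity of `k` the kind; letters out of range go to `1`.
    · have := h (wWord n π, wWord' n π) (Or.inr ⟨n, π, rfl⟩) fun k =>
        if k = 0 then X else if hk : (k - 1) / 2 < n then
          if k % 2 = 1 then Y ⟨_, hk⟩ else T ⟨_, hk⟩ else 1
      have e1 : ∀ i : ℕ, (2 * i + 1 - 1) / 2 = i := by intro i; omega
      have e2 : ∀ i : ℕ, (2 * i + 2 - 1) / 2 = i := by intro i; omega
      have e3 : ∀ i : ℕ, (2 * i + 1) % 2 = 1 := by intro i; omega
      have e4 : ∀ i : ℕ, (2 * i + 2) % 2 = 0 := by intro i; omega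
      simpa only [wWord, wWord', map_mul, map_pow, map_list_prod, List.map_ofFn,
        Function.comp_def, FreeMonoid.lift_eval_of, e1, e2, e3, e4, Fin.is_lt, dif_pos, if_true,
        Fin.eta, Nat.add_eq_zero_iff, one_ne_zero, and_false, if_false, OfNat.ofNat_ne_zero,
        zero_ne_one] using this
  · rintro ⟨h1, h2⟩ p hp φ
    simp only [Set.mem_union, Set.mem_insert_iff, Set.mem_singleton_iff, Set.mem_ofPred_eq] at hp
    rcases hp with (rfl | rfl | rfl | rfl) | ⟨n, π, rfl⟩
    · simpa using h1.xtx (φ 0) (φ 2)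
    · simpa using h1.sq_comm (φ 0) (φ 1)
    · simpa using h1.xytxy (φ 0) (φ 1) (φ 2)
    · simpa using h1.fill (φ 0) (φ 4) (φ 5) (φ 6)
    · simpa [wWord, wWord', map_list_prod, List.map_ofFn, Function.comp_def] using
        h2 n π (φ 0) (fun i => φ (2 * i + 1)) (fun i => φ (2 * i + 2))

theorem mem_varI {M : Type u} [Monoid M] : varI.Mem M ↔ PhiLaws M ∧ ILaw M := by
  constructor
  · intro h
    refine ⟨⟨fun X T => ?_, fun X Y => ?_, fun X Y T => ?_, fun X T₁ T₂ T₃ => ?_⟩,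
      fun X T Y S => ?_⟩
    · have := h (x * t * x, x * t * x ^ 2) (by simp) fun n => [X, 1, T].getD n 1
      simpa using this
    · have := h (x ^ 2 * y ^ 2, y ^ 2 * x ^ 2) (by simp) fun n => [X, Y].getD n 1
      simpa using this
    · have := h (x * y * t * x * y, y * x * t * x * y) (by simp) fun n => [X, Y, T].getD n 1
      simpa using this
    · have := h (x * t₁ * x * t₂ * t₃ * x, x * t₁ * x * t₂ * x * t₃ * x) (by simp)
        fun n => [X, 1, 1, 1, T₁, T₂, T₃].getD n 1
      simpa using this
    · have := h (x * t * x * y * s * y, x * t * y * x * s * y) (by simp)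
        fun n => [X, Y, T, S].getD n 1
      simpa using this
  · rintro ⟨h1, h2⟩ p hp φ
    simp only [Set.mem_insert_iff, Set.mem_singleton_iff] at hp
    rcases hp with rfl | rfl | rfl | rfl | rfl
    · simpa using h1.xtx (φ 0) (φ 2)
    · simpa using h1.sq_comm (φ 0) (φ 1)
    · simpa using h1.xytxy (φ 0) (φ 1) (φ 2)
    · simpa using h1.fill (φ 0) (φ 4) (φ 5) (φ 6)
    · simpa using h2 (φ 0) (φ 2) (φ 1) (φ 3)

theorem mem_varH {M : Type u} [Monoid M] : varH.Mem M ↔ PhiLaws M ∧ HLaw M ∧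
    ∀ x y t : M, x ^ 2 * y * t * y = x * y * x * t * y := by
  constructor
  · intro h
    have h4 : ∀ X Y T : M, X ^ 2 * Y * T * Y = X * Y * X * T * Y := fun X Y T => by
      have := h (x ^ 2 * y * t * y, x * y * x * t * y) (by simp) fun n => [X, Y, T].getD n 1
      simpa using this
    refine ⟨⟨fun X T => ?_, fun X Y => ?_, fun X Y T => ?_, fun X T₁ T₂ T₃ => ?_⟩,
      fun X Y T => ?_, h4⟩
    · have := h (x * t * x, x * t * x ^ 2) (by simp) fun n => [X, 1, T].getD n 1
      simpa using this
    · have := h (x ^ 2 * y ^ 2, y ^ 2 * x ^ 2) (by simp) fun n => [X, Y].getD n 1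
      simpa using this
    · have := h (x * y * t * x * y, y * x * t * x * y) (by simp) fun n => [X, Y, T].getD n 1
      simpa using this
    · have := h (x * t₁ * x * t₂ * t₃ * x, x * t₁ * x * t₂ * x * t₃ * x) (by simp)
        fun n => [X, 1, 1, 1, T₁, T₂, T₃].getD n 1
      simpa using this
    · have := h (x * y * x * t * y, y * x ^ 2 * t * y) (by simp)
        fun n => [X, Y, T].getD n 1
      rw [h4]
      simpa using this
  · rintro ⟨h1, h2, h3⟩ p hp φ
    simp only [Set.mem_insert_iff, Set.mem_singleton_iff] at hp
    rcases hp with rfl | rfl | rfl | rfl | rfl | rfl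
    · simpa using h1.xtx (φ 0) (φ 2)
    · simpa using h1.sq_comm (φ 0) (φ 1)
    · simpa using h1.xytxy (φ 0) (φ 1) (φ 2)
    · simpa using h1.fill (φ 0) (φ 4) (φ 5) (φ 6)
    · simpa using h3 (φ 0) (φ 1) (φ 2)
    · simpa using (h3 (φ 0) (φ 1) (φ 2)).symm.trans (h2 (φ 0) (φ 1) (φ 2))

theorem mem_varF {M : Type u} [Monoid M] : varF.Mem M ↔
    (∀ x y : M, x ^ 2 * y ^ 2 = y ^ 2 * x ^ 2) ∧
    (∀ x y t : M, x * y * t * x * y = y * x * t * x * y) ∧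
    ∀ x t s : M, x * t * x * s = x * t * x * s * x := by
  constructor
  · intro h
    refine ⟨fun X Y => ?_, fun X Y T => ?_, fun X T S => ?_⟩
    · have := h (x ^ 2 * y ^ 2, y ^ 2 * x ^ 2) (by simp) fun n => [X, Y].getD n 1
      simpa using this
    · have := h (x * y * t * x * y, y * x * t * x * y) (by simp) fun n => [X, Y, T].getD n 1
      simpa using this
    · have := h (x * t * x * s, x * t * x * s * x) (by simp) fun n => [X, 1, T, S].getD n 1
      simpa using this
  · rintro ⟨h1, h2, h3⟩ p hp φ
    simp only [Set.mem_insert_iff, Set.mem_singleton_iff] at hp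
    rcases hp with rfl | rfl | rfl
    · simpa using h1 (φ 0) (φ 1)
    · simpa using h2 (φ 0) (φ 1) (φ 2)
    · simpa using h3 (φ 0) (φ 2) (φ 3)

/-! ## The word theory of a subvariety of `𝕁` -/

section laws

variable {M : Type*} [Monoid M]

theorem exists_split_of_sublist (φ : ℕ → M) {l q : List ℕ} (h : l.Sublist q) :
    ∃ (ts : List M) (R : M), ts.length = l.length ∧
      ev φ q = (List.zipWith (fun a c => a * φ c) ts l).prod * R := by
  induction h with
  | slnil => exact ⟨[], 1, rfl, by simp [ev]⟩
  | @cons l q a h ih =>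
    obtain ⟨ts, R, h1, h2⟩ := ih
    cases l with
    | nil => exact ⟨[], ev φ (a :: q), rfl, by simp⟩
    | cons c l =>
      cases ts with
      | nil => simp at h1
      | cons t ts => exact ⟨φ a * t :: ts, R, h1, by rw [ev_cons, h2]; simp [mul_assoc]⟩
  | @cons_cons l q a h ih =>
    obtain ⟨ts, R, h1, h2⟩ := ih
    exact ⟨1 :: ts, R, by simp [h1], by rw [ev_cons, h2]; simp [mul_assoc]⟩

/-- The word `r` is a rearrangement of a sublist of `q`, and the gaps of that sublist in `q` serve
as values of the `tᵢ`. -/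
theorem WLaw.subperm (h : WLaw M) (φ : ℕ → M) (x : M) {r q : List ℕ} (hr : r.Subperm q) :
    x * ev φ r * x * ev φ q = x ^ 2 * ev φ r * ev φ q := by
  obtain ⟨l, hl, hq⟩ := hr
  obtain ⟨ts, R, h1, h2⟩ := exists_split_of_sublist φ hq
  have hrl : r.Subperm l := hl.symm.subperm
  have hlen : r.length = l.length := hl.symm.length_eq
  let σ : Fin l.length → Fin l.length := fun i => hrl.idxInj (i.cast hlen.symm)
  have hσ : Function.Injective σ := fun i j hij => by
    have := hrl.idxInj_injective hij
    simpa using this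
  let π : Equiv.Perm (Fin l.length) := Equiv.ofBijective σ (Finite.injective_iff_bijective.1 hσ)
  have e1 : ev φ r = (List.ofFn fun i => φ (l.get (π i))).prod := by
    rw [ev]
    congr 1
    apply List.ext_getElem
    · simp [hlen]
    · intro i hi hi'
      simp only [List.getElem_map, List.getElem_ofFn]
      congr 1
      exact (List.Subperm.getElem_idxInj_eq_getElem (h := hrl) (i := ⟨i, by simpa using hi⟩)).symm
  have e2 : List.zipWith (fun a c => a * φ c) ts l =
      List.ofFn fun i : Fin l.length => ts.get (i.cast h1.symm) * φ (l.get i) := by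
    apply List.ext_getElem
    · simp [h1]
    · intro i hi hi'
      simp
  have := h l.length π x (fun i => φ (l.get i)) fun i => ts.get (i.cast h1.symm)
  rw [h2, e2, e1, ← mul_assoc, this, mul_assoc]

namespace PhiLaws

theorem ev_mem (φ : ℕ → M) {p : List ℕ} {x : ℕ} (hx : x ∈ p) :
    ∃ a b : M, ev φ p = a * φ x * b := by
  obtain ⟨p₁, p₂, rfl⟩ := List.append_of_mem hx
  exact ⟨ev φ p₁, ev φ p₂, by simp [ev_append, ev_cons, mul_assoc]⟩

theorem dbl (h : PhiLaws M) (φ : ℕ → M) {p : List ℕ} {x : ℕ} (hx : x ∈ p) :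
    ev φ p * φ x = ev φ p * φ x * φ x := by
  obtain ⟨a, b, e⟩ := ev_mem φ hx
  have := congrArg (a * ·) (h.xtx (φ x) b)
  simp only [pow_two, ← mul_assoc] at this
  rw [e]
  exact this

theorem comm (h : PhiLaws M) (φ : ℕ → M) {p : List ℕ} {x y : ℕ} (hx : x ∈ p) (hy : y ∈ p) :
    ev φ p * φ x * φ y = ev φ p * φ y * φ x := by
  have key : ∀ {x y : ℕ}, x ∈ p → y ∈ p →
      ev φ p * φ x * φ y = ev φ p * (φ x ^ 2 * φ y ^ 2) := by
    intro x y hx hy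
    have h2 := h.dbl φ (p := p ++ [x, x]) (x := y) (by simp [hy])
    simp only [ev_append, ev_cons, ev_nil, mul_one, ← mul_assoc] at h2
    rw [h.dbl φ hx, h2]
    simp only [pow_two, mul_assoc]
  rw [key hx hy, h.sq_comm, ← key hy hx]

theorem fill_ev (h : PhiLaws M) (φ : ℕ → M) {p q : List ℕ} {x : ℕ} (hp : 2 ≤ p.count x)
    (hx : x ∈ q) : ev φ p * ev φ q = ev φ p * φ x * ev φ q := by
  obtain ⟨p₁, p₂, rfl, h1⟩ := exists_first_occurrence (z := x) (p := p)
    (List.count_pos_iff.1 (by omega))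
  have h2 : x ∈ p₂ := by
    rw [← List.count_pos_iff]
    simp [List.count_append, List.count_eq_zero.2 h1] at hp
    simpa using hp
  obtain ⟨p₃, p₄, rfl⟩ := List.append_of_mem h2
  obtain ⟨q₁, q₂, rfl⟩ := List.append_of_mem hx
  have := congrArg (fun m => ev φ p₁ * m * ev φ q₂) (h.fill (φ x) (ev φ p₃) (ev φ p₄) (ev φ q₁))
  simpa [ev_append, ev_cons, mul_assoc] using this

/-- After a prefix containing them, letters are nonfirst occurrences, so `xtx ≈ xtx²` replaces each
by any positive power. -/
theorem pow_ev (h : PhiLaws M) (φ : ℕ → M) (m : ℕ) (r : List ℕ) {q p : List ℕ}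
    (hp : ∀ c ∈ r, c ∈ p) : ev φ p * ev φ q =
      ev φ p * ev φ (q.flatMap fun c => if c ∈ r then List.replicate (m + 1) c else [c]) := by
  induction q generalizing p with
  | nil => rfl
  | cons c q ih =>
    have h1 := ih (p := p ++ [c]) fun d hd => by simp [hp d hd]
    simp only [ev_append, ev_cons, ev_nil, mul_one] at h1
    rw [List.flatMap_cons, ev_cons, ev_append, ← mul_assoc, h1, ← mul_assoc]
    congr 1
    split_ifs with hc
    · have : ∀ k, ev φ p * ev φ (List.replicate (k + 1) c) = ev φ p * φ c := by
        intro k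
        induction k with
        | zero => simp [ev]
        | succ k ihk =>
          rw [List.replicate_succ', ev_append, ← mul_assoc, ihk]
          simp only [ev_cons, ev_nil, mul_one]
          exact (h.dbl φ (hp c hc)).symm
      rw [this]
    · simp [ev]

/-- `WLaw.subperm` needs `q` to contain `r` with multiplicities, whereas only containment of letters
is given. Raising each letter of `q` that occurs in `r` to the power `|r| + 1` makes up for this. -/
theorem merge (h : PhiLaws M) (hw : WLaw M) (φ : ℕ → M) {q r : List ℕ} {x : ℕ}
    (hr : ∀ y ∈ r, y ∈ q) :
    φ x * (ev φ r * (φ x * ev φ q)) = φ x * (φ x * (ev φ r * ev φ q)) := by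
  set q' := q.flatMap fun c => if c ∈ r then List.replicate (r.length + 1) c else [c] with hq'
  have hsub : r.Subperm q' := by
    rw [List.subperm_ext_iff]
    intro c hc
    obtain ⟨q₁, q₂, rfl⟩ := List.append_of_mem (hr c hc)
    have := List.count_le_length (a := c) (l := r)
    simp [hq', hc, List.count_append]
    omega
  have e := hw.subperm φ (φ x) hsub
  have k1 := h.pow_ev φ r.length r (q := q) (p := x :: (r ++ [x])) (by simp +contextual)
  have k2 := h.pow_ev φ r.length r (q := q) (p := x :: x :: r) (by simp +contextual)
  rw [← hq'] at k1 k2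
  simp only [ev_cons, ev_append, ev_nil, mul_one, pow_two, mul_assoc] at e k1 k2
  rw [k1, e, k2]

end PhiLaws

end laws

theorem wordTheory_of_le {V : MonoidVariety.{u}} (hV : V ≤ varJ) : WordTheory (Holds V) where
  refl _ _ _ _ _ := rfl
  symm h M _ hM φ := (h M hM φ).symm
  trans h k M _ hM φ := (h M hM φ).trans (k M hM φ)
  dbl := by
    intro p q x hx M _ hM φ
    have := (mem_varJ.1 (hV M hM)).1.dbl φ hx
    simp only [ev_append, ev_cons, ← mul_assoc]
    rw [← this]
  comm := by
    intro p q x y hx hy M _ hM φ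
    have := (mem_varJ.1 (hV M hM)).1.comm φ hx hy
    simp only [ev_append, ev_cons, ← mul_assoc]
    rw [this]
  ins := by
    intro p q x hp hx M _ hM φ
    have := (mem_varJ.1 (hV M hM)).1.fill_ev φ hp hx
    simp only [ev_append, ev_cons, ← mul_assoc]
    exact this
  swap := by
    intro p q r x y M _ hM φ
    have := (mem_varJ.1 (hV M hM)).1.xytxy (φ x) (φ y) (ev φ q)
    simp only [ev_append, ev_cons]
    simpa only [mul_assoc] using congrArg (fun m => ev φ p * m * ev φ r) this
  merge := by
    intro p q r x hr M _ hM φ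
    have h := mem_varJ.1 (hV M hM)
    simp only [ev_append, ev_cons]
    rw [h.1.merge h.2 φ hr]

/-! ### Implications between the laws -/

section implications

variable {M : Type*} [Monoid M]

/-- The second `x` moves left over `y_{1π}⋯y_{nπ}` letter by letter; each step is an instance of
`xtxysy ≈ xtyxsy`, as every `yᵢ` recurs in the tail. -/
theorem ILaw.wLaw (h : ILaw M) : WLaw M := by
  have key : ∀ (x : M) (l : List M) (T : M), (∀ y ∈ l, ∃ a b, T = a * y * b) →
      x * l.prod * x * T = x ^ 2 * l.prod * T := by
    intro x l
    induction l using List.reverseRecOn with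
    | nil => intro T _; simp [pow_two]
    | append_singleton l y ih =>
      intro T hT
      obtain ⟨a, b, hab⟩ := hT y (by simp)
      have h1 := congrArg (· * b) (h x l.prod y a)
      have h2 := ih (y * T) fun c hc => by
        obtain ⟨a, b, hab⟩ := hT c (by simp [hc])
        exact ⟨y * a, b, by rw [hab]; simp only [mul_assoc]⟩
      simp only [hab, mul_assoc, List.prod_append, List.prod_singleton] at h1 h2 ⊢
      rw [← h1, h2]
  intro n π x y t
  refine key x _ _ fun c hc => ?_
  obtain ⟨i, rfl⟩ := List.mem_ofFn.1 hc
  have hm : t (π i) * y (π i) ∈ List.ofFn fun i => t i * y i := List.mem_ofFn.2 ⟨π i, rfl⟩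
  obtain ⟨l₁, l₂, hl⟩ := List.append_of_mem hm
  exact ⟨l₁.prod * t (π i), l₂.prod, by rw [hl]; simp [mul_assoc]⟩

/-- Square the nonfirst `x` by `xtx ≈ xtx²`, move the square over `y`, and contract it again. -/
theorem HLaw.iLaw (h : PhiLaws M) (hH : HLaw M) : ILaw M := by
  intro x t y s
  have e1 : ∀ m : M, x * t * x * m = x * t * (x ^ 2 * m) := fun m => by
    rw [← mul_assoc, ← h.xtx]
  have e2 := hH x y s
  calc x * t * x * y * s * y = x * t * x * (y * s * y) := by simp only [mul_assoc]
    _ = x * t * (x ^ 2 * (y * s * y)) := e1 _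
    _ = x * t * (x ^ 2 * y * s * y) := by simp only [mul_assoc]
    _ = x * t * (y * x ^ 2 * s * y) := by rw [e2]
    _ = x * (t * y) * x ^ 2 * (s * y) := by simp only [mul_assoc]
    _ = x * (t * y) * x * (s * y) := by rw [← h.xtx]
    _ = x * t * y * x * s * y := by simp only [mul_assoc]

/-- For the last law, `xtxs ≈ xtxsx` lets `xy` be appended at the right end of both sides; then
`xytxy ≈ yxtxy` exchanges the adjacent `x` and `y`. -/
theorem laws_of_mem_varF {M : Type u} [Monoid M] (h : varF.Mem M) : PhiLaws M ∧ ILaw M := by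
  obtain ⟨h1, h2, h3⟩ := mem_varF.1 h
  refine ⟨⟨fun x t => ?_, h1, h2, fun x t₁ t₂ t₃ => ?_⟩, fun x t y s => ?_⟩
  · simpa [pow_two, mul_assoc] using h3 x t 1
  · simpa [mul_assoc] using congrArg (· * t₃ * x) (h3 x t₁ t₂)
  · have e1 := h3 x t (y * s * y)
    have e2 := congrArg (x * t * x * ·) (h3 y s x)
    have e3 := congrArg (x * t * ·) (h2 x y (s * y))
    have e4 := congrArg (x * t * ·) (h3 y (x * s) x)
    have e5 := h3 x (t * y) (s * y)
    simp only [mul_assoc] at e1 e2 e3 e4 e5 ⊢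
    rw [e1, e2, e3, ← e4, ← e5]

end implications

theorem varI_le_varJ : (varI : MonoidVariety.{u}) ≤ varJ := fun _ _ h =>
  mem_varJ.2 ⟨(mem_varI.1 h).1, (mem_varI.1 h).2.wLaw⟩

theorem varH_le_varI : (varH : MonoidVariety.{u}) ≤ varI := fun _ _ h =>
  mem_varI.2 ⟨(mem_varH.1 h).1, HLaw.iLaw (mem_varH.1 h).1 (mem_varH.1 h).2.1⟩

theorem varF_le_varI : (varF : MonoidVariety.{u}) ≤ varI := fun _ _ h =>
  mem_varI.2 (laws_of_mem_varF h)

theorem varH_le_varJ : (varH : MonoidVariety.{u}) ≤ varJ :=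
  MonoidVariety.le_trans' varH_le_varI varI_le_varJ

theorem varF_le_varJ : (varF : MonoidVariety.{u}) ≤ varJ :=
  MonoidVariety.le_trans' varF_le_varI varI_le_varJ

/-! ## `λ`-words -/

/-- The word `u` with each run of equal letters contracted to one letter. -/
def red : List ℕ → List ℕ
  | [] => []
  | [a] => [a]
  | a :: b :: l => if a = b then red (b :: l) else a :: red (b :: l)

theorem red_dup (c : ℕ) (r : List ℕ) : ∀ l : List ℕ, red (l ++ c :: c :: r) = red (l ++ c :: r)
  | [] => by simp [red]
  | [a] => by
    simp [red]
  | a :: b :: l => by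
    have h := red_dup c r (b :: l)
    simp only [List.cons_append] at h
    simp only [List.cons_append, red, h]

theorem red_eq_nil {u : List ℕ} (h : red u = []) : u = [] := by
  induction u with
  | nil => rfl
  | cons a u ih =>
    cases u with
    | nil => simp [red] at h
    | cons b l =>
      rw [red] at h
      split_ifs at h
      simpa using ih h

theorem red_eq_cons {c : ℕ} {m : List ℕ} :
    ∀ {u : List ℕ}, red u = c :: m → ∃ k u', u = List.replicate (k + 1) c ++ u' ∧ red u' = m
  | [], h => by simp [red] at h
  | [a], h => by
    simp only [red, List.cons.injEq] at h
    exact ⟨0, [], by simp [h.1], by simp [red, h.2]⟩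
  | a :: b :: l, h => by
    rw [red] at h
    split_ifs at h with hab
    · obtain ⟨k, u', h1, h2⟩ := red_eq_cons h
      have hb : b = c := by simpa [List.replicate_succ] using congrArg List.head? h1
      exact ⟨k + 1, u', by rw [h1, hab, hb, List.replicate_succ (n := k + 1)]; rfl, h2⟩
    · simp only [List.cons.injEq] at h
      exact ⟨0, b :: l, by simp [h.1], h.2⟩

/-- Auxiliary congruence: equal contractions in every context. -/
def redCon : Con (FreeMonoid ℕ) where
  r u w := ∀ l r, red (l ++ u.toList ++ r) = red (l ++ w.toList ++ r)
  iseqv := ⟨fun _ _ _ => rfl, fun h l r => (h l r).symm, fun h k l r => (h l r).trans (k l r)⟩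
  mul' := by
    intro u u' w w' h k l r
    have h1 := h l (w.toList ++ r)
    have h2 := k (l ++ u'.toList) r
    simp only [FreeMonoid.toList_mul, List.append_assoc] at h1 h2 ⊢
    rw [h1, h2]

theorem red_eq_of_tauOne {u w : FreeMonoid ℕ} (h : tauOne u w) : red u.toList = red w.toList := by
  have hle : tauOne ≤ redCon := by
    refine Con.conGen_le.2 ?_
    rintro _ _ ⟨a, rfl, rfl⟩ l r
    have := red_dup a r l
    simpa [pow_two] using this.symm
  simpa using hle h [] []

/-- The `λ`-word of a word. -/
def cls (u : List ℕ) : lam.Quotient := ((FreeMonoid.ofList u : FreeMonoid ℕ) : lam.Quotient)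

theorem cls_append (u w : List ℕ) : cls (u ++ w) = cls u * cls w := rfl

theorem cls_surjective : Function.Surjective cls := fun q =>
  Con.induction_on q fun u => ⟨u.toList, rfl⟩

theorem cls_eq_iff {u w : List ℕ} :
    cls u = cls w ↔ LambdaRel (FreeMonoid.ofList u) (FreeMonoid.ofList w) := Con.eq _

/-- The first two occurrences of `a` in `u` are adjacent. -/
abbrev FTA (a : ℕ) (u : List ℕ) : Prop := FirstTwoAdjacent a (FreeMonoid.ofList u)

section invariants

variable {u w : List ℕ} (h : cls u = cls w)
include h

theorem red_eq_of_cls : red u = red w := red_eq_of_tauOne (cls_eq_iff.1 h).1.1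

theorem fta_iff_of_cls (a : ℕ) : FTA a u ↔ FTA a w := by
  have h1 := cls_eq_iff.1 h
  constructor
  · intro k
    exact (h1.2 a k.mem_mul).1 k
  · intro k
    exact (h1.2 a (h1.1.2 ▸ k.mem_mul)).2 k

theorem count_eq_one_iff_of_cls (a : ℕ) : u.count a = 1 ↔ w.count a = 1 :=
  (count_of_rel (cls_eq_iff.1 h).1 a).2

theorem count_eq_zero_iff_of_cls (a : ℕ) : u.count a = 0 ↔ w.count a = 0 :=
  (count_of_rel (cls_eq_iff.1 h).1 a).1

theorem two_le_count_iff_of_cls (a : ℕ) : 2 ≤ u.count a ↔ 2 ≤ w.count a := by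
  have h1 := count_eq_one_iff_of_cls h a
  have h2 := count_eq_zero_iff_of_cls h a
  omega

theorem head_eq_of_cls : u.head? = w.head? := (tauOne_ends (cls_eq_iff.1 h).1.1).1

theorem getLast_eq_of_cls : u.getLast? = w.getLast? := (tauOne_ends (cls_eq_iff.1 h).1.1).2.1

end invariants

theorem fta_cons (a b : ℕ) (l : List ℕ) :
    FTA a (b :: l) ↔ (b = a ∧ l.head? = some a) ∨ (b ≠ a ∧ FTA a l) :=
  firstTwoAdjacent_cons a b l

theorem not_fta_nil (a : ℕ) : ¬ FTA a [] := by
  rintro ⟨p, r, h, -⟩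
  simp at h

theorem tauOne_dup (c : ℕ) : tauOne (FreeMonoid.ofList [c]) (FreeMonoid.ofList [c, c]) :=
  ConGen.Rel.of _ _ ⟨c, rfl, rfl⟩

/-- Since `c` occurs in `p`, a further copy changes neither the set of multiple letters nor the
adjacency of first two occurrences. Hence an `n⁺` after an earlier `n` is the same as a single `n`.
-/
theorem cls_dup_right {p : List ℕ} {c : ℕ} (hc : c ∈ p) : cls (p ++ [c]) = cls (p ++ [c, c]) := by
  rw [cls_eq_iff]
  refine ⟨⟨tauOne.mul (tauOne.refl (FreeMonoid.ofList p)) (tauOne_dup c), ?_⟩, fun b _ => ?_⟩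
  · ext b
    have := List.count_pos_iff.2 hc
    by_cases hb : b = c
    · subst hb
      simp [mulLetters, List.count_append]
      omega
    · simp [mulLetters, List.count_append, Ne.symm hb]
  · have h1 := firstTwoAdjacent_mul b (FreeMonoid.ofList p) (FreeMonoid.ofList [c])
    have h2 := firstTwoAdjacent_mul b (FreeMonoid.ofList p) (FreeMonoid.ofList [c, c])
    change FirstTwoAdjacent b (FreeMonoid.ofList p * FreeMonoid.ofList [c]) ↔
      FirstTwoAdjacent b (FreeMonoid.ofList p * FreeMonoid.ofList [c, c])
    rw [h1, h2]
    have h3 := fta_cons b c []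
    have h4 := fta_cons b c [c]
    have h5 := not_fta_nil b
    have h6 : List.count b p = 0 → b ≠ c := by
      rintro h rfl
      exact List.count_eq_zero.1 h hc
    simp only [FTA] at h3 h4 h5
    simp only [h3, h4, FreeMonoid.toList_ofList, eq_false h5, List.head?_cons, List.head?_nil,
      and_false, or_false, reduceCtorEq]
    have h7 : (c = b ∧ some c = some b) ↔ c = b := by simp
    rw [h7]
    constructor
    · exact Or.imp_right fun k => Or.inl k
    · exact Or.imp_right fun k => k.elim id fun k => absurd k.2.symm (h6 k.1)

theorem cls_dup {p : List ℕ} {c : ℕ} (hc : c ∈ p) (q : List ℕ) :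
    cls (p ++ c :: q) = cls (p ++ c :: c :: q) := by
  have := congrArg (· * cls q) (cls_dup_right hc)
  simpa [← cls_append] using this

theorem cls_replicate {p : List ℕ} {c : ℕ} (hc : c ∈ p) (q : List ℕ) (m : ℕ) :
    cls (p ++ (List.replicate (m + 1) c ++ q)) = cls (p ++ c :: q) := by
  induction m with
  | zero => simp
  | succ m ih =>
    rw [← ih]
    have := cls_dup hc (List.replicate m c ++ q)
    simpa [List.replicate_succ] using this.symm

theorem cls_replicate_first (q : List ℕ) (c m : ℕ) :
    cls (List.replicate (m + 2) c ++ q) = cls (c :: c :: q) := by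
  have := cls_replicate (p := [c]) (c := c) (by simp) q m
  simpa [List.replicate_succ] using this

/-! ### Classes of some `λ`-words -/

section classes

variable {a b t s : ℕ}

/-- Contracting runs determines the order of the runs. The runs of `t` and `s` have length one
because these letters are simple, and the first runs of `a` and `b` because their first two
occurrences are not adjacent. The other two runs are free. The descriptions of the other classes
below are obtained in the same way. -/
theorem cls_eq_atba (hab : a ≠ b) (hat : a ≠ t) (has : a ≠ s) (hbt : b ≠ t) (hbs : b ≠ s)
    (hts : t ≠ s) {u : List ℕ} : cls u = cls [a, t, b, a, s, b] ↔
      ∃ i j, u = a :: t :: b :: (List.replicate (i + 1) a ++ s :: List.replicate (j + 1) b) := by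
  constructor
  · intro h
    have hr := red_eq_of_cls h
    simp only [red, hat, hbt.symm, hab.symm, has, hbs.symm, if_false] at hr
    obtain ⟨k₁, u₁, h1, hr⟩ := red_eq_cons hr
    obtain ⟨k₂, u₂, h2, hr⟩ := red_eq_cons hr
    obtain ⟨k₃, u₃, h3, hr⟩ := red_eq_cons hr
    obtain ⟨k₄, u₄, h4, hr⟩ := red_eq_cons hr
    obtain ⟨k₅, u₅, h5, hr⟩ := red_eq_cons hr
    obtain ⟨k₆, u₆, h6, hr⟩ := red_eq_cons hr
    have h7 := red_eq_nil hr
    subst h7 h6 h5 h4 h3 h2 h1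
    have c1 := (count_eq_one_iff_of_cls h t).2 (by simp [hat, hbt, hts.symm])
    have c2 := (count_eq_one_iff_of_cls h s).2 (by simp [has, hbs, hts])
    simp [List.count_append, List.count_replicate, hat, hbt, hts.symm] at c1
    simp [List.count_append, List.count_replicate, has, hbs, hts] at c2
    subst c1 c2
    have e1 : k₁ = 0 := by
      by_contra hk
      obtain ⟨k, rfl⟩ := Nat.exists_eq_succ_of_ne_zero hk
      have := (fta_iff_of_cls h a).1 ⟨[], _, by simp [List.replicate_succ]; rfl, by simp⟩
      simp [fta_cons, hat.symm] at this
    have e3 : k₃ = 0 := by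
      by_contra hk
      obtain ⟨k, rfl⟩ := Nat.exists_eq_succ_of_ne_zero hk
      have := (fta_iff_of_cls h b).1 ⟨[a, t], _, by simp [e1, List.replicate_succ]; rfl,
        by simp [hab.symm, hbt]⟩
      simp [fta_cons, hbt.symm, hab] at this
    exact ⟨k₄, k₆, by simp [e1, e3]⟩
  · rintro ⟨i, j, rfl⟩
    have h1 := cls_replicate (p := [a, t, b]) (c := a) (by simp)
      (s :: List.replicate (j + 1) b) i
    have h2 := cls_replicate (p := [a, t, b, a, s]) (c := b) (by simp) [] j
    simp only [List.cons_append, List.nil_append, List.append_nil] at h1 h2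
    rw [h1, h2]

theorem cls_eq_abta (hab : a ≠ b) (hat : a ≠ t) (has : a ≠ s) (hbt : b ≠ t) (hbs : b ≠ s)
    (hts : t ≠ s) {u : List ℕ} : cls u = cls [a, b, t, a, s, b] ↔
      ∃ i j, u = a :: b :: t :: (List.replicate (i + 1) a ++ s :: List.replicate (j + 1) b) := by
  constructor
  · intro h
    have hr := red_eq_of_cls h
    simp only [red, hat.symm, hbt, hab, has, hbs.symm, if_false] at hr
    obtain ⟨k₁, u₁, h1, hr⟩ := red_eq_cons hr
    obtain ⟨k₂, u₂, h2, hr⟩ := red_eq_cons hr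
    obtain ⟨k₃, u₃, h3, hr⟩ := red_eq_cons hr
    obtain ⟨k₄, u₄, h4, hr⟩ := red_eq_cons hr
    obtain ⟨k₅, u₅, h5, hr⟩ := red_eq_cons hr
    obtain ⟨k₆, u₆, h6, hr⟩ := red_eq_cons hr
    have h7 := red_eq_nil hr
    subst h7 h6 h5 h4 h3 h2 h1
    have c1 := (count_eq_one_iff_of_cls h t).2 (by simp [hat, hbt, hts.symm])
    have c2 := (count_eq_one_iff_of_cls h s).2 (by simp [has, hbs, hts])
    simp [List.count_append, List.count_replicate, hat, hbt, hts.symm] at c1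
    simp [List.count_append, List.count_replicate, has, hbs, hts] at c2
    subst c1 c2
    have e1 : k₁ = 0 := by
      by_contra hk
      obtain ⟨k, rfl⟩ := Nat.exists_eq_succ_of_ne_zero hk
      have := (fta_iff_of_cls h a).1 ⟨[], _, by simp [List.replicate_succ]; rfl, by simp⟩
      simp [fta_cons, hab.symm] at this
    have e3 : k₂ = 0 := by
      by_contra hk
      obtain ⟨k, rfl⟩ := Nat.exists_eq_succ_of_ne_zero hk
      have := (fta_iff_of_cls h b).1 ⟨[a], _, by simp [e1, List.replicate_succ]; rfl,
        by simp [hab.symm]⟩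
      simp [fta_cons, hbt.symm, hab] at this
    exact ⟨k₄, k₆, by simp [e1, e3]⟩
  · rintro ⟨i, j, rfl⟩
    have h1 := cls_replicate (p := [a, b, t]) (c := a) (by simp)
      (s :: List.replicate (j + 1) b) i
    have h2 := cls_replicate (p := [a, b, t, a, s]) (c := b) (by simp) [] j
    simp only [List.cons_append, List.nil_append, List.append_nil] at h1 h2
    rw [h1, h2]

theorem cls_eq_baas (hab : a ≠ b) (has : a ≠ s) (hbs : b ≠ s) {u : List ℕ} :
    cls u = cls [b, a, a, s, b] ↔
      ∃ i j, u = b :: (List.replicate (i + 2) a ++ s :: List.replicate (j + 1) b) := by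
  constructor
  · intro h
    have hr := red_eq_of_cls h
    simp only [red, hab.symm, has, hbs.symm, if_false, if_true] at hr
    obtain ⟨k₁, u₁, h1, hr⟩ := red_eq_cons hr
    obtain ⟨k₂, u₂, h2, hr⟩ := red_eq_cons hr
    obtain ⟨k₃, u₃, h3, hr⟩ := red_eq_cons hr
    obtain ⟨k₄, u₄, h4, hr⟩ := red_eq_cons hr
    have h7 := red_eq_nil hr
    subst h7 h4 h3 h2 h1
    have c2 := (count_eq_one_iff_of_cls h s).2 (by simp [has, hbs])
    have c3 := (two_le_count_iff_of_cls h a).2 (by simp [hab.symm, has.symm])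
    simp [List.count_append, List.count_replicate, has, hbs] at c2
    simp [List.count_append, List.count_replicate, hab.symm, has.symm] at c3
    subst c2
    obtain ⟨k, rfl⟩ : ∃ k, k₂ = k + 1 := ⟨k₂ - 1, by omega⟩
    have e1 : k₁ = 0 := by
      by_contra hk
      obtain ⟨k, rfl⟩ := Nat.exists_eq_succ_of_ne_zero hk
      have := (fta_iff_of_cls h b).1 ⟨[], _, by simp [List.replicate_succ]; rfl, by simp⟩
      simp [fta_cons, hab] at this
    exact ⟨k, k₄, by simp [e1]⟩
  · rintro ⟨i, j, rfl⟩
    have h1 := congrArg (cls [b] * ·) (cls_replicate_first (s :: List.replicate (j + 1) b) a i)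
    have h2 := cls_replicate (p := [b, a, a, s]) (c := b) (by simp) [] j
    simp only [← cls_append, List.cons_append, List.nil_append, List.append_nil] at h1 h2
    rw [h1, h2]

theorem cls_eq_ata (hat : a ≠ t) {u : List ℕ} :
    cls u = cls [a, t, a] ↔ ∃ i, u = a :: t :: List.replicate (i + 1) a := by
  constructor
  · intro h
    have hr := red_eq_of_cls h
    simp only [red, hat, hat.symm, if_false] at hr
    obtain ⟨k₁, u₁, h1, hr⟩ := red_eq_cons hr
    obtain ⟨k₂, u₂, h2, hr⟩ := red_eq_cons hr
    obtain ⟨k₃, u₃, h3, hr⟩ := red_eq_cons hr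
    have h7 := red_eq_nil hr
    subst h7 h3 h2 h1
    have c2 := (count_eq_one_iff_of_cls h t).2 (by simp [hat])
    simp [List.count_append, List.count_replicate, hat] at c2
    subst c2
    have e1 : k₁ = 0 := by
      by_contra hk
      obtain ⟨k, rfl⟩ := Nat.exists_eq_succ_of_ne_zero hk
      have := (fta_iff_of_cls h a).1 ⟨[], _, by simp [List.replicate_succ]; rfl, by simp⟩
      simp [fta_cons, hat.symm] at this
    exact ⟨k₃, by simp [e1]⟩
  · rintro ⟨i, rfl⟩
    have h1 := cls_replicate (p := [a, t]) (c := a) (by simp) [] i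
    simpa using h1

end classes

/-! ## The monoids `M_λ(W)` -/

/-- The element of `M_λ(W)` represented by a word. -/
def mkM (W : Set lam.Quotient) (u : List ℕ) : MLam W := ((cls u : lam.Quotient) : (reesCon W).Quotient)

/-- The words whose `λ`-class is a factor of an element of `W`. -/
def Fac (W : Set lam.Quotient) : Set (List ℕ) := {u | cls u ∈ tauClosure W}

section

variable {W : Set lam.Quotient}

theorem mkM_append (u w : List ℕ) : mkM W (u ++ w) = mkM W u * mkM W w := rfl

theorem mkM_surjective : Function.Surjective (mkM W) := by
  intro m
  induction m using Con.induction_on with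
  | _ q =>
    obtain ⟨u, rfl⟩ := cls_surjective q
    exact ⟨u, rfl⟩

theorem mkM_eq_iff {u w : List ℕ} :
    mkM W u = mkM W w ↔ cls u = cls w ∨ (u ∉ Fac W ∧ w ∉ Fac W) := Con.eq _

theorem mkM_eq {u w : List ℕ} (h : u ∈ Fac W ∨ w ∈ Fac W → cls u = cls w) :
    mkM W u = mkM W w := by
  rw [mkM_eq_iff]
  tauto

theorem ev_mkM (ψ : ℕ → List ℕ) (u : List ℕ) : ev (fun n => mkM W (ψ n)) u = mkM W (u.flatMap ψ) := by
  induction u with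
  | nil => rfl
  | cons a u ih => rw [ev_cons, ih, List.flatMap_cons, mkM_append]

theorem fac_of_append {l u r : List ℕ} (h : l ++ u ++ r ∈ Fac W) : u ∈ Fac W := by
  obtain ⟨p, hp, l', r', h⟩ := h
  exact ⟨p, hp, l' * cls l, cls r * r', by rw [h, cls_append, cls_append]; simp only [mul_assoc]⟩

theorem fac_of_infix {u w : List ℕ} (h : w ∈ Fac W) (k : u <:+: w) : u ∈ Fac W := by
  obtain ⟨l, r, rfl⟩ := k
  exact fac_of_append h

theorem fac_of_cls {u w : List ℕ} (h : w ∈ Fac W) (k : cls u = cls w) : u ∈ Fac W := by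
  change cls u ∈ tauClosure W
  rw [k]
  exact h

theorem mem_fac_singleton {u w : List ℕ} :
    u ∈ Fac {cls w} ↔ ∃ l r, cls (l ++ u ++ r) = cls w := by
  constructor
  · rintro ⟨_, rfl, l, r, h⟩
    obtain ⟨l, rfl⟩ := cls_surjective l
    obtain ⟨r, rfl⟩ := cls_surjective r
    exact ⟨l, r, h.symm⟩
  · rintro ⟨l, r, h⟩
    exact ⟨_, rfl, cls l, cls r, h.symm⟩

theorem mem_fac_insert {u : List ℕ} {p : lam.Quotient} :
    u ∈ Fac (insert p W) ↔ u ∈ Fac {p} ∨ u ∈ Fac W := by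
  constructor
  · rintro ⟨q, rfl | hq, h⟩
    · exact Or.inl ⟨q, rfl, h⟩
    · exact Or.inr ⟨q, hq, h⟩
  · rintro (⟨q, rfl, h⟩ | ⟨q, hq, h⟩)
    · exact ⟨_, Or.inl rfl, h⟩
    · exact ⟨q, Or.inr hq, h⟩

/-- The identity `u ≈ w` holds in `M_λ(W)`, in terms of words. -/
def Sim (W : Set lam.Quotient) (u w : List ℕ) : Prop :=
  ∀ ψ : ℕ → List ℕ, (u.flatMap ψ ∈ Fac W ∨ w.flatMap ψ ∈ Fac W) →
    cls (u.flatMap ψ) = cls (w.flatMap ψ)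

theorem Sim.symm {u w : List ℕ} (h : Sim W u w) : Sim W w u := fun ψ k => (h ψ k.symm).symm

theorem sim_of_ev {u w : List ℕ} (h : ∀ φ : ℕ → MLam W, ev φ u = ev φ w) : Sim W u w := by
  intro ψ hψ
  have := h fun n => mkM W (ψ n)
  rw [ev_mkM, ev_mkM, mkM_eq_iff] at this
  tauto

end

/-! ### Substitutions of letters -/

theorem flatMap_eq_replicate {ψ : ℕ → List ℕ} {x c : ℕ} (hx : ψ x = [c]) {l : List ℕ}
    (h : ∀ n ∈ l, n ≠ x → ψ n = []) : l.flatMap ψ = List.replicate (l.count x) c := by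
  induction l with
  | nil => rfl
  | cons n l ih =>
    have := ih fun m hm => h m (by simp [hm])
    by_cases hn : n = x
    · subst hn
      simp [this, hx, List.replicate_succ]
    · simp [this, h n (by simp) hn, hn]

theorem flatMap_eq_nil {ψ : ℕ → List ℕ} {l : List ℕ} (h : ∀ n ∈ l, ψ n = []) :
    l.flatMap ψ = [] := by
  simpa [List.flatMap_eq_nil_iff] using h

theorem count_flatMap_letter {ψ : ℕ → List ℕ} {x c : ℕ} (hx : ψ x = [c])
    (h : ∀ n, n ≠ x → c ∉ ψ n) (l : List ℕ) : (l.flatMap ψ).count c = l.count x := by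
  induction l with
  | nil => rfl
  | cons n l ih =>
    rw [List.flatMap_cons, List.count_append, ih]
    by_cases hn : n = x
    · subst hn
      simp [hx]
      omega
    · simp [List.count_eq_zero.2 (h n hn), hn]

theorem flatMap_bef {ψ : ℕ → List ℕ} {x c : ℕ} (hx : ψ x = [c])
    (h : ∀ n, n ≠ x → c ∉ ψ n) {l : List ℕ} (hl : x ∈ l) :
    (bef x l).flatMap ψ = bef c (l.flatMap ψ) := by
  obtain ⟨p, q, rfl, hp⟩ := exists_first_occurrence hl
  rw [bef_append_cons hp, List.flatMap_append, List.flatMap_cons, hx, List.cons_append,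
    List.nil_append, bef_append_cons]
  rw [← List.count_eq_zero, count_flatMap_letter hx h]
  exact List.count_eq_zero.2 hp

/-! ### Invariants of the identities of `M_λ(W)` -/

section

variable {W : Set lam.Quotient} {u w : List ℕ}

/-- The first letter detects `1 ≤ i`, the adjacency of the first two occurrences of `c` detects `2 ≤
i`, and the last letter detects `1 ≤ j`. -/
theorem cls_pow_mul_pow {c i j i' j' : ℕ} {T : List ℕ} (hT : T ≠ []) (hc : c ∉ T)
    (h : cls (List.replicate i c ++ T ++ List.replicate j c) =
      cls (List.replicate i' c ++ T ++ List.replicate j' c)) :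
    (1 ≤ i ↔ 1 ≤ i') ∧ (2 ≤ i ↔ 2 ≤ i') ∧ (1 ≤ j ↔ 1 ≤ j') := by
  obtain ⟨d, T', rfl⟩ := List.exists_cons_of_ne_nil hT
  have hd : d ≠ c := fun e => hc (by simp [e])
  have head : ∀ i j, (List.replicate i c ++ (d :: T') ++ List.replicate j c).head? = some c ↔
      1 ≤ i := by
    intro i j
    cases i <;> simp [List.replicate_succ, hd]
  have last : ∀ i j, (List.replicate i c ++ (d :: T') ++ List.replicate j c).getLast? = some c ↔
      1 ≤ j := by
    intro i j
    rw [List.getLast?_append]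
    cases j with
    | zero =>
      simp only [List.replicate_zero, List.getLast?_nil, Option.none_or, List.getLast?_append]
      have : ∀ e, (d :: T').getLast? = some e → e ≠ c := fun e he hec =>
        hc (hec ▸ List.mem_of_getLast? he)
      simp only [List.getLast?_eq_some_getLast (List.cons_ne_nil d T'), Option.some_or,
        Option.some.injEq]
      have := this _ (List.getLast?_eq_some_getLast (List.cons_ne_nil d T'))
      simp [this]
    | succ j => simp [List.getLast?_replicate]
  have fta : ∀ i j, 1 ≤ i → (FTA c (List.replicate i c ++ (d :: T') ++ List.replicate j c) ↔
      2 ≤ i) := by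
    intro i j hi
    obtain ⟨i, rfl⟩ := Nat.exists_eq_add_of_le' hi
    cases i <;> simp [List.replicate_succ, fta_cons, hd]
  have h1 := head_eq_of_cls h
  have h2 := getLast_eq_of_cls h
  have h3 := fta_iff_of_cls h c
  have k1 : 1 ≤ i ↔ 1 ≤ i' := by rw [← head i j, h1, head]
  refine ⟨k1, ?_, by rw [← last i j, h2, last]⟩
  by_cases hi : 1 ≤ i
  · rw [← fta i j hi, h3, fta i' j' (k1.1 hi)]
  · omega

/-- The substitution `x ↦ c`, `t ↦ T`, all other letters to the empty word. -/
def subst₂ (x t : ℕ) (c : ℕ) (T : List ℕ) (n : ℕ) : List ℕ :=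
  if n = x then [c] else if n = t then T else []

theorem flatMap_subst₂ {x t c : ℕ} {T : List ℕ} (hxt : x ≠ t) (ht : u.count t = 1) :
    u.flatMap (subst₂ x t c T) = List.replicate ((bef t u).count x) c ++ T ++
      List.replicate ((aft t u).count x) c := by
  have hu := eq_bef_append_aft (List.count_pos_iff.1 (by omega : 0 < u.count t))
  have h1 := not_mem_bef t u
  have h2 : t ∉ aft t u := by
    intro hc
    have := List.count_pos_iff.2 hc
    rw [hu, List.count_append, List.count_cons_self] at ht
    omega
  have key : ∀ l : List ℕ, t ∉ l → l.flatMap (subst₂ x t c T) = List.replicate (l.count x) c := by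
    intro l hl
    refine flatMap_eq_replicate (by simp [subst₂]) fun n hn hnx => ?_
    have : n ≠ t := fun e => hl (e ▸ hn)
    simp [subst₂, hnx, this]
  have ht' : subst₂ x t c T t = T := by simp [subst₂, hxt.symm]
  conv_lhs => rw [hu]
  rw [List.flatMap_append, List.flatMap_cons, key _ h1, key _ h2, ht', List.append_assoc]

/-- Erasing all letters but `x` compares numbers of occurrences; sending also a simple `t` to `T`
compares the numbers of `x` before it. Only exponents at most `1` on the left have to give factors,
since two exponents that are both at least `2` need not be told apart. -/
theorem sameF_of_sim {c : ℕ} {T : List ℕ} (hT : T ≠ []) (hc : c ∉ T)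
    (hW : c :: (T ++ [c, c]) ∈ Fac W) (h : Sim W u w) : SameF u w := by
  have hcc : ∀ k ≤ 2, List.replicate k c ∈ Fac W := by
    intro k hk
    refine fac_of_append (l := c :: T) (r := List.replicate (2 - k) c) ?_
    rw [List.append_assoc, ← List.replicate_add, show k + (2 - k) = 2 by omega]
    exact hW
  have hrep : ∀ (x : ℕ) (u : List ℕ), u.flatMap (subst₂ x x c []) = List.replicate (u.count x) c :=
    fun x u => flatMap_eq_replicate (by simp [subst₂]) fun n _ hn => by simp [subst₂, hn]
  have hcount : ∀ x, (u.count x = 0 ↔ w.count x = 0) ∧ (2 ≤ u.count x ↔ 2 ≤ w.count x) := by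
    intro x
    by_cases h2 : u.count x ≤ 1 ∨ w.count x ≤ 1
    · have := h (subst₂ x x c []) (by
        rw [hrep, hrep]
        exact h2.imp (fun k => hcc _ (by omega)) fun k => hcc _ (by omega))
      rw [hrep, hrep] at this
      have k1 := count_eq_one_iff_of_cls this c
      have k2 := count_eq_zero_iff_of_cls this c
      simp only [List.count_replicate_self] at k1 k2
      omega
    · omega
  have hone : ∀ x, u.count x = 1 ↔ w.count x = 1 := by
    intro x
    have := hcount x
    omega
  -- The exponent `j` on the right may exceed `2`, but then `cʲ` and `c²` lie in the same `λ`-class.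
  have small : ∀ i j, i ≤ 1 → List.replicate i c ++ T ++ List.replicate j c ∈ Fac W := by
    intro i j hi
    have h2 : ∀ j ≤ 2, List.replicate i c ++ T ++ List.replicate j c ∈ Fac W := by
      intro j hj
      refine fac_of_append (l := List.replicate (1 - i) c) (r := List.replicate (2 - j) c) ?_
      have : List.replicate (1 - i) c ++ (List.replicate i c ++ T ++ List.replicate j c) ++
          List.replicate (2 - j) c = (List.replicate (1 - i) c ++ List.replicate i c) ++
            (T ++ (List.replicate j c ++ List.replicate (2 - j) c)) := by
        simp only [List.append_assoc]
      rw [this, ← List.replicate_add, ← List.replicate_add, show 1 - i + i = 1 by omega,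
        show j + (2 - j) = 2 by omega]
      exact hW
    by_cases hj : j ≤ 2
    · exact h2 j hj
    · refine fac_of_cls (h2 2 le_rfl) ?_
      have := cls_replicate_first [] c (j - 2)
      rw [cls_append _ (List.replicate j c), cls_append _ (List.replicate 2 c)]
      congr 1
      simpa [show j - 2 + 2 = j by omega] using this
  have hbef : ∀ t x, u.count t = 1 → w.count t = 1 →
      (x ∈ bef t u ↔ x ∈ bef t w) ∧ (2 ≤ (bef t u).count x ↔ 2 ≤ (bef t w).count x) := by
    intro t x htu htw
    rcases eq_or_ne x t with rfl | hxt
    · have h1 := not_mem_bef x u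
      have h2 := not_mem_bef x w
      simp [h1, h2, List.count_eq_zero.2 h1, List.count_eq_zero.2 h2]
    rw [← List.count_pos_iff, ← List.count_pos_iff]
    by_cases h2 : (bef t u).count x ≤ 1 ∨ (bef t w).count x ≤ 1
    · have := h (subst₂ x t c T) (by
        rw [flatMap_subst₂ hxt htu, flatMap_subst₂ hxt htw]
        exact h2.imp (small _ _) (small _ _))
      rw [flatMap_subst₂ hxt htu, flatMap_subst₂ hxt htw] at this
      have := cls_pow_mul_pow hT hc this
      exact ⟨this.1, this.2.1⟩
    · omega
  refine ⟨fun x => ?_, fun x => (hcount x).2, fun t x => ?_, fun t x => ?_⟩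
  · have := (hcount x).1
    rw [List.count_eq_zero, List.count_eq_zero] at this
    exact not_iff_not.1 this
  · have := hbef t x
    have := hone t
    tauto
  · have := hbef t x
    have := hone t
    tauto

/-- Suppose `x` occurs after the simple `t` in `w` but not in `u`. By `SameF` it occurs before `t`
in both words, so it is multiple and at least two of its occurrences precede `t` in `u`. The image
of `u` is then in the class of `ddT`, which determines that nothing follows `T`. -/
theorem sameL_of_sim {d : ℕ} {T : List ℕ} (hT : T ≠ []) (hd : d ∉ T)
    (hW : d :: d :: T ∈ Fac W) (hF : SameF u w) (h : Sim W u w) : SameL u w := by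
  have key : ∀ {u w : List ℕ} (t x : ℕ), SameF u w → Sim W u w → u.count t = 1 →
      x ∈ aft t w → x ∈ aft t u := by
    intro u w t x hF h htu hxw
    by_contra hxu
    have htw := (hF.count_eq_one t).1 htu
    have cu : ∀ y, u.count y = (bef t u).count y + ((aft t u).count y + if t = y then 1 else 0) := by
      intro y
      conv_lhs => rw [eq_bef_append_aft (List.count_pos_iff.1 (by omega : 0 < u.count t))]
      simp [List.count_append, List.count_cons]
    have cw : ∀ y, w.count y = (bef t w).count y + ((aft t w).count y + if t = y then 1 else 0) := by
      intro y
      conv_lhs => rw [eq_bef_append_aft (List.count_pos_iff.1 (by omega : 0 < w.count t))]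
      simp [List.count_append, List.count_cons]
    have hxw' := List.count_pos_iff.2 hxw
    have hxu' := List.count_eq_zero.2 hxu
    have hxt : x ≠ t := by
      rintro rfl
      have := cw x
      simp at this
      omega
    have h1 := hF.mem x
    have h2 := hF.two x
    have h3 := hF.mem_bef htu x
    rw [← List.count_pos_iff, ← List.count_pos_iff] at h1 h3
    have h4 := cu x
    have h5 := cw x
    rw [if_neg hxt.symm] at h4 h5
    have h6 : 2 ≤ (bef t u).count x := by omega
    have := h (subst₂ x t d T) (Or.inl (by
      rw [flatMap_subst₂ hxt htu, hxu']
      refine fac_of_cls hW ?_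
      have := cls_replicate_first T d ((bef t u).count x - 2)
      simpa [show (bef t u).count x - 2 + 2 = (bef t u).count x by omega] using this))
    rw [flatMap_subst₂ hxt htu, flatMap_subst₂ hxt htw] at this
    have := (cls_pow_mul_pow hT hd this).2.2
    omega
  intro t x
  constructor
  · rintro ⟨h1, h2⟩
    exact ⟨(hF.count_eq_one t).1 h1, key t x hF.symm h.symm ((hF.count_eq_one t).1 h1) h2⟩
  · rintro ⟨h1, h2⟩
    exact ⟨(hF.count_eq_one t).2 h1, key t x hF h ((hF.count_eq_one t).2 h1) h2⟩

/-- The substitution `x ↦ a`, `y ↦ b`, `t ↦ t'`, `s ↦ s'`, all other letters to the empty word. -/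
def subst₄ (x y t s : ℕ) (a b t' s' : ℕ) (n : ℕ) : List ℕ :=
  if n = x then [a] else if n = y then [b] else if n = t then [t'] else
    if n = s then [s'] else []

theorem Sep.ne {x y s : ℕ} (h : Sep x y s u) : x ≠ y ∧ x ≠ s ∧ y ≠ s := by
  obtain ⟨h1, h2, h3, h4, h5⟩ := h
  refine ⟨?_, ?_, ?_⟩
  · rintro rfl; exact h3 h5
  · rintro rfl; omega
  · rintro rfl
    rw [List.count_eq_zero.2 (not_mem_bef y u)] at h4
    omega

theorem Sep.decomp {x y s : ℕ} (h : Sep x y s u) : ∃ p q, u = p ++ s :: q ∧ s ∉ p ∧ s ∉ q ∧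
    x ∉ q ∧ p.count x = u.count x ∧ p.count y = 1 ∧ 1 ≤ q.count y := by
  have hne := h.ne
  obtain ⟨h1, h2, h3, h4, h5⟩ := h
  have hu := eq_bef_append_aft (List.count_pos_iff.1 (by omega : 0 < u.count s))
  refine ⟨bef s u, aft s u, hu, not_mem_bef s u, ?_, h3, ?_, h4, List.count_pos_iff.2 h5⟩
  · intro hc
    have := List.count_pos_iff.2 hc
    rw [hu, List.count_append, List.count_cons_self] at h1
    omega
  · conv_rhs => rw [hu]
    simp [List.count_append, List.count_eq_zero.2 h3, hne.2.1.symm]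

/-- The substitution sends a word with pattern I into the class of `ba⁺sb⁺`. The other side lands in
this class too; nothing precedes its first `b`, so no `x` precedes the first `y` there. -/
theorem sameI_of_sim {a b s' : ℕ} (hab : a ≠ b) (has : a ≠ s') (hbs : b ≠ s')
    (hW : [b, a, a, s', b] ∈ Fac W) (hF : SameF u w) (hL : SameL u w) (h : Sim W u w) :
    SameI u w := by
  have key : ∀ {u w : List ℕ} (x y s : ℕ), SameF u w → SameL u w → Sim W u w →
      PatI x y s u → PatI x y s w := by
    intro u w x y s hF hL h ⟨hS, hxy⟩
    have hS' := hF.sep hL hS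
    refine ⟨hS', ?_⟩
    obtain ⟨hne1, hne2, hne3⟩ := hS.ne
    obtain ⟨p, q, rfl, hsp, hsq, hxq, hxp, hyp, hyq⟩ := hS.decomp
    obtain ⟨p₁, p₂, rfl, hp1⟩ := exists_first_occurrence
      (List.count_pos_iff.1 (by omega : 0 < p.count y))
    have hp2 : y ∉ p₂ := by
      intro hc
      have := List.count_pos_iff.2 hc
      simp [List.count_append] at hyp
      omega
    rw [List.append_assoc, List.cons_append, bef_append_cons hp1] at hxy
    -- This pattern has no letter `t`, so its place is taken by `s`.
    let ψ := subst₄ x y s s a b s' s'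
    have px : ψ x = [a] := by simp [ψ, subst₄]
    have py : ψ y = [b] := by simp [ψ, subst₄, hne1.symm]
    have ps : ψ s = [s'] := by simp [ψ, subst₄, hne2.symm, hne3.symm]
    have pn : ∀ n, n ≠ x → n ≠ y → n ≠ s → ψ n = [] := fun n h1 h2 h3 => by
      simp [ψ, subst₄, h1, h2, h3]
    simp only [List.mem_append, List.mem_cons, not_or] at hsp
    have e : (p₁ ++ y :: p₂ ++ s :: q).flatMap ψ = b :: (List.replicate (p₂.count x) a ++ s' ::
        List.replicate (q.count y) b) := by
      have e1 : p₁.flatMap ψ = [] := flatMap_eq_nil fun n hn => pn n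
        (by rintro rfl; exact hxy hn) (by rintro rfl; exact hp1 hn) (by rintro rfl; exact hsp.1 hn)
      have e2 : p₂.flatMap ψ = List.replicate (p₂.count x) a := flatMap_eq_replicate px
        fun n hn hnx => pn n hnx (by rintro rfl; exact hp2 hn) (by rintro rfl; exact hsp.2.2 hn)
      have e3 : q.flatMap ψ = List.replicate (q.count y) b := flatMap_eq_replicate py
        fun n hn hnx => pn n (by rintro rfl; exact hxq hn) hnx (by rintro rfl; exact hsq hn)
      simp [e1, e2, e3, py, ps]
    have hc : 2 ≤ p₂.count x := by
      have := hS.2.1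
      rw [← hxp] at this
      simpa [List.count_append, List.count_eq_zero.2 hxy, hne1.symm] using this
    have hcls : cls ((p₁ ++ y :: p₂ ++ s :: q).flatMap ψ) = cls [b, a, a, s', b] := by
      rw [e, cls_eq_baas hab has hbs]
      exact ⟨p₂.count x - 2, q.count y - 1, by
        rw [show p₂.count x - 2 + 2 = p₂.count x by omega,
          show q.count y - 1 + 1 = q.count y by omega]⟩
    have hw := h ψ (Or.inl (fac_of_cls hW hcls))
    rw [hcls] at hw
    obtain ⟨i, j, hw⟩ := (cls_eq_baas hab has hbs).1 hw.symm
    have pb : ∀ n, n ≠ y → b ∉ ψ n := by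
      intro n hn
      simp only [ψ, subst₄, hn, if_false]
      split_ifs <;> simp [hab.symm, hbs]
    have hyw : y ∈ w := (hF.mem y).1 (by simp)
    have := flatMap_bef py pb hyw
    rw [hw] at this
    have hnil : bef b (b :: (List.replicate (i + 2) a ++ s' :: List.replicate (j + 1) b)) = [] :=
      bef_append_cons (p := []) (by simp) _
    rw [hnil, List.flatMap_eq_nil_iff] at this
    intro hc
    have := this x hc
    simp [px] at this
  exact fun x y s => ⟨key x y s hF hL h,
    key x y s hF.symm (fun t x => (hL t x).symm) h.symm⟩

/-- In the patterns H and J the letter `t` lies before `s`: only one `x` precedes `t`, while all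
occurrences of `x`, at least two, precede `s`. -/
theorem before_sep {x y s t : ℕ} {p q : List ℕ} (hS : Sep x y s (p ++ s :: q))
    (hsp : s ∉ p) (hxp : p.count x = (p ++ s :: q).count x)
    (ht : (p ++ s :: q).count t = 1) (hx : (bef t (p ++ s :: q)).count x = 1) :
    ∃ p₁ p₂, p = p₁ ++ t :: p₂ ∧ t ∉ p₁ ∧ t ∉ p₂ ∧ t ∉ q ∧ t ≠ s ∧ t ≠ x ∧
      bef t (p ++ s :: q) = p₁ := by
  have h2 := hS.2.1
  rw [← hxp] at h2
  have htp : t ∈ p := by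
    by_contra htp
    rw [bef_append_of_not_mem htp, List.count_append] at hx
    omega
  obtain ⟨p₁, p₂, rfl, hp1⟩ := exists_first_occurrence htp
  refine ⟨p₁, p₂, rfl, hp1, ?_, ?_, ?_, ?_, ?_⟩
  · intro hc
    have := List.count_pos_iff.2 hc
    simp [List.count_append] at ht
    omega
  · intro hc
    have := List.count_pos_iff.2 hc
    simp [List.count_append, List.count_cons] at ht
    omega
  · rintro rfl; exact hsp htp
  · rintro rfl
    rw [List.append_assoc, List.cons_append, bef_append_cons hp1,
      List.count_eq_zero.2 hp1] at hx
    omega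
  · rw [List.append_assoc, List.cons_append, bef_append_cons hp1]

theorem sameH_of_sim {a b t' s' : ℕ} (hab : a ≠ b) (hat : a ≠ t') (has : a ≠ s') (hbt : b ≠ t')
    (hbs : b ≠ s') (hts : t' ≠ s') (hW : [a, b, t', a, s', b] ∈ Fac W) (hF : SameF u w)
    (hL : SameL u w) (h : Sim W u w) : SameH u w := by
  have key : ∀ {u w : List ℕ} (x y t s : ℕ), SameF u w → SameL u w → Sim W u w →
      PatH x y t s u → PatH x y t s w := by
    intro u w x y t s hF hL h ⟨hS, ht, hxt, hyt, hyx⟩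
    have hS' := hF.sep hL hS
    refine ⟨hS', (hF.count_eq_one t).1 ht, (hF.bef_count_eq_one ht x).1 hxt,
      (hF.mem_bef ht y).1 hyt, ?_⟩
    obtain ⟨hne1, hne2, hne3⟩ := hS.ne
    obtain ⟨p, q, rfl, hsp, hsq, hxq, hxp, hyp, hyq⟩ := hS.decomp
    obtain ⟨p₁, p₂, rfl, hp1, hp2, htq, hts', htx, hbt'⟩ := before_sep hS hsp hxp ht hxt
    rw [hbt'] at hxt hyt
    have hty : t ≠ y := by rintro rfl; exact hp1 hyt
    have hyp1 := List.count_pos_iff.2 hyt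
    have hyp2 : y ∉ p₂ := by
      intro hc
      have := List.count_pos_iff.2 hc
      simp only [List.count_append, List.count_cons] at hyp
      omega
    obtain ⟨p₃, p₄, rfl, hp3⟩ := exists_first_occurrence
      (List.count_pos_iff.1 (by omega : 0 < p₁.count x))
    have hp4 : x ∉ p₄ := by
      intro hc
      have := List.count_pos_iff.2 hc
      simp [List.count_append] at hxt
      omega
    have hyp3 : y ∉ p₃ := by
      simp only [List.append_assoc, List.cons_append] at hyx
      rwa [bef_append_cons hp3] at hyx
    obtain ⟨p₅, p₆, rfl, hp5⟩ := exists_first_occurrence (z := y) (p := p₄) (by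
      simpa [hyp3, hne1.symm] using hyt)
    have hp6 : y ∉ p₆ := by
      intro hc
      have := List.count_pos_iff.2 hc
      simp [List.count_append, List.count_cons] at hyp
      omega
    let ψ := subst₄ x y t s a b t' s'
    have px : ψ x = [a] := by simp [ψ, subst₄]
    have py : ψ y = [b] := by simp [ψ, subst₄, hne1.symm]
    have pt : ψ t = [t'] := by simp [ψ, subst₄, htx, hty]
    have ps : ψ s = [s'] := by simp [ψ, subst₄, hne2.symm, hne3.symm, hts'.symm]
    have pn : ∀ n, n ≠ x → n ≠ y → n ≠ t → n ≠ s → ψ n = [] := fun n h1 h2 h3 h4 => by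
      simp [ψ, subst₄, h1, h2, h3, h4]
    simp only [List.mem_append, List.mem_cons, not_or] at hsp hp1 hp4
    have e : (p₃ ++ x :: (p₅ ++ y :: p₆) ++ t :: p₂ ++ s :: q).flatMap ψ =
        a :: b :: t' :: (List.replicate (p₂.count x) a ++ s' ::
        List.replicate (q.count y) b) := by
      have e1 : p₃.flatMap ψ = [] := flatMap_eq_nil fun n hn => pn n
        (by rintro rfl; exact hp3 hn) (by rintro rfl; exact hyp3 hn)
        (by rintro rfl; exact hp1.1 hn) (by rintro rfl; exact hsp.1.1 hn)
      have e2 : p₅.flatMap ψ = [] := flatMap_eq_nil fun n hn => pn n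
        (by rintro rfl; exact hp4.1 hn) (by rintro rfl; exact hp5 hn)
        (by rintro rfl; exact hp1.2.2.1 hn) (by rintro rfl; exact hsp.1.2.2.1 hn)
      have e3 : p₆.flatMap ψ = [] := flatMap_eq_nil fun n hn => pn n
        (by rintro rfl; exact hp4.2.2 hn) (by rintro rfl; exact hp6 hn)
        (by rintro rfl; exact hp1.2.2.2.2 hn) (by rintro rfl; exact hsp.1.2.2.2.2 hn)
      have e4 : p₂.flatMap ψ = List.replicate (p₂.count x) a := flatMap_eq_replicate px
        fun n hn hnx => pn n hnx (by rintro rfl; exact hyp2 hn) (by rintro rfl; exact hp2 hn)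
          (by rintro rfl; exact hsp.2.2 hn)
      have e5 : q.flatMap ψ = List.replicate (q.count y) b := flatMap_eq_replicate py
        fun n hn hnx => pn n (by rintro rfl; exact hxq hn) hnx (by rintro rfl; exact htq hn)
          (by rintro rfl; exact hsq hn)
      simp [e1, e2, e3, e4, e5, px, py, pt, ps]
    have hc : 1 ≤ p₂.count x := by
      have := hS.2.1
      rw [← hxp, List.count_append, hxt, List.count_cons] at this
      simp only [beq_iff_eq, htx, if_false] at this
      omega
    have hcls : cls ((p₃ ++ x :: (p₅ ++ y :: p₆) ++ t :: p₂ ++ s :: q).flatMap ψ) =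
        cls [a, b, t', a, s', b] := by
      rw [e, cls_eq_abta hab hat has hbt hbs hts]
      exact ⟨p₂.count x - 1, q.count y - 1, by
        rw [show p₂.count x - 1 + 1 = p₂.count x by omega,
          show q.count y - 1 + 1 = q.count y by omega]⟩
    have hw := h ψ (Or.inl (fac_of_cls hW hcls))
    rw [hcls] at hw
    obtain ⟨i, j, hw⟩ := (cls_eq_abta hab hat has hbt hbs hts).1 hw.symm
    have pa : ∀ n, n ≠ x → a ∉ ψ n := by
      intro n hn
      simp only [ψ, subst₄, hn, if_false]
      split_ifs <;> simp [hab, hat, has]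
    have hxw : x ∈ w := (hF.mem x).1 (by simp)
    have := flatMap_bef px pa hxw
    rw [hw] at this
    have hnil : bef a (a :: b :: t' :: (List.replicate (i + 1) a ++ s' ::
        List.replicate (j + 1) b)) = [] :=
      bef_append_cons (p := []) (by simp) _
    rw [hnil, List.flatMap_eq_nil_iff] at this
    intro hc
    have := this y hc
    simp [py] at this
  exact fun x y t s => ⟨key x y t s hF hL h,
    key x y t s hF.symm (fun t x => (hL t x).symm) h.symm⟩

/-- In a word of the class `atba⁺sb⁺` the part before the first `b` is `at`; its single `a` gives
the number of `x` before the first `y` on the other side. -/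
theorem sameJ_of_sim {a b t' s' : ℕ} (hab : a ≠ b) (hat : a ≠ t') (has : a ≠ s') (hbt : b ≠ t')
    (hbs : b ≠ s') (hts : t' ≠ s') (hW : [a, t', b, a, s', b] ∈ Fac W) (hF : SameF u w)
    (hL : SameL u w) (h : Sim W u w) : SameJ u w := by
  have key : ∀ {u w : List ℕ} (x y t s : ℕ), SameF u w → SameL u w → Sim W u w →
      PatJ x y t s u → PatJ x y t s w := by
    intro u w x y t s hF hL h ⟨hS, ht, hxt, hyt, hxy⟩
    have hS' := hF.sep hL hS
    refine ⟨hS', (hF.count_eq_one t).1 ht, (hF.bef_count_eq_one ht x).1 hxt,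
      fun k => hyt ((hF.mem_bef ht y).2 k), ?_⟩
    obtain ⟨hne1, hne2, hne3⟩ := hS.ne
    obtain ⟨p, q, rfl, hsp, hsq, hxq, hxp, hyp, hyq⟩ := hS.decomp
    obtain ⟨p₁, p₂, rfl, hp1, hp2, htq, hts', htx, hbt'⟩ := before_sep hS hsp hxp ht hxt
    rw [hbt'] at hxt hyt
    have hty : t ≠ y := by
      rintro rfl
      exact htq (List.count_pos_iff.1 hyq)
    have hyp2 : p₂.count y = 1 := by
      simpa [List.count_append, List.count_eq_zero.2 hyt, hty] using hyp
    obtain ⟨p₃, p₄, rfl, hp3⟩ := exists_first_occurrence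
      (List.count_pos_iff.1 (by omega : 0 < p₂.count y))
    have hp4 : y ∉ p₄ := by
      intro hc
      have := List.count_pos_iff.2 hc
      simp [List.count_append] at hyp2
      omega
    have hxp3 : x ∉ p₃ := by
      rw [show p₁ ++ t :: (p₃ ++ y :: p₄) ++ s :: q = (p₁ ++ t :: p₃) ++ y :: (p₄ ++ s :: q) by simp,
        bef_append_cons (by simp [hyt, hty.symm, hp3])] at hxy
      simp only [List.count_append, List.count_cons, hxt, beq_iff_eq, htx, if_false] at hxy
      exact List.count_eq_zero.1 (by omega)
    let ψ := subst₄ x y t s a b t' s'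
    have px : ψ x = [a] := by simp [ψ, subst₄]
    have py : ψ y = [b] := by simp [ψ, subst₄, hne1.symm]
    have pt : ψ t = [t'] := by simp [ψ, subst₄, htx, hty]
    have ps : ψ s = [s'] := by simp [ψ, subst₄, hne2.symm, hne3.symm, hts'.symm]
    have pn : ∀ n, n ≠ x → n ≠ y → n ≠ t → n ≠ s → ψ n = [] := fun n h1 h2 h3 h4 => by
      simp [ψ, subst₄, h1, h2, h3, h4]
    simp only [List.mem_append, List.mem_cons, not_or] at hsp hp1 hp2
    have e : (p₁ ++ t :: (p₃ ++ y :: p₄) ++ s :: q).flatMap ψ =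
        a :: t' :: b :: (List.replicate (p₄.count x) a ++ s' ::
        List.replicate (q.count y) b) := by
      have e1 : p₁.flatMap ψ = List.replicate (p₁.count x) a := flatMap_eq_replicate px
        fun n hn hnx => pn n hnx (by rintro rfl; exact hyt hn) (by rintro rfl; exact hp1 hn)
          (by rintro rfl; exact hsp.1 hn)
      have e2 : p₃.flatMap ψ = [] := flatMap_eq_nil fun n hn => pn n
        (by rintro rfl; exact hxp3 hn) (by rintro rfl; exact hp3 hn)
        (by rintro rfl; exact hp2.1 hn) (by rintro rfl; exact hsp.2.2.1 hn)
      have e4 : p₄.flatMap ψ = List.replicate (p₄.count x) a := flatMap_eq_replicate px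
        fun n hn hnx => pn n hnx (by rintro rfl; exact hp4 hn) (by rintro rfl; exact hp2.2.2 hn)
          (by rintro rfl; exact hsp.2.2.2.2 hn)
      have e5 : q.flatMap ψ = List.replicate (q.count y) b := flatMap_eq_replicate py
        fun n hn hnx => pn n (by rintro rfl; exact hxq hn) hnx (by rintro rfl; exact htq hn)
          (by rintro rfl; exact hsq hn)
      simp [e1, e2, e4, e5, hxt, py, pt, ps]
    have hc : 1 ≤ p₄.count x := by
      have := hS.2.1
      rw [← hxp] at this
      simp only [List.count_append, List.count_cons, hxt, beq_iff_eq, htx, hne1.symm, if_false,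
        List.count_eq_zero.2 hxp3] at this
      omega
    have hcls : cls ((p₁ ++ t :: (p₃ ++ y :: p₄) ++ s :: q).flatMap ψ) =
        cls [a, t', b, a, s', b] := by
      rw [e, cls_eq_atba hab hat has hbt hbs hts]
      exact ⟨p₄.count x - 1, q.count y - 1, by
        rw [show p₄.count x - 1 + 1 = p₄.count x by omega,
          show q.count y - 1 + 1 = q.count y by omega]⟩
    have hw := h ψ (Or.inl (fac_of_cls hW hcls))
    rw [hcls] at hw
    obtain ⟨i, j, hw⟩ := (cls_eq_atba hab hat has hbt hbs hts).1 hw.symm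
    have pa : ∀ n, n ≠ x → a ∉ ψ n := by
      intro n hn
      simp only [ψ, subst₄, hn, if_false]
      split_ifs <;> simp [hab, hat, has]
    have pb : ∀ n, n ≠ y → b ∉ ψ n := by
      intro n hn
      simp only [ψ, subst₄, hn, if_false]
      split_ifs <;> simp [hab.symm, hbt, hbs]
    have hyw : y ∈ w := (hF.mem y).1 (by simp)
    have := flatMap_bef py pb hyw
    rw [hw, show a :: t' :: b :: (List.replicate (i + 1) a ++ s' :: List.replicate (j + 1) b) =
      [a, t'] ++ b :: (List.replicate (i + 1) a ++ s' :: List.replicate (j + 1) b) by rfl,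
      bef_append_cons (by simp [hab.symm, hbt])] at this
    rw [← count_flatMap_letter px pa, this]
    simp [hat.symm]
  exact fun x y t s => ⟨key x y t s hF hL h,
    key x y t s hF.symm (fun t x => (hL t x).symm) h.symm⟩

end

/-! ## Identities of the monoids `M_λ(W)` -/

theorem eq_replicate_of_no_change {X : List ℕ}
    (h : ∀ X₁ c d X₂, X = X₁ ++ c :: d :: X₂ → c = d) : ∃ c k, X = List.replicate k c := by
  induction X with
  | nil => exact ⟨0, 0, rfl⟩
  | cons a X ih =>
    obtain ⟨c, k, rfl⟩ := ih fun X₁ c d X₂ e => h (a :: X₁) c d X₂ (by rw [e]; rfl)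
    cases k with
    | zero => exact ⟨a, 1, rfl⟩
    | succ k =>
      have := h [] a c (List.replicate k c) (by simp [List.replicate_succ])
      subst this
      exact ⟨a, k + 2, by simp [List.replicate_succ]⟩

theorem cls_replicate_congr {p : List ℕ} {c : ℕ} (hc : c ∈ p) (q : List ℕ) {m n : ℕ} (hm : 1 ≤ m)
    (hn : 1 ≤ n) : cls (p ++ (List.replicate m c ++ q)) = cls (p ++ (List.replicate n c ++ q)) := by
  have h1 := cls_replicate hc q (m - 1)
  have h2 := cls_replicate hc q (n - 1)
  rw [show m - 1 + 1 = m by omega] at h1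
  rw [show n - 1 + 1 = n by omega] at h2
  rw [h1, h2]

/-- Conditions on the factors of `W` that ensure the identities `Φ` in `M_λ(W)`. -/
structure PhiFactors (W : Set lam.Quotient) : Prop where
  rep : ∀ X p, X ++ (p ++ X) ∈ Fac W → ∃ c k, X = List.replicate k c
  ccdd : ∀ c d, c ≠ d → [c, c, d, d] ∉ Fac W
  dccd : ∀ c d p, c ≠ d → d :: c :: (p ++ [c, d]) ∉ Fac W
  third : ∀ c p q r, c :: (p ++ c :: (q ++ (r ++ [c]))) ∈ Fac W → (∀ n ∈ q, n = c) ∨ ∀ n ∈ r, n = c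

namespace PhiFactors

variable {W : Set lam.Quotient}

/-- Every repeated variable of `Φ` takes, in a nonzero product, a power of a letter by `rep`. The
other conditions exclude the cases in which two such powers involve different letters, or in which
an inserted block would not be absorbed. -/
theorem phiLaws (h : PhiFactors W) : PhiLaws (MLam W) where
  xtx := by
    intro x t
    obtain ⟨X, rfl⟩ := mkM_surjective x
    obtain ⟨T, rfl⟩ := mkM_surjective t
    simp only [pow_two, ← mkM_append]
    refine mkM_eq fun hF => ?_
    have hX : X ++ (T ++ X) ∈ Fac W := by
      rcases hF with hF | hF
      · simpa using hF
      · exact fac_of_append (l := []) (r := X) (by simpa using hF)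
    obtain ⟨c, k, rfl⟩ := h.rep _ _ hX
    rcases k with _ | k
    · simp
    have h1 := cls_replicate (p := List.replicate (k + 1) c ++ T) (c := c) (by simp) [] k
    have h2 := cls_replicate (p := List.replicate (k + 1) c ++ T) (c := c) (by simp) []
      (k + (k + 1))
    rw [List.append_nil] at h1 h2
    rw [h1, ← h2, ← List.replicate_add]
    congr 3
    omega
  sq_comm := by
    have key : ∀ X Y, X ++ X ++ (Y ++ Y) ∈ Fac W → X ++ X ++ (Y ++ Y) = Y ++ Y ++ (X ++ X) := by
      intro X Y hF
      obtain ⟨c, k, rfl⟩ := h.rep X [] (fac_of_append (l := []) (by simpa using hF))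
      obtain ⟨d, m, rfl⟩ := h.rep Y [] (fac_of_append (r := []) (by simpa using hF))
      rcases eq_or_ne c d with rfl | hcd
      · simp only [← List.replicate_add]
        congr 1
        omega
      rcases k with _ | k
      · simp
      rcases m with _ | m
      · simp
      refine absurd (fac_of_append (l := List.replicate (2 * k) c) (r := List.replicate (2 * m) d)
        (u := [c, c, d, d]) ?_) (h.ccdd c d hcd)
      convert hF using 1
      have e1 : List.replicate (k + 1) c ++ List.replicate (k + 1) c =
          List.replicate (2 * k) c ++ [c, c] := by
        rw [← List.replicate_add, show k + 1 + (k + 1) = 2 * k + 2 by omega, List.replicate_add]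
        rfl
      have e2 : List.replicate (m + 1) d ++ List.replicate (m + 1) d =
          [d, d] ++ List.replicate (2 * m) d := by
        rw [← List.replicate_add, show m + 1 + (m + 1) = 2 + 2 * m by omega, List.replicate_add]
        rfl
      rw [e1, e2]
      simp
    intro x y
    obtain ⟨X, rfl⟩ := mkM_surjective x
    obtain ⟨Y, rfl⟩ := mkM_surjective y
    simp only [pow_two, ← mkM_append]
    refine mkM_eq fun hF => ?_
    rcases hF with hF | hF
    · rw [key X Y hF]
    · rw [key Y X hF]
  xytxy := by
    intro x y t
    obtain ⟨X, rfl⟩ := mkM_surjective x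
    obtain ⟨Y, rfl⟩ := mkM_surjective y
    obtain ⟨T, rfl⟩ := mkM_surjective t
    simp only [← mkM_append]
    refine mkM_eq fun hF => ?_
    suffices hXY : X ++ Y = Y ++ X by rw [hXY]
    rcases hF with hF | hF
    · obtain ⟨c, k, hk⟩ := h.rep (X ++ Y) T (by simpa using hF)
      have hX := List.eq_replicate_of_mem (a := c) (l := X) fun n hn =>
        List.eq_of_mem_replicate (hk ▸ List.mem_append_left Y hn)
      have hY := List.eq_replicate_of_mem (a := c) (l := Y) fun n hn =>
        List.eq_of_mem_replicate (hk ▸ List.mem_append_right X hn)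
      rw [hX, hY, ← List.replicate_add, ← List.replicate_add, Nat.add_comm]
    · obtain ⟨c, k, rfl⟩ := h.rep X T (fac_of_append (l := Y) (r := Y) (by simpa using hF))
      obtain ⟨d, m, rfl⟩ := h.rep Y (List.replicate k c ++ T ++ List.replicate k c) (by
        simpa using hF)
      rcases eq_or_ne c d with rfl | hcd
      · rw [← List.replicate_add, ← List.replicate_add, Nat.add_comm]
      rcases k with _ | k
      · simp
      rcases m with _ | m
      · simp
      refine absurd (fac_of_append (l := List.replicate m d) (r := List.replicate m d) ?_)
        (h.dccd c d (List.replicate k c ++ T ++ List.replicate k c) hcd)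
      have e : List.replicate m d ++ d :: c :: (List.replicate k c ++ T ++ List.replicate k c ++
          [c, d]) ++ List.replicate m d = (List.replicate m d ++ [d]) ++ (c :: List.replicate k c) ++
            T ++ (List.replicate k c ++ [c]) ++ (d :: List.replicate m d) := by simp
      rw [e, ← List.replicate_succ', ← List.replicate_succ', ← List.replicate_succ,
        ← List.replicate_succ]
      exact hF
  fill := by
    -- If `q` or `r` is a power of `c`, the extra block of `c` joins an adjacent nonempty run of
    -- nonfirst occurrences, whose length is irrelevant.
    have cls_case : ∀ (c k : ℕ) (P q r : List ℕ), c ∈ P → ((∀ n ∈ q, n = c) ∨ ∀ n ∈ r, n = c) →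
        cls (P ++ (List.replicate (k + 1) c ++ (q ++ (r ++ List.replicate (k + 1) c)))) =
        cls (P ++ (List.replicate (k + 1) c ++ (q ++ (List.replicate (k + 1) c ++
          (r ++ List.replicate (k + 1) c))))) := by
      intro c k P q r hP hqr
      rcases hqr with hq | hr
      · obtain ⟨m, rfl⟩ : ∃ m, q = List.replicate m c := ⟨_, List.eq_replicate_of_mem hq⟩
        have := cls_replicate_congr hP (r ++ List.replicate (k + 1) c) (m := k + 1 + m)
          (n := k + 1 + (m + (k + 1))) (by omega) (by omega)
        simpa only [List.replicate_add, List.append_assoc] using this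
      · obtain ⟨m, rfl⟩ : ∃ m, r = List.replicate m c := ⟨_, List.eq_replicate_of_mem hr⟩
        have hP' : c ∈ P ++ (List.replicate (k + 1) c ++ q) := by simp
        have := cls_replicate_congr hP' [] (m := m + (k + 1))
          (n := k + 1 + (m + (k + 1))) (by omega) (by omega)
        simpa only [List.replicate_add, List.append_assoc, List.append_nil] using this
    intro x t₁ t₂ t₃
    obtain ⟨X, rfl⟩ := mkM_surjective x
    obtain ⟨T₁, rfl⟩ := mkM_surjective t₁
    obtain ⟨T₂, rfl⟩ := mkM_surjective t₂
    obtain ⟨T₃, rfl⟩ := mkM_surjective t₃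
    simp only [← mkM_append]
    refine mkM_eq fun hF => ?_
    obtain ⟨c, k, rfl⟩ : ∃ c k, X = List.replicate k c := by
      rcases hF with hF | hF
      · exact h.rep X T₁ (fac_of_append (l := []) (r := T₂ ++ T₃ ++ X) (by simpa using hF))
      · exact h.rep X T₁ (fac_of_append (l := []) (r := T₂ ++ X ++ T₃ ++ X) (by simpa using hF))
    rcases k with _ | k
    · simp
    have e1 : List.replicate (k + 1) c = c :: List.replicate k c := rfl
    have e2 : List.replicate (k + 1) c = List.replicate k c ++ [c] := List.replicate_succ'
    have := cls_case c k (List.replicate (k + 1) c ++ T₁) T₂ T₃ (by simp) (by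
      rcases hF with hF | hF
      · refine h.third c (T₁ ++ List.replicate k c) T₂ T₃
          (fac_of_append (l := List.replicate k c) (r := List.replicate k c) ?_)
        have e : List.replicate k c ++ c :: (T₁ ++ List.replicate k c ++ c :: (T₂ ++ (T₃ ++ [c]))) ++
            List.replicate k c = (List.replicate k c ++ [c]) ++ T₁ ++ (List.replicate k c ++ [c]) ++
              T₂ ++ T₃ ++ (c :: List.replicate k c) := by simp
        rw [e, ← List.replicate_succ', ← List.replicate_succ]
        exact hF
      · have := h.third c (T₁ ++ List.replicate k c) T₂ (List.replicate (k + 1) c ++ T₃)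
          (fac_of_append (l := List.replicate k c) (r := List.replicate k c) (by
            have e : List.replicate k c ++ c :: (T₁ ++ List.replicate k c ++ c :: (T₂ ++
                ((List.replicate (k + 1) c ++ T₃) ++ [c]))) ++ List.replicate k c =
                (List.replicate k c ++ [c]) ++ T₁ ++ (List.replicate k c ++ [c]) ++ T₂ ++
                  List.replicate (k + 1) c ++ T₃ ++ (c :: List.replicate k c) := by simp
            rw [e, ← List.replicate_succ', ← List.replicate_succ]
            exact hF))
        exact this.imp_right fun h n hn => h n (by simp [hn]))
    simpa using this

end PhiFactors

/-! ### Words with one multiple letter -/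

section oneMultiple

variable {W : Set lam.Quotient} {a t : ℕ}

theorem eq_replicate_of_twice (ha : ∀ u ∈ Fac W, ∀ n ∈ u, n = a ∨ n = t)
    (ht : ∀ u ∈ Fac W, u.count t ≤ 1) {X p : List ℕ} (h : X ++ (p ++ X) ∈ Fac W) :
    X = List.replicate X.length a := by
  refine List.eq_replicate_of_mem fun n hn => ?_
  rcases ha _ h n (by simp [hn]) with hna | rfl
  · exact hna
  · have h1 := ht _ h
    have := List.count_pos_iff.2 hn
    simp only [List.count_append] at h1
    omega

theorem phiFactors_of_one (hat : a ≠ t) (ha : ∀ u ∈ Fac W, ∀ n ∈ u, n = a ∨ n = t)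
    (ht : ∀ u ∈ Fac W, u.count t ≤ 1) : PhiFactors W where
  rep X p h := ⟨a, _, eq_replicate_of_twice ha ht h⟩
  ccdd c d hcd h := by
    have h1 := ha _ h c (by simp)
    have h2 := ha _ h d (by simp)
    have h3 := ht _ h
    simp only [List.count_cons, List.count_nil, beq_iff_eq] at h3
    split_ifs at h3 <;> omega
  dccd c d p hcd h := by
    have h1 := ha _ h c (by simp)
    have h2 := ha _ h d (by simp)
    have h3 := ht _ h
    simp only [List.count_cons, List.count_append, List.count_nil, beq_iff_eq] at h3
    split_ifs at h3 <;> omega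
  third c p q r h := by
    have h3 := ht _ h
    have hc : c = a := by
      refine (ha _ h c (by simp)).resolve_right ?_
      rintro rfl
      simp [List.count_append] at h3
    subst hc
    simp only [List.count_cons, List.count_append, List.count_nil, beq_iff_eq, hat,
      if_false] at h3
    by_cases hq : t ∈ q
    · right
      intro n hn
      refine (ha _ h n (by simp [hn])).resolve_right ?_
      rintro rfl
      have h1 := List.count_pos_iff.2 hq
      have h2 := List.count_pos_iff.2 hn
      omega
    · left
      intro n hn
      refine (ha _ h n (by simp [hn])).resolve_right ?_
      rintro rfl
      exact hq hn

/-- A word occurring twice in a factor cannot contain `t`, so it is a power of `a`; any two such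
words commute. -/
theorem laws_of_one (ha : ∀ u ∈ Fac W, ∀ n ∈ u, n = a ∨ n = t)
    (ht : ∀ u ∈ Fac W, u.count t ≤ 1) : ILaw (MLam W) ∧ ELaw (MLam W) := by
  have key : ∀ {X Y : List ℕ} (p q : List ℕ), X ++ (p ++ X) ∈ Fac W → Y ++ (q ++ Y) ∈ Fac W →
      X ++ Y = Y ++ X := by
    intro X Y p q h1 h2
    rw [eq_replicate_of_twice ha ht h1, eq_replicate_of_twice ha ht h2, ← List.replicate_add,
      ← List.replicate_add, Nat.add_comm]
  constructor
  · intro x t y s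
    obtain ⟨X, rfl⟩ := mkM_surjective x
    obtain ⟨Y, rfl⟩ := mkM_surjective y
    obtain ⟨T, rfl⟩ := mkM_surjective t
    obtain ⟨S, rfl⟩ := mkM_surjective s
    simp only [← mkM_append]
    refine mkM_eq fun hF => ?_
    suffices hXY : X ++ Y = Y ++ X by
      simp only [List.append_assoc]
      rw [← List.append_assoc X Y, hXY, List.append_assoc]
    rcases hF with hF | hF
    · exact key T S (fac_of_append (l := []) (r := Y ++ S ++ Y) (by simpa using hF))
        (fac_of_append (l := X ++ T ++ X) (r := []) (by simpa using hF))
    · exact key (T ++ Y) (X ++ S) (fac_of_append (l := []) (r := S ++ Y) (by simpa using hF))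
        (fac_of_append (l := X ++ T) (r := []) (by simpa using hF))
  · intro x y t s
    obtain ⟨X, rfl⟩ := mkM_surjective x
    obtain ⟨Y, rfl⟩ := mkM_surjective y
    obtain ⟨T, rfl⟩ := mkM_surjective t
    obtain ⟨S, rfl⟩ := mkM_surjective s
    simp only [← mkM_append]
    refine mkM_eq fun hF => ?_
    suffices hXY : X ++ Y = Y ++ X by rw [hXY]
    rcases hF with hF | hF
    · exact key (Y ++ T) (T ++ X ++ S) (fac_of_append (l := []) (r := S ++ Y) (by simpa using hF))
        (fac_of_append (l := X) (r := []) (by simpa using hF))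
    · exact key T (X ++ T ++ X ++ S) (fac_of_append (l := Y) (r := S ++ Y) (by simpa using hF))
        (fac_of_append (l := []) (r := []) (by simpa using hF))

end oneMultiple

/-! ### Words with two multiple letters -/

/-- The positions of letters in the words `atba⋯asb⋯b` (for `i = 1`, `j = 2`) and `abta⋯asb⋯b` (for
`i = 2`, `j = 1`); `m` is the position of `s`. -/
def Shape (a b t s i j m : ℕ) (w : List ℕ) : Prop := ∀ k c, w[k]? = some c →
  (k = 0 ∧ c = a) ∨ (k = i ∧ c = t) ∨ (k = j ∧ c = b) ∨ (3 ≤ k ∧ k < m ∧ c = a) ∨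
    (k = m ∧ c = s) ∨ (m < k ∧ c = b)

/-- This turns the question whether a configuration can be a factor into linear arithmetic: reading
off the letters at four places gives constraints on positions that `omega` refutes. -/
theorem Shape.at {a b t s i j m : ℕ} {w : List ℕ} (h : Shape a b t s i j m w) (p : List ℕ) {c : ℕ}
    {q : List ℕ} (e : w = p ++ c :: q) :
    (p.length = 0 ∧ c = a) ∨ (p.length = i ∧ c = t) ∨ (p.length = j ∧ c = b) ∨
      (3 ≤ p.length ∧ p.length < m ∧ c = a) ∨ (p.length = m ∧ c = s) ∨ (m < p.length ∧ c = b) :=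
  h _ _ (by simp [e])

theorem getElem?_tail_shape {a b s n m k c : ℕ}
    (h : (List.replicate n a ++ s :: List.replicate m b)[k]? = some c) :
    (k < n ∧ c = a) ∨ (k = n ∧ c = s) ∨ (n < k ∧ c = b) := by
  rcases lt_trichotomy k n with hk | rfl | hk
  · rw [List.getElem?_append_left (by simpa using hk)] at h
    have := List.mem_of_getElem? h
    exact Or.inl ⟨hk, List.eq_of_mem_replicate this⟩
  · rw [List.getElem?_append_right (by simp)] at h
    simp at h
    exact Or.inr (Or.inl ⟨rfl, h.symm⟩)
  · rw [List.getElem?_append_right (by simpa using hk.le), List.length_replicate,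
      show k - n = (k - n - 1) + 1 by omega, List.getElem?_cons_succ] at h
    have := List.mem_of_getElem? h
    exact Or.inr (Or.inr ⟨hk, List.eq_of_mem_replicate this⟩)

theorem shape_atba (a b t s i j : ℕ) : Shape a b t s 1 2 (i + 4)
    (a :: t :: b :: (List.replicate (i + 1) a ++ s :: List.replicate (j + 1) b)) := by
  intro k c h
  match k with
  | 0 => simp at h; omega
  | 1 => simp at h; omega
  | 2 => simp at h; omega
  | k + 3 =>
    have := getElem?_tail_shape (by simpa using h)
    omega

theorem shape_abta (a b t s i j : ℕ) : Shape a b t s 2 1 (i + 4)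
    (a :: b :: t :: (List.replicate (i + 1) a ++ s :: List.replicate (j + 1) b)) := by
  intro k c h
  match k with
  | 0 => simp at h; omega
  | 1 => simp at h; omega
  | 2 => simp at h; omega
  | k + 3 =>
    have := getElem?_tail_shape (by simpa using h)
    omega

section shape

variable {W : Set lam.Quotient} {a b t s i j : ℕ}

theorem phiFactors_of_shape (hab : a ≠ b) (hat : a ≠ t) (has : a ≠ s) (hbt : b ≠ t) (hbs : b ≠ s)
    (hts : t ≠ s) (hij : i = 1 ∧ j = 2 ∨ i = 2 ∧ j = 1)
    (hW : ∀ u ∈ Fac W, ∃ l r m, 4 ≤ m ∧ Shape a b t s i j m (l ++ u ++ r)) : PhiFactors W where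
  rep X p h := by
    refine eq_replicate_of_no_change fun X₁ c d X₂ e => ?_
    by_contra hcd
    subst e
    obtain ⟨l, r, m, hm, hS⟩ := hW _ h
    have h1 := hS.at (l ++ X₁) (c := c) (q := d :: X₂ ++ (p ++ (X₁ ++ c :: d :: X₂)) ++ r) (by simp)
    have h2 := hS.at (l ++ X₁ ++ [c]) (c := d) (q := X₂ ++ (p ++ (X₁ ++ c :: d :: X₂)) ++ r)
      (by simp)
    have h3 := hS.at (l ++ X₁ ++ c :: d :: X₂ ++ p ++ X₁) (c := c) (q := d :: X₂ ++ r) (by simp)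
    have h4 := hS.at (l ++ X₁ ++ c :: d :: X₂ ++ p ++ X₁ ++ [c]) (c := d) (q := X₂ ++ r) (by simp)
    simp only [List.length_append, List.length_cons, List.length_nil] at h1 h2 h3 h4
    omega
  ccdd c d hcd h := by
    obtain ⟨l, r, m, hm, hS⟩ := hW _ h
    have h1 := hS.at l (c := c) (q := [c, d, d] ++ r) (by simp)
    have h2 := hS.at (l ++ [c]) (c := c) (q := [d, d] ++ r) (by simp)
    have h3 := hS.at (l ++ [c, c]) (c := d) (q := [d] ++ r) (by simp)
    have h4 := hS.at (l ++ [c, c, d]) (c := d) (q := r) (by simp)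
    simp only [List.length_append, List.length_cons, List.length_nil] at h1 h2 h3 h4
    omega
  dccd c d p hcd h := by
    obtain ⟨l, r, m, hm, hS⟩ := hW _ h
    have h1 := hS.at l (c := d) (q := c :: (p ++ [c, d]) ++ r) (by simp)
    have h2 := hS.at (l ++ [d]) (c := c) (q := p ++ [c, d] ++ r) (by simp)
    have h3 := hS.at (l ++ [d, c] ++ p) (c := c) (q := [d] ++ r) (by simp)
    have h4 := hS.at (l ++ [d, c] ++ p ++ [c]) (c := d) (q := r) (by simp)
    simp only [List.length_append, List.length_cons, List.length_nil] at h1 h2 h3 h4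
    omega
  third c p q r h := by
    left
    intro n hn
    by_contra hnc
    obtain ⟨q₁, q₂, rfl⟩ := List.append_of_mem hn
    obtain ⟨l, r', m, hm, hS⟩ := hW _ h
    have h1 := hS.at l (c := c) (q := p ++ c :: (q₁ ++ n :: q₂ ++ (r ++ [c])) ++ r') (by simp)
    have h2 := hS.at (l ++ c :: p) (c := c) (q := q₁ ++ n :: q₂ ++ (r ++ [c]) ++ r') (by simp)
    have h3 := hS.at (l ++ c :: p ++ c :: q₁) (c := n) (q := q₂ ++ (r ++ [c]) ++ r') (by simp)
    have h4 := hS.at (l ++ c :: p ++ c :: q₁ ++ n :: q₂ ++ r) (c := c) (q := r') (by simp)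
    simp only [List.length_append, List.length_cons] at h1 h2 h3 h4
    omega

end shape

theorem exists_first_change {c : ℕ} {Y : List ℕ} (h : ¬ ∀ n ∈ Y, n = c) :
    ∃ m d Y', Y = List.replicate m c ++ d :: Y' ∧ d ≠ c := by
  induction Y with
  | nil => simp at h
  | cons e Y ih =>
    by_cases he : e = c
    · subst he
      obtain ⟨m, d, Y', rfl, hd⟩ := ih (by simpa using h)
      exact ⟨m + 1, d, Y', by simp [List.replicate_succ], hd⟩
    · exact ⟨0, e, Y, by simp, he⟩

theorem mkM_flatten {W : Set lam.Quotient} (L : List (List ℕ)) :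
    (L.map (mkM W)).prod = mkM W L.flatten := by
  induction L with
  | nil => rfl
  | cons u L ih => simp [ih, mkM_append]

section shape

variable {W : Set lam.Quotient} {a b t s : ℕ}

/-- `X` is a power of some `c`. If `d ≠ c` is the first other letter of `Y`, then `d` recurs in `Q`,
and the word contains `cd⋯c⋯d` or `ccd⋯d`; neither is a factor of `atba⁺sb⁺`. -/
theorem commute_of_shape_atba (hat : a ≠ t) (has : a ≠ s) (hbt : b ≠ t)
    (hbs : b ≠ s) (hts : t ≠ s) (hP : PhiFactors W)
    (hW : ∀ u ∈ Fac W, ∃ l r m, 4 ≤ m ∧ Shape a b t s 1 2 m (l ++ u ++ r)) {X Y Q : List ℕ}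
    (hYQ : ∀ n ∈ Y, n ∈ Q) (h : X ++ (Y ++ (X ++ Q)) ∈ Fac W ∨ X ++ (X ++ (Y ++ Q)) ∈ Fac W) :
    X ++ Y = Y ++ X := by
  obtain ⟨c, k, rfl⟩ : ∃ c k, X = List.replicate k c := by
    rcases h with h | h
    · exact hP.rep X Y (fac_of_append (l := []) (r := Q) (by simpa using h))
    · exact hP.rep X [] (fac_of_append (l := []) (r := Y ++ Q) (by simpa using h))
  rcases k with _ | k
  · simp
  by_cases hY : ∀ n ∈ Y, n = c
  · rw [List.eq_replicate_of_mem hY, ← List.replicate_add, ← List.replicate_add, Nat.add_comm]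
  exfalso
  obtain ⟨m', d, Y', rfl, hd⟩ := exists_first_change hY
  obtain ⟨Q₁, Q₂, rfl⟩ := List.append_of_mem (hYQ d (by simp))
  rcases h with h | h
  · have e : List.replicate (k + 1) c ++ (List.replicate m' c ++ d :: Y' ++
        (List.replicate (k + 1) c ++ (Q₁ ++ d :: Q₂))) = List.replicate (k + m') c ++
          c :: d :: (Y' ++ c :: (List.replicate k c ++ Q₁ ++ d :: Q₂)) := by
      have e1 : List.replicate (k + 1) c ++ List.replicate m' c =
          List.replicate (k + m') c ++ [c] := by
        rw [← List.replicate_add, ← List.replicate_succ']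
        congr 1
        omega
      calc _ = (List.replicate (k + 1) c ++ List.replicate m' c) ++ d :: Y' ++
            (List.replicate (k + 1) c ++ (Q₁ ++ d :: Q₂)) := by simp only [List.append_assoc]
        _ = _ := by rw [e1, List.replicate_succ (n := k)]; simp
    rw [e] at h
    obtain ⟨l, r, m, hm, hS⟩ := hW _ h
    have h1 := hS.at (l ++ List.replicate (k + m') c) (c := c) (q := d :: (Y' ++
      c :: (List.replicate k c ++ Q₁ ++ d :: Q₂)) ++ r) (by simp)
    have h2 := hS.at (l ++ List.replicate (k + m') c ++ [c]) (c := d) (q := Y' ++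
      c :: (List.replicate k c ++ Q₁ ++ d :: Q₂) ++ r) (by simp)
    have h3 := hS.at (l ++ List.replicate (k + m') c ++ c :: d :: Y') (c := c)
      (q := List.replicate k c ++ Q₁ ++ d :: Q₂ ++ r) (by simp)
    have h4 := hS.at (l ++ List.replicate (k + m') c ++ c :: d :: Y' ++
      c :: (List.replicate k c ++ Q₁)) (c := d) (q := Q₂ ++ r) (by simp)
    simp only [List.length_append, List.length_cons, List.length_nil] at h1 h2 h3 h4
    omega
  · have e : List.replicate (k + 1) c ++ (List.replicate (k + 1) c ++
        (List.replicate m' c ++ d :: Y' ++ (Q₁ ++ d :: Q₂))) =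
          List.replicate (k + k + m') c ++ c :: c :: d :: (Y' ++ Q₁ ++ d :: Q₂) := by
      have e1 : List.replicate (k + 1) c ++ (List.replicate (k + 1) c ++ List.replicate m' c) =
          List.replicate (k + k + m') c ++ [c, c] := by
        rw [← List.replicate_add, ← List.replicate_add,
          show k + 1 + (k + 1 + m') = k + k + m' + 2 by omega, List.replicate_add]
        rfl
      calc _ = (List.replicate (k + 1) c ++ (List.replicate (k + 1) c ++
            List.replicate m' c)) ++ d :: Y' ++ (Q₁ ++ d :: Q₂) := by
              simp only [List.append_assoc]
        _ = _ := by rw [e1]; simp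
    rw [e] at h
    obtain ⟨l, r, m, hm, hS⟩ := hW _ h
    have h1 := hS.at (l ++ List.replicate (k + k + m') c) (c := c)
      (q := c :: d :: (Y' ++ Q₁ ++ d :: Q₂) ++ r) (by simp)
    have h2 := hS.at (l ++ List.replicate (k + k + m') c ++ [c]) (c := c)
      (q := d :: (Y' ++ Q₁ ++ d :: Q₂) ++ r) (by simp)
    have h3 := hS.at (l ++ List.replicate (k + k + m') c ++ [c, c]) (c := d)
      (q := Y' ++ Q₁ ++ d :: Q₂ ++ r) (by simp)
    have h4 := hS.at (l ++ List.replicate (k + k + m') c ++ c :: c :: d :: (Y' ++ Q₁)) (c := d)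
      (q := Q₂ ++ r) (by simp)
    simp only [List.length_append, List.length_cons, List.length_nil] at h1 h2 h3 h4
    omega

theorem wLaw_of_shape_atba (hat : a ≠ t) (has : a ≠ s) (hbt : b ≠ t)
    (hbs : b ≠ s) (hts : t ≠ s) (hP : PhiFactors W)
    (hW : ∀ u ∈ Fac W, ∃ l r m, 4 ≤ m ∧ Shape a b t s 1 2 m (l ++ u ++ r)) :
    WLaw (MLam W) := by
  intro n π x y t'
  obtain ⟨X, rfl⟩ := mkM_surjective x
  choose Y hY using fun i => mkM_surjective (y i)
  choose T hT using fun i => mkM_surjective (t' i)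
  have e1 : (List.ofFn fun i => y (π i)).prod = mkM W (List.ofFn fun i => Y (π i)).flatten := by
    rw [← mkM_flatten, List.map_ofFn]
    congr 2
    funext i
    exact (hY _).symm
  have e2 : (List.ofFn fun i => t' i * y i).prod =
      mkM W (List.ofFn fun i => T i ++ Y i).flatten := by
    rw [← mkM_flatten, List.map_ofFn]
    congr 2
    funext i
    simp [mkM_append, hY, hT]
  rw [e1, e2]
  simp only [pow_two, ← mkM_append]
  refine mkM_eq fun hF => ?_
  have := commute_of_shape_atba hat has hbt hbs hts hP hW (X := X)
    (Y := (List.ofFn fun i => Y (π i)).flatten) (Q := (List.ofFn fun i => T i ++ Y i).flatten) (by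
      intro n hn
      simp only [List.mem_flatten, List.mem_ofFn] at hn ⊢
      obtain ⟨_, ⟨i, rfl⟩, hn⟩ := hn
      exact ⟨_, ⟨π i, rfl⟩, by simp [hn]⟩) (by simpa using hF)
  simp only [List.append_assoc] at this ⊢
  rw [← List.append_assoc (List.ofFn fun i => Y (π i)).flatten X, ← this]
  simp only [List.append_assoc]

/-- Here `X` and `Y` take powers of letters `c` and `d`. If `c ≠ d`, the three sides of the laws
contain `ccd⋯d`, `cd⋯dc` with only `d` in between, or `dcc⋯d`, and none of these is a factor of
`abta⁺sb⁺`. So `X` and `Y` commute. -/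
theorem hLaws_of_shape_abta (hab : a ≠ b) (hat : a ≠ t) (has : a ≠ s) (hbt : b ≠ t)
    (hbs : b ≠ s) (hts : t ≠ s) (hP : PhiFactors W)
    (hW : ∀ u ∈ Fac W, ∃ l r m, 4 ≤ m ∧ Shape a b t s 2 1 m (l ++ u ++ r)) :
    HLaw (MLam W) ∧ ∀ x y t : MLam W, x ^ 2 * y * t * y = x * y * x * t * y := by
  have last : ∀ (c k : ℕ), List.replicate (k + 1) c = List.replicate k c ++ [c] :=
    fun _ _ => List.replicate_succ'
  have first : ∀ (c k : ℕ), List.replicate (k + 1) c = c :: List.replicate k c :=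
    fun _ _ => List.replicate_succ
  have double : ∀ (c k : ℕ), List.replicate (k + 1) c ++ List.replicate (k + 1) c =
      List.replicate (k + k) c ++ [c, c] := by
    intro c k
    rw [← List.replicate_add, show k + 1 + (k + 1) = k + k + 2 by omega, List.replicate_add]
    rfl
  have double' : ∀ (c k : ℕ), List.replicate (k + 1) c ++ List.replicate (k + 1) c =
      [c, c] ++ List.replicate (k + k) c := by
    intro c k
    rw [← List.replicate_add, show k + 1 + (k + 1) = 2 + (k + k) by omega, List.replicate_add]
    rfl
  have key1 : ∀ X Y T : List ℕ, X ++ X ++ Y ++ T ++ Y ∈ Fac W → X ++ Y = Y ++ X := by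
    intro X Y T h
    obtain ⟨c, k, rfl⟩ := hP.rep X [] (fac_of_append (l := []) (r := Y ++ T ++ Y) (by simpa using h))
    obtain ⟨d, n, rfl⟩ := hP.rep Y T (fac_of_append (r := []) (by simpa using h))
    rcases eq_or_ne c d with rfl | hcd
    · rw [← List.replicate_add, ← List.replicate_add, Nat.add_comm]
    rcases k with _ | k
    · simp
    rcases n with _ | n
    · simp
    exfalso
    rw [double, first d n] at h
    obtain ⟨l, r, m, hm, hS⟩ := hW _ h
    have h1 := hS.at (l ++ List.replicate (k + k) c) (c := c)
      (q := c :: d :: (List.replicate n d ++ T ++ d :: List.replicate n d) ++ r) (by simp)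
    have h2 := hS.at (l ++ List.replicate (k + k) c ++ [c]) (c := c)
      (q := d :: (List.replicate n d ++ T ++ d :: List.replicate n d) ++ r) (by simp)
    have h3 := hS.at (l ++ List.replicate (k + k) c ++ [c, c]) (c := d)
      (q := List.replicate n d ++ T ++ d :: List.replicate n d ++ r) (by simp)
    have h4 := hS.at (l ++ List.replicate (k + k) c ++ c :: c :: d :: (List.replicate n d ++ T))
      (c := d) (q := List.replicate n d ++ r) (by simp)
    simp only [List.length_append, List.length_cons, List.length_nil] at h1 h2 h3 h4
    omega
  have key2 : ∀ X Y T : List ℕ, X ++ Y ++ X ++ T ++ Y ∈ Fac W → X ++ Y = Y ++ X := by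
    intro X Y T h
    obtain ⟨c, k, rfl⟩ := hP.rep X Y (fac_of_append (l := []) (r := T ++ Y) (by simpa using h))
    obtain ⟨d, n, rfl⟩ := hP.rep Y (List.replicate k c ++ T)
      (fac_of_append (r := []) (by simpa using h))
    rcases eq_or_ne c d with rfl | hcd
    · rw [← List.replicate_add, ← List.replicate_add, Nat.add_comm]
    rcases k with _ | k
    · simp
    rcases n with _ | n
    · simp
    exfalso
    have h' : List.replicate (k + 1) c ++ List.replicate (n + 1) d ++ List.replicate (k + 1) c ∈
      Fac W := fac_of_append (l := []) (r := T ++ List.replicate (n + 1) d) (by simpa using h)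
    obtain ⟨l, r, m, hm, hS⟩ := hW _ h'
    have h1 := hS.at (l ++ List.replicate k c) (c := c)
      (q := List.replicate (n + 1) d ++ List.replicate (k + 1) c ++ r) (by
        rw [last c k]; simp)
    have h2 := hS.at (l ++ List.replicate (k + 1) c) (c := d)
      (q := List.replicate n d ++ List.replicate (k + 1) c ++ r) (by
        rw [first d n]; simp)
    have h3 := hS.at (l ++ List.replicate (k + 1) c ++ List.replicate n d) (c := d)
      (q := List.replicate (k + 1) c ++ r) (by
        rw [last d n]; simp)
    have h4 := hS.at (l ++ List.replicate (k + 1) c ++ List.replicate (n + 1) d) (c := c)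
      (q := List.replicate k c ++ r) (by
        simp only [List.append_assoc]
        rw [first c k]; simp)
    simp only [List.length_append, List.length_replicate] at h1 h2 h3 h4
    omega
  have key3 : ∀ X Y T : List ℕ, Y ++ (X ++ X) ++ T ++ Y ∈ Fac W → X ++ Y = Y ++ X := by
    intro X Y T h
    obtain ⟨c, k, rfl⟩ := hP.rep X [] (fac_of_append (l := Y) (r := T ++ Y) (by simpa using h))
    obtain ⟨d, n, rfl⟩ := hP.rep Y (List.replicate k c ++ List.replicate k c ++ T)
      (fac_of_append (l := []) (r := []) (by simpa using h))
    rcases eq_or_ne c d with rfl | hcd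
    · rw [← List.replicate_add, ← List.replicate_add, Nat.add_comm]
    rcases k with _ | k
    · simp
    rcases n with _ | n
    · simp
    exfalso
    rw [double', last d n] at h
    obtain ⟨l, r, m, hm, hS⟩ := hW _ h
    have h1 := hS.at (l ++ List.replicate n d) (c := d) (q := [c, c] ++ List.replicate (k + k) c ++
      T ++ (List.replicate n d ++ [d]) ++ r) (by simp)
    have h2 := hS.at (l ++ List.replicate n d ++ [d]) (c := c) (q := [c] ++
      List.replicate (k + k) c ++ T ++ (List.replicate n d ++ [d]) ++ r) (by simp)
    have h3 := hS.at (l ++ List.replicate n d ++ [d, c]) (c := c) (q :=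
      List.replicate (k + k) c ++ T ++ (List.replicate n d ++ [d]) ++ r) (by simp)
    have h4 := hS.at (l ++ List.replicate n d ++ [d, c, c] ++ List.replicate (k + k) c ++ T ++
      List.replicate n d) (c := d) (q := r) (by simp)
    simp only [List.length_append, List.length_cons, List.length_nil] at h1 h2 h3 h4
    omega
  constructor
  · intro x y t
    obtain ⟨X, rfl⟩ := mkM_surjective x
    obtain ⟨Y, rfl⟩ := mkM_surjective y
    obtain ⟨T, rfl⟩ := mkM_surjective t
    simp only [pow_two, ← mkM_append]
    refine mkM_eq fun hF => ?_
    suffices hXY : X ++ Y = Y ++ X by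
      have : X ++ X ++ Y = Y ++ (X ++ X) := by
        rw [List.append_assoc, hXY, ← List.append_assoc, hXY, List.append_assoc]
      rw [this]
    exact hF.elim (key1 X Y T) (key3 X Y T)
  · intro x y t
    obtain ⟨X, rfl⟩ := mkM_surjective x
    obtain ⟨Y, rfl⟩ := mkM_surjective y
    obtain ⟨T, rfl⟩ := mkM_surjective t
    simp only [pow_two, ← mkM_append]
    refine mkM_eq fun hF => ?_
    suffices hXY : X ++ Y = Y ++ X by
      have : X ++ X ++ Y = X ++ Y ++ X := by
        rw [List.append_assoc X Y X, ← hXY, List.append_assoc]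
      rw [this]
    exact hF.elim (key1 X Y T) (key2 X Y T)

end shape

/-! ### The monoids `M_λ(W)` in the varieties -/

section ulift

variable {M : Type} [Monoid M]

theorem PhiLaws.ulift (h : PhiLaws M) : PhiLaws (ULift.{u} M) where
  xtx x t := ULift.down_injective (h.xtx x.down t.down)
  sq_comm x y := ULift.down_injective (h.sq_comm x.down y.down)
  xytxy x y t := ULift.down_injective (h.xytxy x.down y.down t.down)
  fill x t₁ t₂ t₃ := ULift.down_injective (h.fill x.down t₁.down t₂.down t₃.down)

theorem WLaw.ulift (h : WLaw M) : WLaw (ULift.{u} M) := by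
  intro n π x y t
  apply (MulEquiv.ulift : ULift.{u} M ≃* M).injective
  have := h n π x.down (fun i => (y i).down) fun i => (t i).down
  simp only [map_mul, map_pow, map_list_prod, List.map_ofFn, Function.comp_def]
  exact this

theorem ILaw.ulift (h : ILaw M) : ILaw (ULift.{u} M) := fun x t y s =>
  ULift.down_injective (h x.down t.down y.down s.down)

theorem HLaw.ulift (h : HLaw M) : HLaw (ULift.{u} M) := fun x y t =>
  ULift.down_injective (h x.down y.down t.down)

theorem ELaw.ulift (h : ELaw M) : ELaw (ULift.{u} M) := fun x y t s =>
  ULift.down_injective (h x.down y.down t.down s.down)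

end ulift

/-- The subvariety of `𝕀` defined by `xytxsy ≈ yxtxsy`. -/
def varFE : MonoidVariety.{u} := varIds
  {(x * t * x, x * t * x ^ 2), (x ^ 2 * y ^ 2, y ^ 2 * x ^ 2),
    (x * y * t * x * y, y * x * t * x * y),
    (x * t₁ * x * t₂ * t₃ * x, x * t₁ * x * t₂ * x * t₃ * x),
    (x * t * x * y * s * y, x * t * y * x * s * y),
    (x * y * t * x * s * y, y * x * t * x * s * y)}

theorem mem_varFE {M : Type u} [Monoid M] : varFE.Mem M ↔ PhiLaws M ∧ ILaw M ∧ ELaw M := by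
  constructor
  · intro h
    have hI : varI.Mem M := fun p hp => h p (by
      simp only [Set.mem_insert_iff, Set.mem_singleton_iff] at hp ⊢
      tauto)
    refine ⟨(mem_varI.1 hI).1, (mem_varI.1 hI).2, fun X Y T S => ?_⟩
    have := h (x * y * t * x * s * y, y * x * t * x * s * y) (by simp)
      fun n => [X, Y, T, S].getD n 1
    simpa using this
  · rintro ⟨h1, h2, h3⟩ p hp
    have hI := mem_varI.2 ⟨h1, h2⟩
    simp only [Set.mem_insert_iff, Set.mem_singleton_iff] at hp
    rcases hp with hp | hp | hp | hp | hp | rfl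
    · exact hI p (by simp [hp])
    · exact hI p (by simp [hp])
    · exact hI p (by simp [hp])
    · exact hI p (by simp [hp])
    · exact hI p (by simp [hp])
    · intro φ
      simpa using h3 (φ 0) (φ 1) (φ 2) (φ 3)

theorem varFE_le_varI : (varFE : MonoidVariety.{u}) ≤ varI := fun _ _ h =>
  mem_varI.2 ⟨(mem_varFE.1 h).1, (mem_varFE.1 h).2.1⟩

theorem varFE_le_varJ : (varFE : MonoidVariety.{u}) ≤ varJ :=
  MonoidVariety.le_trans' varFE_le_varI varI_le_varJ

theorem mem_of_mem_fac {u w : List ℕ} (h : u ∈ Fac {cls w}) {n : ℕ} (hn : n ∈ u) : n ∈ w := by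
  obtain ⟨l, r, h⟩ := mem_fac_singleton.1 h
  have := count_eq_zero_iff_of_cls h n
  rw [List.count_eq_zero, List.count_eq_zero] at this
  by_contra hw
  exact this.2 hw (by simp [hn])

theorem count_le_one_of_mem_fac {u w : List ℕ} (h : u ∈ Fac {cls w}) {n : ℕ} (hn : w.count n = 1) :
    u.count n ≤ 1 := by
  obtain ⟨l, r, h⟩ := mem_fac_singleton.1 h
  have := (count_eq_one_iff_of_cls h n).2 hn
  simp only [List.count_append] at this
  omega

section

variable {a b t s : ℕ}

theorem var_atba_le (hab : a ≠ b) (hat : a ≠ t) (has : a ≠ s) (hbt : b ≠ t) (hbs : b ≠ s)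
    (hts : t ≠ s) : (.var (MLam {cls [a, t, b, a, s, b]}) : MonoidVariety.{u}) ≤ varJ := by
  have hW : ∀ u ∈ Fac {cls [a, t, b, a, s, b]}, ∃ l r m, 4 ≤ m ∧
      Shape a b t s 1 2 m (l ++ u ++ r) := by
    intro u hu
    obtain ⟨l, r, h⟩ := mem_fac_singleton.1 hu
    obtain ⟨i, j, h⟩ := (cls_eq_atba hab hat has hbt hbs hts).1 h
    exact ⟨l, r, i + 4, by omega, h ▸ shape_atba a b t s i j⟩
  have hP := phiFactors_of_shape hab hat has hbt hbs hts (Or.inl ⟨rfl, rfl⟩) hW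
  exact MonoidVariety.var_le (mem_varJ.2
    ⟨hP.phiLaws.ulift, (wLaw_of_shape_atba hat has hbt hbs hts hP hW).ulift⟩)

theorem var_abta_le (hab : a ≠ b) (hat : a ≠ t) (has : a ≠ s) (hbt : b ≠ t) (hbs : b ≠ s)
    (hts : t ≠ s) : (.var (MLam {cls [a, b, t, a, s, b]}) : MonoidVariety.{u}) ≤ varH := by
  have hW : ∀ u ∈ Fac {cls [a, b, t, a, s, b]}, ∃ l r m, 4 ≤ m ∧
      Shape a b t s 2 1 m (l ++ u ++ r) := by
    intro u hu
    obtain ⟨l, r, h⟩ := mem_fac_singleton.1 hu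
    obtain ⟨i, j, h⟩ := (cls_eq_abta hab hat has hbt hbs hts).1 h
    exact ⟨l, r, i + 4, by omega, h ▸ shape_abta a b t s i j⟩
  have hP := phiFactors_of_shape hab hat has hbt hbs hts (Or.inr ⟨rfl, rfl⟩) hW
  have hH := hLaws_of_shape_abta hab hat has hbt hbs hts hP hW
  exact MonoidVariety.var_le (mem_varH.2 ⟨hP.phiLaws.ulift, hH.1.ulift,
    fun x y t => ULift.down_injective (hH.2 x.down y.down t.down)⟩)

/-- The bound `2 ≤ l.length` places the factor inside the part `ba⁺sb⁺` of `atba⁺sb⁺`. There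
`c⋯cd⋯d` and `c⋯dc⋯d` with `c ≠ d` cannot occur; the full word `atba⁺sb⁺` does contain the second
one. -/
theorem iLaw_of_shape {W : Set lam.Quotient} (has : a ≠ s) (hbs : b ≠ s)
    (hP : PhiFactors W) (hW : ∀ u ∈ Fac W, ∃ l r m, 4 ≤ m ∧ 2 ≤ l.length ∧
      Shape a b t s 1 2 m (l ++ u ++ r)) : ILaw (MLam W) := by
  have last : ∀ (c k : ℕ), List.replicate (k + 1) c = List.replicate k c ++ [c] :=
    fun _ _ => List.replicate_succ'
  have first : ∀ (c k : ℕ), List.replicate (k + 1) c = c :: List.replicate k c :=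
    fun _ _ => List.replicate_succ
  have key1 : ∀ X T Y S : List ℕ, X ++ T ++ X ++ Y ++ S ++ Y ∈ Fac W → X ++ Y = Y ++ X := by
    intro X T Y S h
    obtain ⟨c, k, rfl⟩ := hP.rep X T (fac_of_append (l := []) (r := Y ++ S ++ Y) (by simpa using h))
    obtain ⟨d, n, rfl⟩ := hP.rep Y S
      (fac_of_append (l := List.replicate k c ++ T ++ List.replicate k c) (r := [])
        (by simpa using h))
    rcases eq_or_ne c d with rfl | hcd
    · rw [← List.replicate_add, ← List.replicate_add, Nat.add_comm]
    rcases k with _ | k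
    · simp
    rcases n with _ | n
    · simp
    exfalso
    have h' : c :: (List.replicate k c ++ T ++ List.replicate k c) ++ [c] ++ d ::
        (List.replicate n d ++ S ++ List.replicate n d) ++ [d] ∈ Fac W := by
      have e : c :: (List.replicate k c ++ T ++ List.replicate k c) ++ [c] ++ d ::
          (List.replicate n d ++ S ++ List.replicate n d) ++ [d] = (c :: List.replicate k c) ++ T ++
            (List.replicate k c ++ [c]) ++ (d :: List.replicate n d) ++ S ++
              (List.replicate n d ++ [d]) := by simp
      rw [e, ← last c k, ← first c k, ← last d n, ← first d n]
      exact h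
    obtain ⟨l, r, m, hm, hl, hS⟩ := hW _ h'
    have h1 := hS.at l (c := c) (q := (List.replicate k c ++ T ++ List.replicate k c) ++ [c] ++ d ::
        (List.replicate n d ++ S ++ List.replicate n d) ++ [d] ++ r) (by simp)
    have h2 := hS.at (l ++ c :: (List.replicate k c ++ T ++ List.replicate k c)) (c := c)
      (q := d :: (List.replicate n d ++ S ++ List.replicate n d) ++ [d] ++ r) (by simp)
    have h3 := hS.at (l ++ c :: (List.replicate k c ++ T ++ List.replicate k c) ++ [c]) (c := d)
      (q := (List.replicate n d ++ S ++ List.replicate n d) ++ [d] ++ r) (by simp)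
    have h4 := hS.at (l ++ c :: (List.replicate k c ++ T ++ List.replicate k c) ++ [c] ++ d ::
        (List.replicate n d ++ S ++ List.replicate n d)) (c := d) (q := r) (by simp)
    simp only [List.length_append, List.length_cons, List.length_nil] at h1 h2 h3 h4
    omega
  have key2 : ∀ X T Y S : List ℕ, X ++ T ++ Y ++ X ++ S ++ Y ∈ Fac W → X ++ Y = Y ++ X := by
    intro X T Y S h
    obtain ⟨c, k, rfl⟩ := hP.rep X (T ++ Y)
      (fac_of_append (l := []) (r := S ++ Y) (by simpa using h))
    obtain ⟨d, n, rfl⟩ := hP.rep Y (List.replicate k c ++ S)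
      (fac_of_append (l := List.replicate k c ++ T) (r := []) (by simpa using h))
    rcases eq_or_ne c d with rfl | hcd
    · rw [← List.replicate_add, ← List.replicate_add, Nat.add_comm]
    rcases k with _ | k
    · simp
    rcases n with _ | n
    · simp
    exfalso
    have h' : c :: (List.replicate k c ++ T ++ List.replicate n d) ++ [d] ++ c ::
        (List.replicate k c ++ S ++ List.replicate n d) ++ [d] ∈ Fac W := by
      convert h using 1
      simp only [last d n, first c k]
      simp
    obtain ⟨l, r, m, hm, hl, hS⟩ := hW _ h'
    have h1 := hS.at l (c := c) (q := (List.replicate k c ++ T ++ List.replicate n d) ++ [d] ++ c ::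
        (List.replicate k c ++ S ++ List.replicate n d) ++ [d] ++ r) (by simp)
    have h2 := hS.at (l ++ c :: (List.replicate k c ++ T ++ List.replicate n d)) (c := d)
      (q := c :: (List.replicate k c ++ S ++ List.replicate n d) ++ [d] ++ r) (by simp)
    have h3 := hS.at (l ++ c :: (List.replicate k c ++ T ++ List.replicate n d) ++ [d]) (c := c)
      (q := (List.replicate k c ++ S ++ List.replicate n d) ++ [d] ++ r) (by simp)
    have h4 := hS.at (l ++ c :: (List.replicate k c ++ T ++ List.replicate n d) ++ [d] ++ c ::
        (List.replicate k c ++ S ++ List.replicate n d)) (c := d) (q := r) (by simp)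
    simp only [List.length_append, List.length_cons, List.length_nil] at h1 h2 h3 h4
    omega
  intro x t y s
  obtain ⟨X, rfl⟩ := mkM_surjective x
  obtain ⟨Y, rfl⟩ := mkM_surjective y
  obtain ⟨T, rfl⟩ := mkM_surjective t
  obtain ⟨S, rfl⟩ := mkM_surjective s
  simp only [← mkM_append]
  refine mkM_eq fun hF => ?_
  have hXY := hF.elim (key1 X T Y S) (key2 X T Y S)
  simp only [List.append_assoc]
  rw [← List.append_assoc X Y, hXY, List.append_assoc]

theorem var_baas_le (hab : a ≠ b) (hat : a ≠ t) (has : a ≠ s) (hbt : b ≠ t) (hbs : b ≠ s)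
    (hts : t ≠ s) : (.var (MLam {cls [b, a, a, s, b]}) : MonoidVariety.{u}) ≤ varI := by
  have hW : ∀ u ∈ Fac {cls [b, a, a, s, b]}, ∃ l r m, 4 ≤ m ∧ 2 ≤ l.length ∧
      Shape a b t s 1 2 m (l ++ u ++ r) := by
    intro u hu
    obtain ⟨l, r, h⟩ := mem_fac_singleton.1 hu
    obtain ⟨i, j, h⟩ := (cls_eq_baas hab has hbs).1 h
    -- The positions are those of `atba⁺sb⁺`: putting `at` in front of a word of the class `ba⁺sb⁺`
    -- shifts every factor by two.
    refine ⟨a :: t :: l, r, i + 1 + 4, by omega, by simp, ?_⟩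
    simp only [List.cons_append, h]
    exact shape_atba a b t s (i + 1) j
  have hP := phiFactors_of_shape hab hat has hbt hbs hts (Or.inl ⟨rfl, rfl⟩) fun u hu => by
    obtain ⟨l, r, m, h1, -, h2⟩ := hW u hu
    exact ⟨l, r, m, h1, h2⟩
  exact MonoidVariety.var_le (mem_varI.2
    ⟨hP.phiLaws.ulift, (iLaw_of_shape has hbs hP hW).ulift⟩)

theorem var_le_varFE {W : Set lam.Quotient} (hat : a ≠ t)
    (ha : ∀ u ∈ Fac W, ∀ n ∈ u, n = a ∨ n = t) (ht : ∀ u ∈ Fac W, u.count t ≤ 1) :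
    (.var (MLam W) : MonoidVariety.{u}) ≤ varFE :=
  MonoidVariety.var_le (mem_varFE.2 ⟨(phiFactors_of_one hat ha ht).phiLaws.ulift,
    (laws_of_one ha ht).1.ulift, (laws_of_one ha ht).2.ulift⟩)

theorem var_aata_le (hat : a ≠ t) :
    (.var (MLam {cls [a, a, t, a]}) : MonoidVariety.{u}) ≤ varFE :=
  var_le_varFE hat (fun u hu n hn => by simpa [or_comm] using mem_of_mem_fac hu hn)
    fun u hu => count_le_one_of_mem_fac hu (by simp [hat])

theorem var_ata_aat_le (hat : a ≠ t) :
    (.var (MLam {cls [a, t, a], cls [a, a, t]}) : MonoidVariety.{u}) ≤ varFE := by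
  refine var_le_varFE hat (fun u hu n hn => ?_) fun u hu => ?_
  · rcases mem_fac_insert.1 hu with hu | hu
    · simpa [or_comm] using mem_of_mem_fac hu hn
    · simpa using mem_of_mem_fac hu hn
  · rcases mem_fac_insert.1 hu with hu | hu
    · exact count_le_one_of_mem_fac hu (by simp [hat])
    · exact count_le_one_of_mem_fac hu (by simp [hat])

theorem var_ata_le (hat : a ≠ t) :
    (.var (MLam {cls [a, t, a]}) : MonoidVariety.{u}) ≤ varF := by
  have ha : ∀ u ∈ Fac {cls [a, t, a]}, ∀ n ∈ u, n = a ∨ n = t := fun u hu n hn => by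
    simpa [or_comm] using mem_of_mem_fac hu hn
  have ht : ∀ u ∈ Fac {cls [a, t, a]}, u.count t ≤ 1 := fun u hu =>
    count_le_one_of_mem_fac hu (by simp [hat])
  have hP := (phiFactors_of_one hat ha ht).phiLaws
  have h3 : ∀ x t' s' : MLam {cls [a, t, a]}, x * t' * x * s' = x * t' * x * s' * x := by
    intro x t' s'
    obtain ⟨X, rfl⟩ := mkM_surjective x
    obtain ⟨T, rfl⟩ := mkM_surjective t'
    obtain ⟨S, rfl⟩ := mkM_surjective s'
    simp only [← mkM_append]
    refine mkM_eq fun hF => ?_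
    have hXS : X ++ T ++ X ++ S ∈ Fac {cls [a, t, a]} := hF.elim id fun h =>
      fac_of_append (l := []) (by simpa using h)
    have hX := eq_replicate_of_twice ha ht (X := X) (p := T)
      (fac_of_append (l := []) (r := S) (by simpa using hXS))
    rcases hk : X.length with _ | k
    · simp [List.length_eq_zero_iff.1 hk]
    rw [hk] at hX
    have hS : S = List.replicate S.length a := by
      refine List.eq_replicate_of_mem fun n hn => ?_
      rcases ha _ hXS n (by simp [hn]) with hna | rfl
      · exact hna
      exfalso
      obtain ⟨S₁, S₂, rfl⟩ := List.append_of_mem hn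
      obtain ⟨l, r, h⟩ := mem_fac_singleton.1 hXS
      obtain ⟨i, h⟩ := (cls_eq_ata hat).1 h
      -- Two nonempty copies of `X` precede this letter, so its position is at least two, where
      -- words of the class `ata⁺` have only `a`.
      have h1 : (a :: n :: List.replicate (i + 1) a)[(l ++ X ++ T ++ X ++ S₁).length]? = some n := by
        rw [← h]
        simp
      obtain ⟨m, hm⟩ : ∃ m, (l ++ X ++ T ++ X ++ S₁).length = m + 2 :=
        ⟨l.length + T.length + S₁.length + k + k, by
          simp only [List.length_append]
          omega⟩
      rw [hm] at h1
      have := List.eq_of_mem_replicate (List.mem_of_getElem? (l := List.replicate (i + 1) a) h1)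
      exact hat this.symm
    rw [hS, hX]
    have := cls_replicate_congr (p := List.replicate (k + 1) a ++ T) (c := a) (by simp) []
      (m := k + 1 + S.length) (n := k + 1 + S.length + (k + 1)) (by omega) (by omega)
    simpa only [List.replicate_add, List.append_assoc, List.append_nil] using this
  exact MonoidVariety.var_le (mem_varF.2 ⟨hP.ulift.sq_comm, hP.ulift.xytxy, fun x t s =>
    ULift.down_injective (h3 x.down t.down s.down)⟩)

end

/-! ## The identities of the varieties -/

def InvE (u w : List ℕ) : Prop := SameF u w ∧ SameL u w
def InvH (u w : List ℕ) : Prop := InvE u w ∧ SameH u w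
-- `SameH` need not be listed for `𝕀` and `𝕁`: since `ℍ` is contained in `𝕀`, it follows from the
-- conditions given.
def InvI (u w : List ℕ) : Prop := InvE u w ∧ SameI u w
def InvJ (u w : List ℕ) : Prop := InvI u w ∧ SameJ u w

section inv

variable {u v w : List ℕ}

theorem InvE.symm (h : InvE u w) : InvE w u := ⟨h.1.symm, fun t x => (h.2 t x).symm⟩

theorem InvE.trans (h : InvE u v) (k : InvE v w) : InvE u w :=
  ⟨h.1.trans k.1, fun t x => (h.2 t x).trans (k.2 t x)⟩

theorem InvH.symm (h : InvH u w) : InvH w u := ⟨h.1.symm, fun x y t s => (h.2 x y t s).symm⟩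

theorem InvH.trans (h : InvH u v) (k : InvH v w) : InvH u w :=
  ⟨h.1.trans k.1, fun x y t s => (h.2 x y t s).trans (k.2 x y t s)⟩

theorem InvI.symm (h : InvI u w) : InvI w u := ⟨h.1.symm, fun x y s => (h.2 x y s).symm⟩

theorem InvI.trans (h : InvI u v) (k : InvI v w) : InvI u w :=
  ⟨h.1.trans k.1, fun x y s => (h.2 x y s).trans (k.2 x y s)⟩

theorem InvJ.symm (h : InvJ u w) : InvJ w u := ⟨h.1.symm, fun x y t s => (h.2 x y t s).symm⟩

theorem InvJ.trans (h : InvJ u v) (k : InvJ v w) : InvJ u w :=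
  ⟨h.1.trans k.1, fun x y t s => (h.2 x y t s).trans (k.2 x y t s)⟩

end inv

theorem sim_of_holds {V : MonoidVariety.{u}} {W : Set lam.Quotient} (hV : .var (MLam W) ≤ V)
    {u w : List ℕ} (h : Holds V u w) : Sim W u w :=
  sim_of_ev (holds_var_iff.1 (h.mono hV))

section

variable {a b t s : ℕ} {u w : List ℕ}

/-- The `λ`-word `atba⁺sb⁺` has the factors `a·tb·a⁺`, `a⁺s` and `ba⁺sb⁺`, so one monoid yields all
four invariants. -/
theorem invJ_of_sim (hab : a ≠ b) (hat : a ≠ t) (has : a ≠ s) (hbt : b ≠ t) (hbs : b ≠ s)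
    (hts : t ≠ s) (h : Sim {cls [a, t, b, a, s, b]} u w) : InvJ u w := by
  have h0 : [a, t, b, a, a, s, b] ∈ Fac {cls [a, t, b, a, s, b]} :=
    mem_fac_singleton.2 ⟨[], [], (cls_dup (p := [a, t, b]) (by simp) [s, b]).symm⟩
  have hF : SameF u w := sameF_of_sim (c := a) (T := [t, b]) (by simp) (by simp [hat, hab])
    (fac_of_infix h0 ⟨[], [s, b], by simp⟩) h
  have hL : SameL u w := sameL_of_sim (d := a) (T := [s]) (by simp) (by simp [has])
    (fac_of_infix h0 ⟨[a, t, b], [b], by simp⟩) hF h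
  exact ⟨⟨⟨hF, hL⟩, sameI_of_sim hab has hbs (fac_of_infix h0 ⟨[a, t], [], by simp⟩) hF hL h⟩,
    sameJ_of_sim hab hat has hbt hbs hts (mem_fac_singleton.2 ⟨[], [], by simp⟩) hF hL h⟩

theorem invI_of_sim (hab : a ≠ b) (has : a ≠ s) (hbs : b ≠ s)
    (h : Sim {cls [b, a, a, s, b]} u w) : InvI u w := by
  have h1 : [b, a, a, s, b] ∈ Fac {cls [b, a, a, s, b]} :=
    mem_fac_singleton.2 ⟨[], [], by simp⟩
  have h0 : [b, a, a, s, b, b] ∈ Fac {cls [b, a, a, s, b]} :=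
    mem_fac_singleton.2 ⟨[], [], (cls_dup (p := [b, a, a, s]) (by simp) []).symm⟩
  have hF : SameF u w := sameF_of_sim (c := b) (T := [a, a, s]) (by simp) (by simp [hab.symm, hbs])
    h0 h
  have hL : SameL u w := sameL_of_sim (d := a) (T := [s]) (by simp) (by simp [has])
    (fac_of_infix h1 ⟨[b], [b], by simp⟩) hF h
  exact ⟨⟨hF, hL⟩, sameI_of_sim hab has hbs h1 hF hL h⟩

theorem invH_of_sim (hab : a ≠ b) (hat : a ≠ t) (has : a ≠ s) (hbt : b ≠ t) (hbs : b ≠ s)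
    (hts : t ≠ s) (h : Sim {cls [a, b, t, a, s, b]} u w) : InvH u w := by
  have h0 : [a, b, t, a, a, s, b] ∈ Fac {cls [a, b, t, a, s, b]} :=
    mem_fac_singleton.2 ⟨[], [], (cls_dup (p := [a, b, t]) (by simp) [s, b]).symm⟩
  have hF : SameF u w := sameF_of_sim (c := a) (T := [b, t]) (by simp) (by simp [hat, hab])
    (fac_of_infix h0 ⟨[], [s, b], by simp⟩) h
  have hL : SameL u w := sameL_of_sim (d := a) (T := [s]) (by simp) (by simp [has])
    (fac_of_infix h0 ⟨[a, b, t], [b], by simp⟩) hF h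
  exact ⟨⟨hF, hL⟩,
    sameH_of_sim hab hat has hbt hbs hts (mem_fac_singleton.2 ⟨[], [], by simp⟩) hF hL h⟩

theorem sameF_of_sim_ata (hat : a ≠ t) (h : Sim {cls [a, t, a]} u w) : SameF u w :=
  sameF_of_sim (c := a) (T := [t]) (by simp) (by simp [hat])
    (mem_fac_singleton.2 ⟨[], [], (cls_dup (p := [a, t]) (by simp) []).symm⟩) h

theorem invE_of_sim_ata_aat (hat : a ≠ t) (h : Sim {cls [a, t, a], cls [a, a, t]} u w) :
    InvE u w := by
  have hF : SameF u w := sameF_of_sim (c := a) (T := [t]) (by simp) (by simp [hat])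
    (mem_fac_insert.2 (Or.inl (mem_fac_singleton.2
      ⟨[], [], (cls_dup (p := [a, t]) (by simp) []).symm⟩))) h
  exact ⟨hF, sameL_of_sim (d := a) (T := [t]) (by simp) (by simp [hat])
    (mem_fac_insert.2 (Or.inr (mem_fac_singleton.2 ⟨[], [], by simp⟩))) hF h⟩

theorem invE_of_sim_aata (hat : a ≠ t) (h : Sim {cls [a, a, t, a]} u w) : InvE u w := by
  have h0 : [a, a, t, a, a] ∈ Fac {cls [a, a, t, a]} :=
    mem_fac_singleton.2 ⟨[], [], (cls_dup (p := [a, a, t]) (by simp) []).symm⟩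
  have hF : SameF u w := sameF_of_sim (c := a) (T := [t]) (by simp) (by simp [hat])
    (fac_of_infix h0 ⟨[a], [], by simp⟩) h
  exact ⟨hF, sameL_of_sim (d := a) (T := [t]) (by simp) (by simp [hat])
    (fac_of_infix h0 ⟨[], [a, a], by simp⟩) hF h⟩

end

/-! ### The laws as rules for swapping letters of words -/

section rules

variable {V : MonoidVariety.{u}}

theorem swap_of_iLaw (h : ∀ (M : Type u) [Monoid M], V.Mem M → ILaw M) (p q : List ℕ) (y z : ℕ)
    (hz : z ∈ p) (hy : y ∈ q) : Holds V (p ++ z :: y :: q) (p ++ y :: z :: q) := by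
  obtain ⟨p₁, p₂, rfl⟩ := List.append_of_mem hz
  obtain ⟨q₁, q₂, rfl⟩ := List.append_of_mem hy
  intro M _ hM φ
  have := congrArg (fun m => ev φ p₁ * m * ev φ q₂) (h M hM (φ z) (ev φ p₂) (φ y) (ev φ q₁))
  simpa only [ev_append, ev_cons, mul_assoc] using this

theorem swap_of_hLaw (h : ∀ (M : Type u) [Monoid M], V.Mem M → HLaw M) (p q : List ℕ) (x y : ℕ)
    (hy : y ∈ q) : Holds V (p ++ x :: x :: y :: q) (p ++ y :: x :: x :: q) := by
  obtain ⟨q₁, q₂, rfl⟩ := List.append_of_mem hy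
  intro M _ hM φ
  have := congrArg (fun m => ev φ p * m * ev φ q₂) (h M hM (φ x) (φ y) (ev φ q₁))
  simpa only [ev_append, ev_cons, pow_two, mul_assoc] using this

theorem swap_of_eLaw (h : ∀ (M : Type u) [Monoid M], V.Mem M → ELaw M) (p q : List ℕ) (x y : ℕ)
    (hx : x ∈ q) (hy : y ∈ q) : Holds V (p ++ x :: y :: q) (p ++ y :: x :: q) := by
  rcases eq_or_ne x y with rfl | hxy
  · exact fun _ _ _ _ => rfl
  intro M _ hM φ
  obtain ⟨q₁, q₂, rfl⟩ := List.append_of_mem hx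
  simp only [List.mem_append, List.mem_cons, hxy.symm, false_or] at hy
  rcases hy with hy | hy
  · obtain ⟨q₃, q₄, rfl⟩ := List.append_of_mem hy
    have := congrArg (fun m => ev φ p * m * ev φ q₂) (h M hM (φ y) (φ x) (ev φ q₃) (ev φ q₄)).symm
    simpa only [ev_append, ev_cons, mul_assoc] using this
  · obtain ⟨q₃, q₄, rfl⟩ := List.append_of_mem hy
    have := congrArg (fun m => ev φ p * m * ev φ q₄) (h M hM (φ x) (φ y) (ev φ q₁) (ev φ q₃))
    simpa only [ev_append, ev_cons, mul_assoc] using this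

end rules

theorem invJ_of_holds {u w : List ℕ} (h : Holds (varJ : MonoidVariety.{u}) u w) : InvJ u w :=
  invJ_of_sim (a := 0) (b := 1) (t := 2) (s := 3) (by simp) (by simp) (by simp) (by simp) (by simp)
    (by simp) (sim_of_holds (var_atba_le (by simp) (by simp) (by simp) (by simp) (by simp)
      (by simp)) h)

theorem invI_of_holds {u w : List ℕ} (h : Holds (varI : MonoidVariety.{u}) u w) : InvI u w :=
  invI_of_sim (a := 0) (b := 1) (s := 3) (by simp) (by simp) (by simp)
    (sim_of_holds (var_baas_le (t := 2) (by simp) (by simp) (by simp) (by simp) (by simp)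
      (by simp)) h)

theorem invH_of_holds {u w : List ℕ} (h : Holds (varH : MonoidVariety.{u}) u w) : InvH u w :=
  invH_of_sim (a := 0) (b := 1) (t := 2) (s := 3) (by simp) (by simp) (by simp) (by simp) (by simp)
    (by simp) (sim_of_holds (var_abta_le (by simp) (by simp) (by simp) (by simp) (by simp)
      (by simp)) h)

theorem invE_of_holds {u w : List ℕ} (h : Holds (varFE : MonoidVariety.{u}) u w) : InvE u w :=
  invE_of_sim_aata (a := 0) (t := 1) (by simp) (sim_of_holds (var_aata_le (by simp)) h)

theorem sameF_of_holds {u w : List ℕ} (h : Holds (varF : MonoidVariety.{u}) u w) : SameF u w :=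
  sameF_of_sim_ata (a := 0) (t := 1) (by simp) (sim_of_holds (var_ata_le (by simp)) h)

theorem solvable_varJ : Solvable (Holds (varJ : MonoidVariety.{u})) InvJ where
  toWordTheory := wordTheory_of_le (MonoidVariety.le_refl' _)
  c_symm := InvJ.symm
  c_trans := InvJ.trans
  sound := invJ_of_holds
  sameF h := h.1.1.1
  sameL h := h.1.1.2
  second_first := Or.inl fun h => h.2
  first_first := Or.inl fun h => h.1.2

theorem solvable_varI : Solvable (Holds (varI : MonoidVariety.{u})) InvI where
  toWordTheory := wordTheory_of_le varI_le_varJ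
  c_symm := InvI.symm
  c_trans := InvI.trans
  sound := invI_of_holds
  sameF h := h.1.1
  sameL h := h.1.2
  second_first := Or.inr (swap_of_iLaw fun _ _ hM => (mem_varI.1 hM).2)
  first_first := Or.inl fun h => h.2

theorem solvable_varH : Solvable (Holds (varH : MonoidVariety.{u})) InvH where
  toWordTheory := wordTheory_of_le varH_le_varJ
  c_symm := InvH.symm
  c_trans := InvH.trans
  sound := invH_of_holds
  sameF h := h.1.1
  sameL h := h.1.2
  second_first := Or.inr (swap_of_iLaw fun _ _ hM => (mem_varI.1 (varH_le_varI _ hM)).2)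
  first_first := Or.inr (Or.inl ⟨fun h => h.2, swap_of_hLaw fun _ _ hM => (mem_varH.1 hM).2.1⟩)

theorem solvable_varFE : Solvable (Holds (varFE : MonoidVariety.{u})) InvE where
  toWordTheory := wordTheory_of_le varFE_le_varJ
  c_symm := InvE.symm
  c_trans := InvE.trans
  sound := invE_of_holds
  sameF h := h.1
  sameL h := h.2
  second_first := Or.inr (swap_of_iLaw fun _ _ hM => (mem_varFE.1 hM).2.1)
  first_first := Or.inr (Or.inr (swap_of_eLaw fun _ _ hM => (mem_varFE.1 hM).2.2))

theorem holds_varJ_iff {u w : List ℕ} : Holds (varJ : MonoidVariety.{u}) u w ↔ InvJ u w :=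
  ⟨invJ_of_holds, solvable_varJ.complete (p := [])⟩

theorem holds_varI_iff {u w : List ℕ} : Holds (varI : MonoidVariety.{u}) u w ↔ InvI u w :=
  ⟨invI_of_holds, solvable_varI.complete (p := [])⟩

theorem holds_varH_iff {u w : List ℕ} : Holds (varH : MonoidVariety.{u}) u w ↔ InvH u w :=
  ⟨invH_of_holds, solvable_varH.complete (p := [])⟩

theorem holds_varFE_iff {u w : List ℕ} : Holds (varFE : MonoidVariety.{u}) u w ↔ InvE u w :=
  ⟨invE_of_holds, solvable_varFE.complete (p := [])⟩

/-! ### Identities of `𝔽` -/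

/-- `xtxs ≈ xtxsx` allows any multiple letter to be repeated at the end of the word. -/
theorem holds_append_of_two {u m : List ℕ} (h : ∀ x ∈ m, 2 ≤ u.count x) :
    Holds (varF : MonoidVariety.{u}) u (u ++ m) := by
  induction m using List.reverseRecOn with
  | nil => rw [List.append_nil]; exact fun _ _ _ _ => rfl
  | append_singleton m x ih =>
    intro M _ hM φ
    rw [ih (fun y hy => h y (by simp [hy])) M hM φ]
    have hx := h x (by simp)
    obtain ⟨p, q, rfl, hp⟩ := exists_first_occurrence (z := x) (p := u)
      (List.count_pos_iff.1 (by omega))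
    obtain ⟨q₁, q₂, rfl⟩ : ∃ q₁ q₂, q = q₁ ++ x :: q₂ := by
      refine List.append_of_mem (List.count_pos_iff.1 ?_)
      simp only [List.count_append, List.count_cons_self, List.count_eq_zero.2 hp] at hx
      omega
    have := congrArg (ev φ p * ·) ((mem_varF.1 hM).2.2 (φ x) (ev φ q₁) (ev φ (q₂ ++ m)))
    simpa only [ev_append, ev_cons, ev_nil, mul_one, mul_assoc] using this

/-- After all multiple letters have been appended, every multiple letter occurs behind every simple
one. Then `SameL` holds and no `Sep` is possible, so none of the patterns occurs and the padded
identity holds already in `𝕁`. -/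
theorem holds_varF_iff {u w : List ℕ} : Holds (varF : MonoidVariety.{u}) u w ↔ SameF u w := by
  refine ⟨sameF_of_holds, fun h => ?_⟩
  set m := u.filter fun x => 2 ≤ u.count x with hm
  have hmu : ∀ x, x ∈ m ↔ 2 ≤ u.count x := by
    intro x
    simp only [hm, List.mem_filter, decide_eq_true_eq, and_iff_right_iff_imp]
    exact fun h => List.count_pos_iff.1 (by omega)
  have hmw : ∀ x, x ∈ m ↔ 2 ≤ w.count x := fun x => (hmu x).trans (h.two x)
  have hc : ∀ {v : List ℕ}, (∀ x, x ∈ m ↔ 2 ≤ v.count x) → ∀ t,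
      ((v ++ m).count t = 1 ↔ v.count t = 1) ∧ (2 ≤ (v ++ m).count t ↔ 2 ≤ v.count t) := by
    intro v hv t
    have h1 := hv t
    rw [← List.count_pos_iff] at h1
    rw [List.count_append]
    omega
  have hb : ∀ {v : List ℕ} {t : ℕ}, v.count t = 1 → bef t (v ++ m) = bef t v := fun {v t} ht =>
    bef_append_of_mem (List.count_pos_iff.1 (by omega)) _
  have ha : ∀ {v : List ℕ} {t : ℕ}, v.count t = 1 → aft t (v ++ m) = aft t v ++ m := by
    intro v t ht
    have e := eq_bef_append_aft (List.count_pos_iff.1 (by omega : 0 < v.count t))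
    conv_lhs => rw [e, List.append_assoc, List.cons_append]
    exact aft_append_cons (not_mem_bef t v) _
  have hF : SameF (u ++ m) (w ++ m) := by
    refine ⟨fun x => by simp [h.mem x], fun x => ?_, fun t x => ?_, fun t x => ?_⟩
    · rw [(hc hmu x).2, (hc hmw x).2, h.two]
    · rw [(hc hmu t).1, (hc hmw t).1, and_congr_right fun ht => by rw [hb ht],
        h.bef_mem]
      exact and_congr_right fun ht => by rw [hb ht]
    · rw [(hc hmu t).1, (hc hmw t).1, and_congr_right fun ht => by rw [hb ht],
        h.bef_two]
      exact and_congr_right fun ht => by rw [hb ht]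
  have hcount : ∀ {v : List ℕ} {t : ℕ}, v.count t = 1 → ∀ x, v.count x = (bef t v).count x +
      ((if t = x then 1 else 0) + (aft t v).count x) := by
    intro v t ht x
    have e := eq_bef_append_aft (List.count_pos_iff.1 (by omega : 0 < v.count t))
    conv_lhs => rw [e, List.count_append, List.count_cons]
    simp only [beq_iff_eq]
    omega
  have hL : SameL (u ++ m) (w ++ m) := by
    intro t x
    rw [(hc hmu t).1, (hc hmw t).1, h.count_eq_one t]
    refine and_congr_right fun ht => ?_
    have ht' := (h.count_eq_one t).2 ht
    rw [ha ht, ha ht']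
    by_cases hx : x ∈ m
    · simp [hx]
    have h1 := hcount ht x
    have h2 := hcount ht' x
    have h3 := h.mem_bef ht' x
    have h4 := h.mem x
    have h5 : x ≠ t → t ≠ x := Ne.symm
    rw [← List.count_pos_iff, ← List.count_pos_iff] at h3 h4
    rw [hmu] at hx
    have hx' := hx
    rw [h.two] at hx'
    simp only [List.mem_append, ← List.count_pos_iff (l := aft t _)]
    rw [show x ∈ m ↔ False by simp [hmu, hx], or_false, or_false]
    split_ifs at h1 h2 <;> omega
  have hsep : ∀ {v : List ℕ}, (∀ x, x ∈ m ↔ 2 ≤ v.count x) → ∀ x y s, ¬ Sep x y s (v ++ m) := by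
    rintro v hv x y s ⟨h1, h2, h3, -, -⟩
    rw [(hc hv s).1] at h1
    rw [(hc hv x).2, ← hv] at h2
    rw [ha h1] at h3
    exact h3 (by simp [h2])
  have hJ : InvJ (u ++ m) (w ++ m) :=
    ⟨⟨⟨hF, hL⟩, fun x y s => ⟨fun k => absurd k.1 (hsep hmu x y s),
      fun k => absurd k.1 (hsep hmw x y s)⟩⟩, fun x y t s =>
        ⟨fun k => absurd k.1 (hsep hmu x y s), fun k => absurd k.1 (hsep hmw x y s)⟩⟩
  have hT := wordTheory_of_le (V := (varF : MonoidVariety.{u})) varF_le_varJ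
  exact hT.trans (holds_append_of_two fun x hx => (hmu x).1 hx)
    (hT.trans ((holds_varJ_iff.2 hJ).mono varF_le_varJ)
      (hT.symm (holds_append_of_two fun x hx => (hmw x).1 hx)))

open MonoidVariety

/-! ## Inclusions between the varieties -/

theorem varF_le_varFE : (varF : MonoidVariety.{u}) ≤ varFE := le_of_holds fun _ _ h =>
  holds_varF_iff.2 (holds_varFE_iff.1 h).1

theorem varF_le_varH : (varF : MonoidVariety.{u}) ≤ varH := le_of_holds fun _ _ h =>
  holds_varF_iff.2 (holds_varH_iff.1 h).1.1

theorem dual_le {V W : MonoidVariety.{u}} (h : ∀ (N : Type u) [Monoid N], V.Mem N → W.Mem Nᵐᵒᵖ) :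
    V.dual ≤ W := by
  rintro M _ ⟨N, _, hN, ⟨e⟩⟩
  exact W.mem_of_equiv e.symm (h N hN)

theorem mem_dual {V : MonoidVariety.{u}} {N : Type u} [Monoid N] (h : V.Mem N) : V.dual.Mem Nᵐᵒᵖ :=
  ⟨N, inferInstance, h, ⟨MulEquiv.refl _⟩⟩

/-- Identities of the opposite monoid of `E¹`. -/
theorem E1.laws : ((∀ x t : E1, x * (t * x) = x ^ 2 * (t * x)) ∧
    (∀ x y : E1, y ^ 2 * x ^ 2 = x ^ 2 * y ^ 2) ∧
    (∀ x y t : E1, y * (x * (t * (y * x))) = y * (x * (t * (x * y))))) ∧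
    (∀ x t₁ t₂ t₃ : E1, x * (t₃ * (t₂ * (x * (t₁ * x)))) =
      x * (t₃ * (x * (t₂ * (x * (t₁ * x)))))) ∧
    (∀ x t y s : E1, y * (s * (y * (x * (t * x)))) = y * (s * (x * (y * (t * x))))) ∧
    ∀ x y t s : E1, y * (s * (x * (t * (y * x)))) = y * (s * (x * (t * (x * y)))) := by
  refine ⟨⟨?_, ?_, ?_⟩, ?_, ?_, ?_⟩
  · rintro ⟨⟩ ⟨⟩ <;> rfl
  · rintro ⟨⟩ ⟨⟩ <;> rfl
  · rintro ⟨⟩ ⟨⟩ ⟨⟩ <;> rfl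
  · rintro ⟨⟩ ⟨⟩ ⟨⟩ ⟨⟩ <;> rfl
  · rintro ⟨⟩ ⟨⟩ ⟨⟩ ⟨⟩ <;> rfl
  · rintro ⟨⟩ ⟨⟩ ⟨⟩ ⟨⟩ <;> rfl

theorem varFE_mem_op_E1 : (varFE : MonoidVariety.{u}).Mem (ULift.{u} E1)ᵐᵒᵖ := by
  obtain ⟨⟨h1, h2, h3⟩, h4, h5, h6⟩ := E1.laws
  exact mem_varFE.2 ⟨⟨
    fun x t => MulOpposite.unop_injective (ULift.down_injective (h1 x.unop.down t.unop.down)),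
    fun x y => MulOpposite.unop_injective (ULift.down_injective (h2 x.unop.down y.unop.down)),
    fun x y t => MulOpposite.unop_injective (ULift.down_injective
      (h3 x.unop.down y.unop.down t.unop.down)),
    fun x t₁ t₂ t₃ => MulOpposite.unop_injective (ULift.down_injective
      (h4 x.unop.down t₁.unop.down t₂.unop.down t₃.unop.down))⟩,
    fun x t y s => MulOpposite.unop_injective (ULift.down_injective
      (h5 x.unop.down t.unop.down y.unop.down s.unop.down)),
    fun x y t s => MulOpposite.unop_injective (ULift.down_injective
      (h6 x.unop.down y.unop.down t.unop.down s.unop.down))⟩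

theorem dual_varE_le_varFE : (varE.dual : MonoidVariety.{u}) ≤ varFE := by
  refine dual_le fun N _ hN => ?_
  have h : (varE : MonoidVariety.{u}) ≤ varFE.dual :=
    var_le ⟨(ULift.{u} E1)ᵐᵒᵖ, inferInstance, varFE_mem_op_E1, ⟨MulEquiv.opOp _⟩⟩
  obtain ⟨P, _, hP, ⟨e⟩⟩ := h N hN
  exact varFE.mem_of_equiv ((MulEquiv.opOp P).trans e.symm.op) hP

/-- Substitute `c` for the simple `t` and `e` for `x`. In the opposite of `E¹` an `e` on the left of
`c` is absorbed, while one on the right gives zero, so the value tells whether `x` occurs after `t`.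
-/
theorem sameL_of_holds_dual_varE {u w : List ℕ} (hF : SameF u w)
    (h : Holds (varE.dual : MonoidVariety.{u}) u w) : SameL u w := by
  let e : (ULift.{u} E1)ᵐᵒᵖ := MulOpposite.op ⟨E1.e⟩
  let c : (ULift.{u} E1)ᵐᵒᵖ := MulOpposite.op ⟨E1.c⟩
  let z : (ULift.{u} E1)ᵐᵒᵖ := MulOpposite.op ⟨E1.zero⟩
  have hval : ∀ (t x : ℕ), x ≠ t → ∀ v : List ℕ, v.count t = 1 →
      ev (fun n => if n = t then c else if n = x then e else 1) v =
        if x ∈ aft t v then z else c := by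
    intro t x hxt v hv
    set φ : ℕ → (ULift.{u} E1)ᵐᵒᵖ := fun n => if n = t then c else if n = x then e else 1 with hφ
    have h1 : ∀ l : List ℕ, t ∉ l → ev φ l = if x ∈ l then e else 1 := by
      intro l hl
      induction l with
      | nil => rfl
      | cons n l ih =>
        simp only [List.mem_cons, not_or] at hl
        rw [ev_cons, ih hl.2]
        have hnt : n ≠ t := fun k => hl.1 k.symm
        by_cases hn : n = x
        · subst hn
          simp only [hφ, hnt, if_false, if_true, List.mem_cons, true_or]
          split_ifs
          · rfl
          · rw [mul_one]
        · have hn' : x ≠ n := fun k => hn k.symm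
          simp only [hφ, hnt, hn, if_false, List.mem_cons, hn', false_or, one_mul]
    have ht : t ∈ v := List.count_pos_iff.1 (by omega)
    have hd := eq_bef_append_aft ht
    have hta : t ∉ aft t v := by
      intro k
      rw [hd, List.count_append, List.count_cons_self] at hv
      have := List.count_pos_iff.2 k
      omega
    conv_lhs => rw [hd]
    rw [ev_append, ev_cons, h1 _ (not_mem_bef t v), h1 _ hta]
    simp only [hφ, if_true]
    split_ifs <;> rfl
  have hcz : c ≠ z := by
    intro k
    have := congrArg (fun m => (MulOpposite.unop m).down) k
    exact absurd this (by rintro ⟨⟩)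
  intro t x
  rw [hF.count_eq_one t]
  refine and_congr_right fun ht => ?_
  have ht' := (hF.count_eq_one t).2 ht
  rcases eq_or_ne x t with rfl | hxt
  · have : ∀ v : List ℕ, v.count x = 1 → x ∉ aft x v := by
      intro v hv k
      have hd := eq_bef_append_aft (t := x) (u := v) (List.count_pos_iff.1 (by omega))
      rw [hd, List.count_append, List.count_cons_self] at hv
      have := List.count_pos_iff.2 k
      omega
    simp [this _ ht, this _ ht']
  have := h _ (mem_dual (mem_var E1)) fun n => if n = t then c else if n = x then e else 1
  rw [hval t x hxt u ht', hval t x hxt w ht] at this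
  split_ifs at this with h1 h2 h2
  · simp [h1, h2]
  · exact absurd this.symm hcz
  · exact absurd this hcz
  · simp [h1, h2]

/-- An identity of the join holds in both varieties; `𝔽` supplies `SameF` and the dual of `𝔼`
supplies `SameL`, which together characterise the identities of `varFE`. -/
theorem varF_sup_dual_varE : (varF ⊔ varE.dual : MonoidVariety.{u}) = varFE := by
  refine le_antisymm' (sup_le' varF_le_varFE dual_varE_le_varFE) (le_of_holds fun u w h => ?_)
  have hF := holds_varF_iff.1 (h.mono (le_sup_left' _ _))
  exact holds_varFE_iff.2 ⟨hF, sameL_of_holds_dual_varE hF (h.mono (le_sup_right' _ _))⟩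

/-! ## Generating monoids -/

section generators

variable {a b t s : ℕ}

theorem varF_eq (hat : a ≠ t) : (varF : MonoidVariety.{u}) = .var (MLam {cls [a, t, a]}) :=
  le_antisymm' (le_of_holds fun _ _ h => holds_varF_iff.2
    (sameF_of_sim_ata hat (sim_of_holds (le_refl' _) h))) (var_ata_le hat)

theorem varFE_eq (hat : a ≠ t) :
    (varFE : MonoidVariety.{u}) = .var (MLam {cls [a, t, a], cls [a, a, t]}) :=
  le_antisymm' (le_of_holds fun _ _ h => holds_varFE_iff.2
    (invE_of_sim_ata_aat hat (sim_of_holds (le_refl' _) h))) (var_ata_aat_le hat)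

theorem varFE_eq' (hat : a ≠ t) : (varFE : MonoidVariety.{u}) = .var (MLam {cls [a, a, t, a]}) :=
  le_antisymm' (le_of_holds fun _ _ h => holds_varFE_iff.2
    (invE_of_sim_aata hat (sim_of_holds (le_refl' _) h))) (var_aata_le hat)

theorem varH_eq (hab : a ≠ b) (hat : a ≠ t) (has : a ≠ s) (hbt : b ≠ t) (hbs : b ≠ s)
    (hts : t ≠ s) : (varH : MonoidVariety.{u}) = .var (MLam {cls [a, b, t, a, s, b]}) :=
  le_antisymm' (le_of_holds fun _ _ h => holds_varH_iff.2
    (invH_of_sim hab hat has hbt hbs hts (sim_of_holds (le_refl' _) h)))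
    (var_abta_le hab hat has hbt hbs hts)

theorem varI_eq (hab : a ≠ b) (hat : a ≠ t) (has : a ≠ s) (hbt : b ≠ t) (hbs : b ≠ s)
    (hts : t ≠ s) : (varI : MonoidVariety.{u}) = .var (MLam {cls [b, a, a, s, b]}) :=
  le_antisymm' (le_of_holds fun _ _ h => holds_varI_iff.2
    (invI_of_sim hab has hbs (sim_of_holds (le_refl' _) h)))
    (var_baas_le hab hat has hbt hbs hts)

theorem varJ_eq (hab : a ≠ b) (hat : a ≠ t) (has : a ≠ s) (hbt : b ≠ t) (hbs : b ≠ s)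
    (hts : t ≠ s) : (varJ : MonoidVariety.{u}) = .var (MLam {cls [a, t, b, a, s, b]}) :=
  le_antisymm' (le_of_holds fun _ _ h => holds_varJ_iff.2
    (invJ_of_sim hab hat has hbt hbs hts (sim_of_holds (le_refl' _) h)))
    (var_atba_le hab hat has hbt hbs hts)

end generators

/-! ## Subvarieties of `𝔹₀` -/

theorem ev_eq_pow {M : Type*} [Monoid M] {φ : ℕ → M} {x : ℕ} {l : List ℕ}
    (h : ∀ n ∈ l, n ≠ x → φ n = 1) : ev φ l = φ x ^ l.count x := by
  induction l with
  | nil => simp [ev]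
  | cons n l ih =>
    rw [ev_cons, ih fun m hm => h m (by simp [hm])]
    by_cases hn : n = x
    · subst hn
      rw [List.count_cons_self, pow_succ']
    · rw [h n (by simp) hn, one_mul, List.count_cons_of_ne hn]

theorem not_mem_aft {t : ℕ} {v : List ℕ} (h : v.count t = 1) : t ∉ aft t v := by
  intro k
  rw [eq_bef_append_aft (List.count_pos_iff.1 (by omega : 0 < v.count t)), List.count_append,
    List.count_cons_self] at h
  have := List.count_pos_iff.2 k
  omega

/-- The substitution of `X` for `x` and of `T` for `t`. -/
def eval₂ {M : Type*} [Monoid M] (x t : ℕ) (X T : M) (n : ℕ) : M :=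
  if n = t then T else if n = x then X else 1

theorem ev_eval₂ {M : Type*} [Monoid M] {x t : ℕ} (hxt : x ≠ t) (X T : M) {v : List ℕ}
    (hv : v.count t = 1) : ev (eval₂ x t X T) v =
      X ^ (bef t v).count x * T * X ^ (aft t v).count x := by
  have hx : eval₂ x t X T x = X := by simp [eval₂, hxt]
  have ht : eval₂ x t X T t = T := by simp [eval₂]
  have h1 : ∀ l : List ℕ, t ∉ l → ev (eval₂ x t X T) l = X ^ l.count x := by
    intro l hl
    rw [ev_eq_pow (x := x), hx]
    intro n hn hnx
    have hnt : n ≠ t := fun e => hl (e ▸ hn)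
    simp [eval₂, hnt, hnx]
  conv_lhs => rw [eq_bef_append_aft (List.count_pos_iff.1 (by omega : 0 < v.count t))]
  rw [ev_append, ev_cons, h1 _ (not_mem_bef t v), h1 _ (not_mem_aft hv), ht, mul_assoc]

/-- As `1`, `c` and `c² = 0` differ, powers of `c` separate the counts `0`, `1` and more. With `c`
for the simple `t`, the idempotent `f` for `x` gives zero exactly when `x` occurs before `t`, and
`e` exactly when it occurs after `t`. -/
theorem inv_of_B01 {u w : List ℕ} (h : ∀ φ : ℕ → B01, ev φ u = ev φ w) :
    (∀ x, (x ∈ u ↔ x ∈ w) ∧ (2 ≤ u.count x ↔ 2 ≤ w.count x)) ∧ ∀ t x, u.count t = 1 →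
      (x ∈ bef t u ↔ x ∈ bef t w) ∧ (x ∈ aft t u ↔ x ∈ aft t w) := by
  have hc : ∀ k, (B01.c ^ k = 1 ↔ k = 0) ∧ (B01.c ^ k = B01.c ↔ k = 1) := by
    have h2 : ∀ k, B01.c ^ (k + 2) = B01.zero := by
      intro k
      induction k with
      | zero => rfl
      | succ k ih => rw [pow_succ, ih]; rfl
    intro k
    rcases k with _ | _ | k
    · exact ⟨by simp, ⟨fun h => by rw [pow_zero] at h; exact absurd h (by rintro ⟨⟩), by simp⟩⟩
    · exact ⟨⟨fun h => by rw [zero_add, pow_one] at h; exact absurd h (by rintro ⟨⟩), by simp⟩,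
        by simp⟩
    · rw [h2]
      exact ⟨⟨fun h => absurd h (by rintro ⟨⟩), by simp⟩, ⟨fun h => absurd h (by rintro ⟨⟩),
        by simp⟩⟩
  have hcount : ∀ x, (u.count x = 0 ↔ w.count x = 0) ∧ (u.count x = 1 ↔ w.count x = 1) := by
    intro x
    have := h fun n => if n = x then B01.c else 1
    rw [ev_eq_pow (x := x) (by simp +contextual), ev_eq_pow (x := x) (by simp +contextual)] at this
    simp only [if_true] at this
    rw [← (hc (u.count x)).1, ← (hc (w.count x)).1, ← (hc (u.count x)).2, ← (hc (w.count x)).2, this]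
    exact ⟨Iff.rfl, Iff.rfl⟩
  refine ⟨fun x => ?_, fun t x ht => ?_⟩
  · have := hcount x
    rw [← List.count_pos_iff, ← List.count_pos_iff]
    omega
  have ht' := (hcount t).2.1 ht
  rcases eq_or_ne x t with rfl | hxt
  · simp [not_mem_bef, not_mem_aft ht, not_mem_aft ht']
  have idem : ∀ (g : B01) (k : ℕ), g * g = g → g ^ k = if 0 < k then g else 1 := by
    intro g k hg
    induction k with
    | zero => simp
    | succ k ih =>
      rw [pow_succ, ih]
      split_ifs <;> simp_all
  have h1 := h (eval₂ x t B01.f B01.c)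
  have h2 := h (eval₂ x t B01.e B01.c)
  rw [ev_eval₂ hxt _ _ ht, ev_eval₂ hxt _ _ ht', idem _ _ rfl, idem _ _ rfl, idem _ _ rfl,
    idem _ _ rfl] at h1 h2
  simp only [List.count_pos_iff] at h1 h2
  constructor
  · split_ifs at h1 with k1 k2 k3 k4 k2 k3 k4 <;> first
      | (simp only [*]; done)
      | exact absurd h1 (by rintro ⟨⟩)
  · split_ifs at h2 with k1 k2 k3 k4 k2 k3 k4 <;> first
      | (simp only [*]; done)
      | exact absurd h2 (by rintro ⟨⟩)

/-! ### Doubling the multiple letters -/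

/-- Double the letters from a set. -/
def dup (P : ℕ → Prop) [DecidablePred P] (v : List ℕ) : List ℕ :=
  v.flatMap fun n => if P n then [n, n] else [n]

section dup

variable {P : ℕ → Prop} [DecidablePred P]

theorem dup_append (u w : List ℕ) : dup P (u ++ w) = dup P u ++ dup P w := by simp [dup]

theorem dup_cons (n : ℕ) (u : List ℕ) :
    dup P (n :: u) = (if P n then [n, n] else [n]) ++ dup P u := by simp [dup]

theorem count_dup (v : List ℕ) (n : ℕ) :
    (dup P v).count n = if P n then 2 * v.count n else v.count n := by
  induction v with
  | nil => simp [dup]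
  | cons m v ih =>
    rw [dup_cons, List.count_append, ih]
    by_cases hmn : m = n
    · subst hmn
      by_cases hP : P m
      · simp only [hP, if_true, List.count_cons_self, List.count_nil]
        omega
      · simp only [hP, if_false, List.count_cons_self, List.count_nil]
        omega
    · rw [List.count_cons_of_ne hmn]
      by_cases hP : P m
      · simp [hP, hmn]
      · simp [hP, hmn]

theorem mem_dup {v : List ℕ} {n : ℕ} : n ∈ dup P v ↔ n ∈ v := by
  rw [← List.count_pos_iff, ← List.count_pos_iff, count_dup]
  split_ifs <;> omega

theorem bef_aft_dup {v : List ℕ} {t : ℕ} (ht : ¬ P t) (hv : t ∈ v) :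
    bef t (dup P v) = dup P (bef t v) ∧ aft t (dup P v) = dup P (aft t v) := by
  have e : dup P v = dup P (bef t v) ++ t :: dup P (aft t v) := by
    conv_lhs => rw [eq_bef_append_aft hv]
    rw [dup_append, dup_cons]
    simp [ht]
  have ht' : t ∉ dup P (bef t v) := fun k => not_mem_bef t v (mem_dup.1 k)
  rw [e]
  exact ⟨bef_append_cons ht' _, aft_append_cons ht' _⟩

theorem count_dup_eq_one {v : List ℕ} {t : ℕ} :
    (dup P v).count t = 1 ↔ v.count t = 1 ∧ ¬ P t := by
  rw [count_dup]
  split_ifs with h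
  · simp only [h, not_true_eq_false, and_false, iff_false]
    omega
  · simp [h]

end dup

/-- After doubling, every multiple letter occurs an even number of times before any simple letter.
Hence `Sep`, which needs exactly one occurrence, is impossible, and the position of second
occurrences carries no more information than that of first ones. -/
theorem invJ_dup {u w : List ℕ}
    (h1 : ∀ x, (x ∈ u ↔ x ∈ w) ∧ (2 ≤ u.count x ↔ 2 ≤ w.count x))
    (h2 : ∀ t x, u.count t = 1 → (x ∈ bef t u ↔ x ∈ bef t w) ∧ (x ∈ aft t u ↔ x ∈ aft t w)) :
    InvJ (dup (2 ≤ u.count ·) u) (dup (2 ≤ u.count ·) w) := by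
  have hone : ∀ t, u.count t = 1 ↔ w.count t = 1 := by
    intro t
    have := h1 t
    rw [← List.count_pos_iff, ← List.count_pos_iff] at this
    omega
  have hle : ∀ (v : List ℕ) t x, v.count t = 1 → x ≠ t →
      v.count x = (bef t v).count x + (aft t v).count x := by
    intro v t x ht hxt
    conv_lhs => rw [eq_bef_append_aft (List.count_pos_iff.1 (by omega : 0 < v.count t)),
      List.count_append, List.count_cons_of_ne hxt.symm]
  have hsimple : ∀ {v : List ℕ}, (∀ x, 2 ≤ u.count x ↔ 2 ≤ v.count x) → ∀ {t : ℕ},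
      ((dup (2 ≤ u.count ·) v).count t = 1 ↔ v.count t = 1) := by
    intro v hv t
    rw [count_dup_eq_one]
    have := hv t
    omega
  have hdup : ∀ {v : List ℕ}, (∀ x, 2 ≤ u.count x ↔ 2 ≤ v.count x) → ∀ {t : ℕ}, v.count t = 1 →
      bef t (dup (2 ≤ u.count ·) v) = dup (2 ≤ u.count ·) (bef t v) ∧
      aft t (dup (2 ≤ u.count ·) v) = dup (2 ≤ u.count ·) (aft t v) := by
    intro v hv t ht
    refine bef_aft_dup ?_ (List.count_pos_iff.1 (by omega))
    rw [hv]
    omega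
  have hu : ∀ x, 2 ≤ u.count x ↔ 2 ≤ u.count x := fun _ => Iff.rfl
  have hw : ∀ x, 2 ≤ u.count x ↔ 2 ≤ w.count x := fun x => (h1 x).2
  have htwo : ∀ {v : List ℕ}, (∀ x, 2 ≤ u.count x ↔ 2 ≤ v.count x) → ∀ {t x : ℕ}, v.count t = 1 →
      (2 ≤ (dup (2 ≤ u.count ·) (bef t v)).count x ↔ 2 ≤ u.count x ∧ x ∈ bef t v) := by
    intro v hv t x ht
    rcases eq_or_ne x t with rfl | hxt
    · simp [count_dup, not_mem_bef, List.count_eq_zero.2 (not_mem_bef x v)]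
    have := hle v t x ht hxt
    have := hv x
    rw [count_dup, ← List.count_pos_iff]
    split_ifs <;> omega
  have hsep : ∀ {v : List ℕ}, (∀ x, 2 ≤ u.count x ↔ 2 ≤ v.count x) → ∀ {x y s : ℕ},
      ¬ Sep x y s (dup (2 ≤ u.count ·) v) := by
    rintro v hv x y s ⟨k1, k2, k3, k4, k5⟩
    rw [hsimple hv] at k1
    rw [(hdup hv k1).1, count_dup_eq_one, hv] at k4
    rw [(hdup hv k1).2, mem_dup, ← List.count_pos_iff] at k5
    rcases eq_or_ne y s with rfl | hys
    · rw [List.count_eq_zero.2 (not_mem_bef y v)] at k4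
      omega
    have := hle v s y k1 hys
    omega
  have hF : SameF (dup (2 ≤ u.count ·) u) (dup (2 ≤ u.count ·) w) := by
    refine ⟨fun x => ?_, fun x => ?_, fun t x => ?_, fun t x => ?_⟩
    · rw [mem_dup, mem_dup, (h1 x).1]
    · rw [count_dup, count_dup]
      have := (h1 x).2
      split_ifs <;> omega
    · rw [hsimple hu, hsimple hw, ← hone t]
      refine and_congr_right fun ht => ?_
      rw [(hdup hu ht).1, (hdup hw ((hone t).1 ht)).1, mem_dup, mem_dup, (h2 t x ht).1]
    · rw [hsimple hu, hsimple hw, ← hone t]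
      refine and_congr_right fun ht => ?_
      rw [(hdup hu ht).1, (hdup hw ((hone t).1 ht)).1, htwo hu ht, htwo hw ((hone t).1 ht),
        (h2 t x ht).1]
  have hL : SameL (dup (2 ≤ u.count ·) u) (dup (2 ≤ u.count ·) w) := by
    intro t x
    rw [hsimple hu, hsimple hw, ← hone t]
    refine and_congr_right fun ht => ?_
    rw [(hdup hu ht).2, (hdup hw ((hone t).1 ht)).2, mem_dup, mem_dup, (h2 t x ht).2]
  exact ⟨⟨⟨hF, hL⟩, fun x y s => ⟨fun k => absurd k.1 (hsep hu), fun k => absurd k.1 (hsep hw)⟩⟩,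
    fun x y t s => ⟨fun k => absurd k.1 (hsep hu), fun k => absurd k.1 (hsep hw)⟩⟩

/-- `xtx ≈ x²tx` doubles a first occurrence that is not the last, and `dbl` doubles the later ones.
-/
theorem holds_dup {V : MonoidVariety.{u}} (hV : V ≤ varJ)
    (hD : ∀ (M : Type u) [Monoid M], V.Mem M → ∀ x t : M, x * t * x = x ^ 2 * t * x)
    {P : ℕ → Prop} [DecidablePred P] :
    ∀ {q p : List ℕ}, (∀ n ∈ q, P n → 2 ≤ (p ++ q).count n) → Holds V (p ++ q) (p ++ dup P q) := by
  have hT := wordTheory_of_le hV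
  intro q
  induction q with
  | nil => intro p _; exact hT.refl _
  | cons n q ih =>
    intro p h
    rw [dup_cons]
    by_cases hn : P n
    · rw [if_pos hn]
      have h1 : Holds V (p ++ n :: q) (p ++ n :: n :: q) := by
        by_cases hp : n ∈ p
        · exact hT.dbl hp
        have h2 := h n (by simp) hn
        rw [List.count_append, List.count_cons_self, List.count_eq_zero.2 hp] at h2
        obtain ⟨q₁, q₂, rfl⟩ := List.append_of_mem (List.count_pos_iff.1 (by omega : 0 < q.count n))
        intro M _ hM φ
        have := congrArg (fun m => ev φ p * m * ev φ q₂) (hD M hM (φ n) (ev φ q₁))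
        simpa only [ev_append, ev_cons, pow_two, mul_assoc] using this
      have h3 := ih (p := p ++ [n, n]) fun m hm hP => by
        have := h m (by simp [hm]) hP
        simp only [List.count_append, List.count_cons, List.count_nil] at this ⊢
        omega
      refine hT.trans h1 ?_
      simpa using h3
    · rw [if_neg hn]
      have h3 := ih (p := p ++ [n]) fun m hm hP => by
        have := h m (by simp [hm]) hP
        simpa using this
      simpa using h3

/-- Given an identity of `𝔹₀`, double the multiple letters on both sides. The result satisfies the
invariants of `𝕁`, hence holds in `V`, and the doubling can be undone in `V`. -/
theorem le_varB0 {V : MonoidVariety.{u}} (hV : V ≤ varJ)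
    (hD : ∀ (M : Type u) [Monoid M], V.Mem M → ∀ x t : M, x * t * x = x ^ 2 * t * x) :
    V ≤ varB0 := by
  have hT := wordTheory_of_le hV
  refine le_of_holds fun u w h => ?_
  obtain ⟨h1, h2⟩ := inv_of_B01 (holds_var_iff.1 h)
  have hJ := (holds_varJ_iff.2 (invJ_dup h1 h2)).mono hV
  refine hT.trans (holds_dup hV hD (p := []) (P := (2 ≤ u.count ·)) fun n _ hn => hn)
    (hT.trans hJ (hT.symm (holds_dup hV hD (p := []) fun n _ hn => (h1 n).2.1 hn)))

/-- `B₀¹` satisfies `xtx ≈ x²tx`, which moves the second `x` to the other side of the simple `t` and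
so violates `SameF`. -/
theorem not_varF_le_varB0 : ¬ (varF : MonoidVariety.{u}) ≤ varB0 := by
  intro h
  have h1 : Holds (varB0 : MonoidVariety.{u}) [0, 1, 0] [0, 0, 1, 0] := by
    refine holds_var_iff.2 fun φ => ?_
    have : ∀ x t : B01, x * (t * (x * 1)) = x * (x * (t * (x * 1))) := by
      rintro ⟨⟩ ⟨⟩ <;> rfl
    exact this _ _
  have := (sameF_of_holds (h1.mono h)).bef_two 1 0
  simp [bef] at this

/-! ## Consequences of an identity that violates an invariant -/

namespace PhiLaws

variable {M : Type*} [Monoid M]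

theorem sq_eq_cube (h : PhiLaws M) (x : M) : x ^ 2 = x ^ 3 := by
  have := h.xtx x 1
  simpa [pow_two, pow_three, mul_assoc] using this

theorem pow_add_two (h : PhiLaws M) (x : M) (k : ℕ) : x ^ (k + 2) = x ^ 2 := by
  induction k with
  | zero => rfl
  | succ k ih =>
    rw [show k + 1 + 2 = k + 2 + 1 by omega, pow_succ, ih, ← pow_succ, ← h.sq_eq_cube]

theorem mul_pow (h : PhiLaws M) (x t : M) {k : ℕ} (hk : 1 ≤ k) : x * t * x ^ k = x * t * x := by
  match k with
  | 1 => rw [pow_one]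
  | k + 2 => rw [h.pow_add_two, ← h.xtx]

theorem pow_mul_pow (h : PhiLaws M) (x t : M) {i k : ℕ} (hi : 1 ≤ i) (hk : 1 ≤ k) :
    x ^ i * t * x ^ k = x ^ i * t * x := by
  obtain ⟨i, rfl⟩ : ∃ j, i = j + 1 := ⟨i - 1, by omega⟩
  have := congrArg (x ^ i * ·) (h.mul_pow x t hk)
  simpa only [pow_succ, mul_assoc] using this

theorem pow_eq_sq (h : PhiLaws M) (x : M) {k : ℕ} (hk : 2 ≤ k) : x ^ k = x ^ 2 := by
  obtain ⟨k, rfl⟩ : ∃ j, k = j + 2 := ⟨k - 2, by omega⟩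
  exact h.pow_add_two x k

end PhiLaws

/-- The elements `1`, `X` and `X²` are distinct, since otherwise `XTX = X²TX`. Substituting `X` for
a letter, and `T` for a simple one, therefore tells numbers of occurrences apart. -/
theorem sameF_of_not {V : MonoidVariety.{u}} (hV : V ≤ varJ) {M : Type u} [Monoid M] (hM : V.Mem M)
    {X T : M} (hXT : X * T * X ≠ X ^ 2 * T * X) {u w : List ℕ} (h : Holds V u w) : SameF u w := by
  have hP := (mem_varJ.1 (hV M hM)).1
  have h12 : ∀ k, X ^ (k + 2) ≠ X := fun k e => hXT (by
    rw [hP.pow_add_two] at e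
    rw [e])
  have h01 : ∀ k, X ^ (k + 1) ≠ 1 := by
    intro k e
    match k with
    | 0 => exact hXT (by rw [zero_add, pow_one] at e; simp [e])
    | k + 1 =>
      rw [show k + 1 + 1 = k + 2 by omega, hP.pow_add_two] at e
      have e' : X ^ 2 * X = X ^ 2 := by rw [← pow_succ, ← hP.sq_eq_cube]
      rw [e, one_mul] at e'
      exact h12 0 (by rw [zero_add, e, e'])
  have hpow : ∀ {i k : ℕ}, X ^ i = X ^ k → (i = 0 ↔ k = 0) ∧ (i = 1 ↔ k = 1) := by
    intro i k e
    rcases i with _ | _ | i <;> rcases k with _ | _ | k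
    · simp
    · exact absurd (e.symm.trans (pow_zero X)) (h01 0)
    · exact absurd (e.symm.trans (pow_zero X)) (h01 _)
    · exact absurd (e.trans (pow_zero X)) (h01 0)
    · simp
    · exact absurd (e.symm.trans (pow_one X)) (h12 _)
    · exact absurd (e.trans (pow_zero X)) (h01 _)
    · exact absurd (e.trans (pow_one X)) (h12 _)
    · simp
  have hcount : ∀ x, (u.count x = 0 ↔ w.count x = 0) ∧ (u.count x = 1 ↔ w.count x = 1) := by
    intro x
    have := h M hM fun n => if n = x then X else 1
    rw [ev_eq_pow (x := x) (by simp +contextual), ev_eq_pow (x := x) (by simp +contextual)] at this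
    simp only [if_true] at this
    exact hpow this
  -- Multiplying by `X` on the right, and in the first case also on the left, makes the exponents
  -- positive; they then collapse to give `XTX = X²TX`.
  have hpos : ∀ {i j k l : ℕ}, X ^ i * T * X ^ j = X ^ k * T * X ^ l →
      (i = 0 → k = 0) ∧ ¬ (i = 1 ∧ 2 ≤ k) := by
    intro i j k l e
    constructor
    · rintro rfl
      by_contra hk
      have e1 := congrArg (fun m => X * m * X) e
      have e2 := hP.pow_mul_pow X T (i := 1) (k := j + 1) (by omega) (by omega)
      have e3 := hP.pow_mul_pow X T (i := k + 1) (k := l + 1) (by omega) (by omega)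
      have e4 := hP.pow_eq_sq X (k := k + 1) (by omega)
      refine hXT ?_
      calc X * T * X = X ^ 1 * T * X ^ (j + 1) := by rw [e2, pow_one]
        _ = X * (X ^ 0 * T * X ^ j) * X := by simp only [pow_succ, pow_zero, mul_assoc, one_mul]
        _ = X * (X ^ k * T * X ^ l) * X := e1
        _ = X ^ (k + 1) * T * X ^ (l + 1) := by
          rw [pow_succ' X k, pow_succ X l]
          simp only [mul_assoc]
        _ = X ^ 2 * T * X := by rw [e3, e4]
    · rintro ⟨rfl, hk⟩
      have e1 := congrArg (fun m => m * X) e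
      have e2 := hP.pow_mul_pow X T (i := 1) (k := j + 1) (by omega) (by omega)
      have e3 := hP.pow_mul_pow X T (i := k) (k := l + 1) (by omega) (by omega)
      have e4 := hP.pow_eq_sq X hk
      refine hXT ?_
      calc X * T * X = X ^ 1 * T * X ^ (j + 1) := by rw [e2, pow_one]
        _ = X ^ 1 * T * X ^ j * X := by simp only [pow_succ, mul_assoc]
        _ = X ^ k * T * X ^ l * X := e1
        _ = X ^ k * T * X ^ (l + 1) := by simp only [pow_succ, mul_assoc]
        _ = X ^ 2 * T * X := by rw [e3, e4]
  have hbef : ∀ t x, u.count t = 1 → ((bef t u).count x = 0 ↔ (bef t w).count x = 0) ∧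
      (2 ≤ (bef t u).count x ↔ 2 ≤ (bef t w).count x) := by
    intro t x ht
    have ht' := (hcount t).2.1 ht
    rcases eq_or_ne x t with rfl | hxt
    · simp [List.count_eq_zero.2 (not_mem_bef x _)]
    have e := h M hM (eval₂ x t X T)
    rw [ev_eval₂ hxt _ _ ht, ev_eval₂ hxt _ _ ht'] at e
    have e1 := hpos e
    have e2 := hpos e.symm
    omega
  refine ⟨fun x => ?_, fun x => ?_, fun t x => ?_, fun t x => ?_⟩
  · rw [← List.count_pos_iff, ← List.count_pos_iff]
    have := hcount x
    omega
  · have := hcount x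
    omega
  · rw [(hcount t).2]
    refine and_congr_right fun ht => ?_
    have := hbef t x ((hcount t).2.2 ht)
    rw [← List.count_pos_iff, ← List.count_pos_iff]
    omega
  · rw [(hcount t).2]
    exact and_congr_right fun ht => (hbef t x ((hcount t).2.2 ht)).2

/-- Multiplying by `X²` on the left levels the exponents before `T`, so that only the presence of an
`X` after `T` matters. -/
theorem sameL_of_not {V : MonoidVariety.{u}} (hV : V ≤ varJ) {M : Type u} [Monoid M] (hM : V.Mem M)
    {X T : M} (hXT : X ^ 2 * T ≠ X ^ 2 * T * X) {u w : List ℕ} (h : Holds V u w)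
    (hF : SameF u w) : SameL u w := by
  have hP := (mem_varJ.1 (hV M hM)).1
  have hpos : ∀ {i j k l : ℕ}, X ^ i * T * X ^ j = X ^ k * T * X ^ l → j = 0 → l = 0 := by
    rintro i j k l e rfl
    by_contra hl
    have e1 := congrArg (fun m => X ^ 2 * m) e
    have e2 := hP.pow_add_two X i
    have e3 := hP.pow_add_two X k
    have e4 := hP.pow_mul_pow X T (i := k + 2) (k := l) (by omega) (by omega)
    refine hXT ?_
    calc X ^ 2 * T = X ^ (i + 2) * T := by rw [e2]
      _ = X ^ 2 * (X ^ i * T * X ^ 0) := by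
        rw [add_comm, pow_add, pow_zero, mul_one, mul_assoc]
      _ = X ^ 2 * (X ^ k * T * X ^ l) := e1
      _ = X ^ (k + 2) * T * X ^ l := by
        rw [add_comm, pow_add]
        simp only [mul_assoc]
      _ = X ^ 2 * T * X := by rw [e4, e3]
  intro t x
  rw [hF.count_eq_one t]
  refine and_congr_right fun ht' => ?_
  have ht := (hF.count_eq_one t).2 ht'
  rcases eq_or_ne x t with rfl | hxt
  · simp [not_mem_aft ht, not_mem_aft ht']
  have e := h M hM (eval₂ x t X T)
  rw [ev_eval₂ hxt _ _ ht, ev_eval₂ hxt _ _ ht'] at e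
  have e1 := hpos e
  have e2 := hpos e.symm
  rw [← List.count_pos_iff, ← List.count_pos_iff]
  omega

/-- The substitution of four elements for four letters. -/
def eval₄ {M : Type*} [Monoid M] (x y t s : ℕ) (X Y T S : M) (n : ℕ) : M :=
  if n = x then X else if n = y then Y else if n = t then T else if n = s then S else 1

section eval

variable {M : Type*} [Monoid M] {u : List ℕ} {x y t s : ℕ} (X Y T S : M)

theorem ev_eq_of_count_one {φ : ℕ → M} {l : List ℕ} (hl : ∀ n ∈ l, n ≠ x → n ≠ y →
    φ n = 1) (hy : l.count y = 1) :
    ev φ l = φ x ^ (bef y l).count x * φ y * φ x ^ (aft y l).count x := by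
  have hd := eq_bef_append_aft (List.count_pos_iff.1 (by omega : 0 < l.count y))
  have h1 : ∀ n ∈ bef y l, n ≠ x → φ n = 1 := fun n hn hnx => hl n (by rw [hd]; simp [hn]) hnx
    fun e => not_mem_bef y l (e ▸ hn)
  have h2 : ∀ n ∈ aft y l, n ≠ x → φ n = 1 := fun n hn hnx => hl n (by rw [hd]; simp [hn]) hnx
    fun e => not_mem_aft hy (e ▸ hn)
  conv_lhs => rw [hd]
  rw [ev_append, ev_cons, ev_eq_pow h1, ev_eq_pow h2, mul_assoc]

theorem Sep.ev_eq (h : Sep x y s u) : ∃ i j, 2 ≤ (bef y u).count x + i ∧ 1 ≤ j ∧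
    ev (eval₄ x y s s X Y S S) u = X ^ (bef y u).count x * Y * X ^ i * S * Y ^ j := by
  obtain ⟨hxy, hxs, hys⟩ := h.ne
  have hm := h.2.1
  obtain ⟨p, q, rfl, hsp, hsq, hxq, hxp, hyp, hyq⟩ := h.decomp
  set φ := eval₄ x y s s X Y S S
  have px : φ x = X := by simp [φ, eval₄]
  have py : φ y = Y := by simp [φ, eval₄, hxy.symm]
  have ps : φ s = S := by simp [φ, eval₄, hxs.symm, hys.symm]
  have pn : ∀ n, n ≠ x → n ≠ y → n ≠ s → φ n = 1 := fun n h1 h2 h3 => by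
    simp [φ, eval₄, h1, h2, h3]
  have hy : y ∈ p := List.count_pos_iff.1 (by omega)
  have e1 := ev_eq_of_count_one (φ := φ) (x := x) (l := p) (fun n hn h1 h2 => pn n h1 h2
    (by rintro rfl; exact hsp hn)) hyp
  have e2 : ev φ q = Y ^ q.count y := by
    rw [ev_eq_pow (x := y), py]
    exact fun n hn hny => pn n (by rintro rfl; exact hxq hn) hny (by rintro rfl; exact hsq hn)
  rw [bef_append_of_mem hy]
  refine ⟨(aft y p).count x, q.count y, ?_, hyq, ?_⟩
  · rw [← hxp, eq_bef_append_aft hy, List.count_append, List.count_cons_of_ne hxy.symm] at hm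
    exact hm
  · rw [ev_append, ev_cons, e1, e2, px, py, ps]
    simp only [mul_assoc]

/-- The value of the word is cut at the simple letters `t` and `s`. The same decomposition serves
patterns H and J, which differ in whether the one `y` before `s` lies in `p₁` or in `p₂`. -/
theorem Sep.ev_eq_of_simple (h : Sep x y s u) (ht : u.count t = 1)
    (hx : (bef t u).count x = 1) : ∃ p₁ p₂ j, bef t u = p₁ ∧ bef y u = bef y (p₁ ++ t :: p₂) ∧
      t ≠ y ∧ t ≠ x ∧ t ∉ p₁ ∧ t ∉ p₂ ∧ (p₁ ++ t :: p₂).count y = 1 ∧ 1 ≤ p₂.count x ∧ 1 ≤ j ∧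
      (∀ n, n ∈ p₁ ∨ n ∈ p₂ → n ≠ x → n ≠ y → eval₄ x y t s X Y T S n = 1) ∧
      ev (eval₄ x y t s X Y T S) u = ev (eval₄ x y t s X Y T S) p₁ * T *
        ev (eval₄ x y t s X Y T S) p₂ * S * Y ^ j := by
  obtain ⟨hxy, hxs, hys⟩ := h.ne
  have hS := h
  have hm := h.2.1
  obtain ⟨p, q, rfl, hsp, hsq, hxq, hxp, hyp, hyq⟩ := h.decomp
  obtain ⟨p₁, p₂, rfl, hp1, hp2, htq, hts, htx, hb⟩ := before_sep hS hsp hxp ht hx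
  have hty : t ≠ y := by
    rintro rfl
    exact htq (List.count_pos_iff.1 hyq)
  set φ := eval₄ x y t s X Y T S
  have py : φ y = Y := by simp [φ, eval₄, hxy.symm]
  have pt : φ t = T := by simp [φ, eval₄, htx, hty]
  have ps : φ s = S := by simp [φ, eval₄, hxs.symm, hys.symm, hts.symm]
  have pn : ∀ n, n ≠ x → n ≠ y → n ≠ t → n ≠ s → φ n = 1 := fun n h1 h2 h3 h4 => by
    simp [φ, eval₄, h1, h2, h3, h4]
  have e2 : ev φ q = Y ^ q.count y := by
    rw [ev_eq_pow (x := y), py]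
    exact fun n hn hny => pn n (by rintro rfl; exact hxq hn) hny (by rintro rfl; exact htq hn)
      (by rintro rfl; exact hsq hn)
  refine ⟨p₁, p₂, q.count y, hb, bef_append_of_mem (List.count_pos_iff.1 (by omega)) _, hty, htx,
    hp1, hp2, hyp, ?_, hyq, ?_, ?_⟩
  · rw [hb] at hx
    rw [← hxp, List.count_append, List.count_cons_of_ne htx] at hm
    omega
  · intro n hn h1 h2
    refine pn n h1 h2 ?_ ?_
    · rintro rfl
      exact hn.elim hp1 hp2
    · rintro rfl
      exact hsp (by simp [hn.elim Or.inl fun h => Or.inr (Or.inr h)])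
  · rw [ev_append, ev_append, ev_cons, ev_cons, e2, pt, ps]
    simp only [mul_assoc]

end eval

section violations

variable {V : MonoidVariety.{u}} {u w : List ℕ}

/-- By the common invariants both sides have one `x` and one `y` before `t`, and they differ only in
the order of these two. After collapsing powers of nonfirst occurrences the two values are the sides
of the law. -/
theorem eLaw_of_not_sameH (hV : V ≤ varJ) (h : Holds V u w) (hE : InvE u w) (hH : ¬ SameH u w) :
    ∀ (M : Type u) [Monoid M], V.Mem M → ELaw M := by
  have key : ∀ {u w : List ℕ}, Holds V u w → InvE u w → ∀ x y t s, PatH x y t s u →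
      ¬ PatH x y t s w → ∀ (M : Type u) [Monoid M], V.Mem M → ELaw M := by
    rintro u w h hE x y t s ⟨hS, ht, hxt, hyt, hyx⟩ hw M _ hM X Y T S
    have hP := (mem_varJ.1 (hV M hM)).1
    have hS' := hE.1.sep hE.2 hS
    have ht' := (hE.1.count_eq_one t).1 ht
    have hxt' := (hE.1.bef_count_eq_one ht x).1 hxt
    have hyt' := (hE.1.mem_bef ht y).1 hyt
    have hyx' : y ∈ bef x w := by
      by_contra hyx'
      exact hw ⟨hS', ht', hxt', hyt', hyx'⟩
    have hxy := hS.ne.1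
    have px : eval₄ x y t s X Y T S x = X := by simp [eval₄]
    have py : eval₄ x y t s X Y T S y = Y := by simp [eval₄, hxy.symm]
    have general : ∀ {v : List ℕ}, Sep x y s v → v.count t = 1 → (bef t v).count x = 1 →
        y ∈ bef t v → ∃ k j, 1 ≤ k ∧ 1 ≤ j ∧ ev (eval₄ x y t s X Y T S) v =
          Y ^ (bef x v).count y * X * Y ^ (aft x (bef t v)).count y * T * X ^ k * S * Y ^ j ∧
          (bef x v).count y + (aft x (bef t v)).count y = 1 := by
      intro v hS ht hx hy
      obtain ⟨p₁, p₂, j, hb, hb', hty, htx, -, -, hc, hk, hj, hn, e⟩ :=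
        hS.ev_eq_of_simple X Y T S ht hx
      rw [hb] at hx hy
      have hc1 : p₁.count y = 1 ∧ p₂.count y = 0 := by
        have := List.count_pos_iff.2 hy
        rw [List.count_append, List.count_cons_of_ne hty] at hc
        omega
      have hxp : x ∈ p₁ := List.count_pos_iff.1 (by omega)
      have hbx : bef x v = bef x p₁ := by
        rw [eq_bef_append_aft (List.count_pos_iff.1 (by omega : 0 < v.count t)), hb,
          bef_append_of_mem hxp]
      have e1 := ev_eq_of_count_one (φ := eval₄ x y t s X Y T S) (x := y) (l := p₁)
        (fun n hn' h1 h2 => hn n (Or.inl hn') h2 h1) hx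
      have e2 : ev (eval₄ x y t s X Y T S) p₂ = X ^ p₂.count x := by
        rw [ev_eq_pow (x := x), px]
        exact fun n hn' h1 => hn n (Or.inr hn') h1 fun k => by
          subst k
          have := List.count_pos_iff.2 hn'
          omega
      refine ⟨p₂.count x, j, hk, hj, ?_, ?_⟩
      · rw [e, e1, e2, px, py, hb, hbx]
      · rw [hb, hbx]
        conv_rhs => rw [← hc1.1, eq_bef_append_aft hxp, List.count_append,
          List.count_cons_of_ne hxy]
    obtain ⟨k, j, hk, hj, e1, c1⟩ := general hS ht hxt hyt
    obtain ⟨k', j', hk', hj', e2, c2⟩ := general hS' ht' hxt' hyt'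
    have e := h M hM (eval₄ x y t s X Y T S)
    have n1 : (bef x u).count y = 0 := List.count_eq_zero.2 hyx
    have n2 : (bef x w).count y = 1 := by
      have := List.count_pos_iff.2 hyx'
      omega
    rw [e1, e2, n1, n2, show (aft x (bef t u)).count y = 1 by omega,
      show (aft x (bef t w)).count y = 0 by omega] at e
    simp only [pow_zero, pow_one, one_mul, mul_one] at e
    have f1 : ∀ (A B C : M) (k j : ℕ), 1 ≤ k → 1 ≤ j → (A * B * C * T * A ^ k * S * C ^ j =
        A * B * C * T * A * S * C) := by
      intro A B C k j hk hj
      have g1 := hP.mul_pow A (B * C * T) hk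
      have g2 := hP.mul_pow C (T * A * S) hj
      calc A * B * C * T * A ^ k * S * C ^ j = A * (B * C * T) * A ^ k * S * C ^ j := by
            simp only [mul_assoc]
        _ = A * (B * C * T) * A * S * C ^ j := by rw [g1]
        _ = A * B * (C * (T * A * S) * C ^ j) := by simp only [mul_assoc]
        _ = _ := by rw [g2]; simp only [mul_assoc]
    have f2 : ∀ (A C : M) (k j : ℕ), 1 ≤ k → 1 ≤ j → (C * A * T * A ^ k * S * C ^ j =
        C * A * T * A * S * C) := by
      intro A C k j hk hj
      have g1 := hP.mul_pow A T hk
      have g2 := hP.mul_pow C (A * T * A * S) hj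
      calc C * A * T * A ^ k * S * C ^ j = C * (A * T * A ^ k) * S * C ^ j := by
            simp only [mul_assoc]
        _ = C * (A * T * A) * S * C ^ j := by rw [g1]
        _ = C * (A * T * A * S) * C ^ j := by simp only [mul_assoc]
        _ = _ := by rw [g2]; simp only [mul_assoc]
    have f3 := f1 X 1 Y k j hk hj
    simp only [mul_one] at f3
    rw [f3, f2 X Y k' j' hk' hj'] at e
    exact e
  simp only [SameH, not_forall] at hH
  obtain ⟨x, y, t, s, hH⟩ := hH
  by_cases hu : PatH x y t s u
  · exact key h hE x y t s hu fun hw => hH ⟨fun _ => hw, fun _ => hu⟩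
  · refine key ((wordTheory_of_le hV).symm h) hE.symm x y t s ?_ hu
    by_contra hw
    exact hH ⟨fun k => absurd k hu, fun k => absurd k hw⟩

theorem WLaw.merge_one {M : Type*} [Monoid M] (h : WLaw M) (x y t : M) :
    x ^ 2 * y * t * y = x * y * x * t * y := by
  have := h 1 1 x (fun _ => y) fun _ => t
  simpa [mul_assoc] using this.symm

/-- The side with the pattern evaluates to `YX²SY`; on the other side at least one `X` stands before
`Y`, and that value reduces to `X²YSY`. -/
theorem hLaw_of_not_sameI (hV : V ≤ varJ) (h : Holds V u w) (hE : InvE u w) (hI : ¬ SameI u w) :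
    ∀ (M : Type u) [Monoid M], V.Mem M → HLaw M := by
  have key : ∀ {u w : List ℕ}, Holds V u w → InvE u w → ∀ x y s, PatI x y s u →
      ¬ PatI x y s w → ∀ (M : Type u) [Monoid M], V.Mem M → HLaw M := by
    rintro u w h hE x y s ⟨hS, hxy⟩ hw M _ hM X Y S
    have hP := (mem_varJ.1 (hV M hM)).1
    have hW := (mem_varJ.1 (hV M hM)).2
    have hS' := hE.1.sep hE.2 hS
    have hxy' : 0 < (bef y w).count x := by
      rw [List.count_pos_iff]
      by_contra hxy'
      exact hw ⟨hS', hxy'⟩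
    obtain ⟨i, j, hi, hj, e1⟩ := hS.ev_eq X Y S
    obtain ⟨i', j', hi', hj', e2⟩ := hS'.ev_eq X Y S
    have e := h M hM (eval₄ x y s s X Y S S)
    rw [List.count_eq_zero.2 hxy] at e1 hi
    generalize (bef y w).count x = k at *
    rw [e1, e2, pow_zero, one_mul, hP.pow_eq_sq X (by omega : 2 ≤ i)] at e
    have g1 := hP.mul_pow Y (X ^ 2 * S) hj
    have g2 := hP.mul_pow Y (X ^ i' * S) hj'
    have m := hW.merge_one X Y S
    have e3 : Y * X ^ 2 * S * Y = X ^ k * (Y * X ^ i' * S * Y) := by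
      calc Y * X ^ 2 * S * Y = Y * (X ^ 2 * S) * Y := by simp only [mul_assoc]
        _ = Y * X ^ 2 * S * Y ^ j := by rw [← g1]; simp only [mul_assoc]
        _ = X ^ k * (Y * (X ^ i' * S) * Y ^ j') := by rw [e]; simp only [mul_assoc]
        _ = _ := by rw [g2]; simp only [mul_assoc]
    rw [e3]
    -- If an `X` is left between `Y` and `S`, one of the preceding `X` turns the product into
    -- `X²YSY` by `WLaw.merge_one`; if none is left, there are at least two `X` before `Y` and
    -- nothing is to be moved.
    have step : ∀ n, X ^ (n + 1) * (Y * X ^ i' * S * Y) = X ^ n * (X ^ 2 * Y * S * Y) ∨ i' = 0 := by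
      intro n
      rcases i' with _ | i'
      · exact Or.inr rfl
      left
      have c1 : X * (Y * X ^ (i' + 1) * S * Y) = X ^ 2 * Y * S * Y := by
        calc X * (Y * X ^ (i' + 1) * S * Y) = X * Y * X ^ (i' + 1) * S * Y := by
              simp only [mul_assoc]
          _ = X * Y * X * S * Y := by rw [hP.mul_pow X Y (by omega)]
          _ = _ := m.symm
      rw [pow_succ, mul_assoc, c1]
    obtain ⟨n, rfl⟩ : ∃ n, k = n + 1 := ⟨k - 1, by omega⟩
    rcases step n with hs | rfl
    · rw [hs]
      calc X ^ 2 * Y * S * Y = X ^ (n + 2) * Y * S * Y := by rw [hP.pow_add_two X n]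
        _ = _ := by rw [pow_add]; simp only [mul_assoc]
    · rw [hP.pow_eq_sq X (by omega : 2 ≤ n + 1)]
      simp only [pow_zero, mul_one, mul_assoc]
  simp only [SameI, not_forall] at hI
  obtain ⟨x, y, s, hI⟩ := hI
  by_cases hu : PatI x y s u
  · exact key h hE x y s hu fun hw => hI ⟨fun _ => hw, fun _ => hu⟩
  · refine key ((wordTheory_of_le hV).symm h) hE.symm x y s ?_ hu
    by_contra hw
    exact hI ⟨fun k => absurd k hu, fun k => absurd k hw⟩

/-- The side with the pattern evaluates to `XTYXSY`; the other one has an `X` between `T` and `Y`,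
and reduces to `XTXYSY`. -/
theorem iLaw_of_not_sameJ (hV : V ≤ varJ) (h : Holds V u w) (hE : InvE u w) (hJ : ¬ SameJ u w) :
    ∀ (M : Type u) [Monoid M], V.Mem M → ILaw M := by
  have key : ∀ {u w : List ℕ}, Holds V u w → InvE u w → ∀ x y t s, PatJ x y t s u →
      ¬ PatJ x y t s w → ∀ (M : Type u) [Monoid M], V.Mem M → ILaw M := by
    rintro u w h hE x y t s ⟨hS, ht, hxt, hyt, hxy⟩ hw M _ hM X T Y S
    have hP := (mem_varJ.1 (hV M hM)).1
    have hW := (mem_varJ.1 (hV M hM)).2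
    have hS' := hE.1.sep hE.2 hS
    have ht' := (hE.1.count_eq_one t).1 ht
    have hxt' := (hE.1.bef_count_eq_one ht x).1 hxt
    have hyt' : y ∉ bef t w := fun k => hyt ((hE.1.mem_bef ht y).2 k)
    have hxy' : (bef y w).count x ≠ 1 := fun k => hw ⟨hS', ht', hxt', hyt', k⟩
    have hne := hS.ne.1
    have px : eval₄ x y t s X Y T S x = X := by simp [eval₄]
    have py : eval₄ x y t s X Y T S y = Y := by simp [eval₄, hne.symm]
    have general : ∀ {v : List ℕ}, Sep x y s v → v.count t = 1 → (bef t v).count x = 1 →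
        y ∉ bef t v → ∃ k l j, (bef y v).count x = k + 1 ∧ 1 ≤ k + l ∧ 1 ≤ j ∧
          ev (eval₄ x y t s X Y T S) v = X * T * X ^ k * Y * X ^ l * S * Y ^ j := by
      intro v hS ht hx hy
      obtain ⟨p₁, p₂, j, hb, hb', hty, htx, -, -, hc, hk, hj, hn, e⟩ :=
        hS.ev_eq_of_simple X Y T S ht hx
      rw [hb] at hx hy
      have hc1 : p₂.count y = 1 := by
        rw [List.count_append, List.count_cons_of_ne hty, List.count_eq_zero.2 hy] at hc
        omega
      have hyp : y ∈ p₂ := List.count_pos_iff.1 (by omega)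
      have e1 : ev (eval₄ x y t s X Y T S) p₁ = X := by
        rw [ev_eq_pow (x := x), px, hx, pow_one]
        exact fun n hn' h1 => hn n (Or.inl hn') h1 fun k => hy (k ▸ hn')
      have e2 := ev_eq_of_count_one (φ := eval₄ x y t s X Y T S) (x := x) (l := p₂)
        (fun n hn' h1 h2 => hn n (Or.inr hn') h1 h2) hc1
      refine ⟨(bef y p₂).count x, (aft y p₂).count x, j, ?_, ?_, hj, ?_⟩
      · rw [hb', show p₁ ++ t :: p₂ = (p₁ ++ [t]) ++ p₂ by simp,
          bef_append_of_not_mem (by simp [hy, hty.symm]), List.count_append, List.count_append, hx,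
          List.count_cons_of_ne htx, List.count_nil]
        omega
      · rw [eq_bef_append_aft hyp, List.count_append, List.count_cons_of_ne hne.symm] at hk
        exact hk
      · rw [e, e1, e2, px, py]
        simp only [mul_assoc]
    obtain ⟨k, l, j, c1, hkl, hj, e1⟩ := general hS ht hxt hyt
    obtain ⟨k', l', j', c2, hkl', hj', e2⟩ := general hS' ht' hxt' hyt'
    have e := h M hM (eval₄ x y t s X Y T S)
    obtain rfl : k = 0 := by omega
    rw [e1, e2, pow_zero, mul_one] at e
    have m := hW.merge_one X Y S
    have g1 := hP.mul_pow X (T * Y) (by omega : 1 ≤ l)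
    have g2 := hP.mul_pow Y (X * S) hj
    have g3 := hP.mul_pow X T (by omega : 1 ≤ k')
    have g4 := hP.mul_pow Y (X ^ l' * S) hj'
    have a1 : X * T * Y * X ^ l * S * Y ^ j = X * T * Y * X * S * Y := by
      calc X * T * Y * X ^ l * S * Y ^ j = X * (T * Y) * X ^ l * S * Y ^ j := by
            simp only [mul_assoc]
        _ = X * T * (Y * (X * S) * Y ^ j) := by rw [g1]; simp only [mul_assoc]
        _ = _ := by rw [g2]; simp only [mul_assoc]
    have a2 : X * T * X ^ k' * Y * X ^ l' * S * Y ^ j' = X * T * X * Y * X ^ l' * S * Y := by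
      calc X * T * X ^ k' * Y * X ^ l' * S * Y ^ j' =
          X * T * X * (Y * (X ^ l' * S) * Y ^ j') := by rw [g3]; simp only [mul_assoc]
        _ = _ := by rw [g4]; simp only [mul_assoc]
    rw [a1, a2] at e
    rw [e]
    rcases l' with _ | l'
    · rw [pow_zero, mul_one]
    · have g5 := hP.mul_pow X Y (by omega : 1 ≤ l' + 1)
      calc X * T * X * Y * S * Y = X * T * X ^ 2 * (Y * S * Y) := by
            rw [← hP.xtx]; simp only [mul_assoc]
        _ = X * T * (X ^ 2 * Y * S * Y) := by simp only [mul_assoc]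
        _ = X * T * (X * Y * X * S * Y) := by rw [m]
        _ = X * T * (X * Y * X ^ (l' + 1) * S * Y) := by rw [g5]
        _ = _ := by simp only [mul_assoc]
  simp only [SameJ, not_forall] at hJ
  obtain ⟨x, y, t, s, hJ⟩ := hJ
  by_cases hu : PatJ x y t s u
  · exact key h hE x y t s hu fun hw => hJ ⟨fun _ => hw, fun _ => hu⟩
  · refine key ((wordTheory_of_le hV).symm h) hE.symm x y t s ?_ hu
    by_contra hw
    exact hJ ⟨fun k => absurd k hu, fun k => absurd k hw⟩

end violations

/-- The subvarieties of `𝕁` that are not contained in `𝔹₀`. -/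
theorem eq_of_le_varJ {V : MonoidVariety.{u}} (hV : V ≤ varJ) (hB : ¬ V ≤ varB0) :
    V = varF ∨ V = varFE ∨ V = varH ∨ V = varI ∨ V = varJ := by
  -- A single identity violating `SameF` rules out every pair with `XTX ≠ X²TX` in every member of
  -- `V`, which would put `V` below `𝔹₀`. The argument for `SameL` below has the same form.
  have hF : ∀ u w, Holds V u w → SameF u w := by
    by_contra hF
    push Not at hF
    obtain ⟨u, w, h, hF⟩ := hF
    refine hB (le_varB0 hV fun M _ hM X T => ?_)
    by_contra hXT
    exact hF (sameF_of_not hV hM hXT h)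
  by_cases hL : ∀ u w, Holds V u w → SameL u w
  swap
  · left
    push Not at hL
    obtain ⟨u, w, h, hL⟩ := hL
    refine le_antisymm' (fun M _ hM => ?_) (le_of_holds fun u w h => holds_varF_iff.2 (hF u w h))
    have hP := (mem_varJ.1 (hV M hM)).1
    have hx : ∀ X T : M, X ^ 2 * T = X ^ 2 * T * X := by
      intro X T
      by_contra hXT
      exact hL (sameL_of_not hV hM hXT h (hF u w h))
    refine mem_varF.2 ⟨hP.sq_comm, hP.xytxy, fun X T S => ?_⟩
    calc X * T * X * S = X * T * (X ^ 2 * S) := by rw [hP.xtx]; simp only [mul_assoc]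
      _ = X * T * X ^ 2 * S * X := by rw [hx]; simp only [mul_assoc]
      _ = _ := by rw [← hP.xtx]
  have hE : ∀ u w, Holds V u w → InvE u w := fun u w h => ⟨hF u w h, hL u w h⟩
  right
  by_cases hH : ∀ u w, Holds V u w → SameH u w
  swap
  · left
    push Not at hH
    obtain ⟨u, w, h, hH⟩ := hH
    refine le_antisymm' (fun M _ hM => ?_) (le_of_holds fun u w h => holds_varFE_iff.2 (hE u w h))
    have hEL := eLaw_of_not_sameH hV h (hE u w h) hH M hM
    have hP := (mem_varJ.1 (hV M hM)).1
    -- With `t = 1` the new law exchanges `yx` and `xy` in front of `xsy`, and `WLaw.merge_one`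
    -- identifies `xyxsy` with `x²ysy`.
    have hHL : HLaw M := fun X Y T => by
      have e := hEL X Y 1 T
      rw [(mem_varJ.1 (hV M hM)).2.merge_one]
      simpa only [mul_one, pow_two, mul_assoc] using e
    exact mem_varFE.2 ⟨hP, hHL.iLaw hP, hEL⟩
  right
  by_cases hI : ∀ u w, Holds V u w → SameI u w
  swap
  · left
    push Not at hI
    obtain ⟨u, w, h, hI⟩ := hI
    refine le_antisymm' (fun M _ hM => ?_) (le_of_holds fun u w h =>
      holds_varH_iff.2 ⟨hE u w h, hH u w h⟩)
    exact mem_varH.2 ⟨(mem_varJ.1 (hV M hM)).1, hLaw_of_not_sameI hV h (hE u w h) hI M hM,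
      (mem_varJ.1 (hV M hM)).2.merge_one⟩
  right
  by_cases hJ : ∀ u w, Holds V u w → SameJ u w
  swap
  · left
    push Not at hJ
    obtain ⟨u, w, h, hJ⟩ := hJ
    refine le_antisymm' (fun M _ hM => ?_) (le_of_holds fun u w h =>
      holds_varI_iff.2 ⟨hE u w h, hI u w h⟩)
    exact mem_varI.2 ⟨(mem_varJ.1 (hV M hM)).1, iLaw_of_not_sameJ hV h (hE u w h) hJ M hM⟩
  right
  exact le_antisymm' hV (le_of_holds fun u w h =>
    holds_varJ_iff.2 ⟨⟨hE u w h, hI u w h⟩, hJ u w h⟩)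

/-! ## Cardinalities -/

theorem head_red (u : List ℕ) : (red u).head? = u.head? := by
  match u with
  | [] => rfl
  | [a] => rfl
  | a :: b :: l =>
    rw [red]
    split_ifs with h
    · rw [head_red (b :: l), h]
      rfl
    · rfl

theorem red_cons (c : ℕ) (u : List ℕ) :
    red (c :: u) = if u.head? = some c then red u else c :: red u := by
  cases u with
  | nil => simp [red]
  | cons d u => simp [red, eq_comm]

/-- `g` need not be injective. This matters since `encode` sends all letters other than `a`, `b`,
`t` to the same code. -/
theorem red_map_red (g : ℕ → ℕ) (u : List ℕ) : red ((red u).map g) = red (u.map g) := by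
  induction u with
  | nil => rfl
  | cons c u ih =>
    have hh : ((red u).map g).head? = (u.map g).head? := by simp [head_red]
    rw [red_cons, List.map_cons, red_cons (g c)]
    split_ifs with h1 h2 h2
    · exact ih
    · simp [h1] at h2
    · rw [List.map_cons, red_cons, hh, if_pos h2, ih]
    · rw [List.map_cons, red_cons, hh, if_neg h2, ih]

/-- An invariant of `λ`-classes. -/
def invariant (u : List ℕ) : List ℕ × ℕ × ℕ := (red u, min 2 (u.count 0), min 2 (u.count 1))

theorem count_map_of_iff {g : ℕ → ℕ} {a k : ℕ} (h : ∀ n, g n = k ↔ n = a) (u : List ℕ) :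
    (u.map g).count k = u.count a := by
  induction u with
  | nil => rfl
  | cons n u ih =>
    rw [List.map_cons, List.count_cons, List.count_cons, ih]
    simp only [beq_iff_eq, h]

theorem invariant_eq_of_cls {g : ℕ → ℕ} {a b : ℕ} (ha : ∀ n, g n = 0 ↔ n = a)
    (hb : ∀ n, g n = 1 ↔ n = b) {u w : List ℕ} (h : cls u = cls w) :
    invariant (u.map g) = invariant (w.map g) := by
  have hmin : ∀ c, min 2 (u.count c) = min 2 (w.count c) := by
    intro c
    have h1 := count_eq_zero_iff_of_cls h c
    have h2 := count_eq_one_iff_of_cls h c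
    omega
  rw [invariant, invariant, ← red_map_red g u, ← red_map_red g w, red_eq_of_cls h,
    count_map_of_iff ha, count_map_of_iff ha, count_map_of_iff hb, count_map_of_iff hb, hmin, hmin]

/-- `L` lists one coded word for each nonzero element, `f` decodes and `g` encodes letters, and `z`
represents zero. Distinctness of the classes is checked on the codes, where `invariant` can be
computed. -/
theorem card_of_list {W : Set lam.Quotient} {L : List (List ℕ)} {f g : ℕ → ℕ} {a b : ℕ}
    (ha : ∀ n, g n = 0 ↔ n = a) (hb : ∀ n, g n = 1 ↔ n = b)
    (hfg : ∀ w ∈ L, (w.map f).map g = w) (hL : (L.map invariant).Nodup)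
    (hfac : ∀ w ∈ L, w.map f ∈ Fac W) (hall : ∀ u ∈ Fac W, ∃ w ∈ L, cls u = cls (w.map f))
    {z : List ℕ} (hz : z ∉ Fac W) : Nat.card (MLam W) = L.length + 1 := by
  let F : Option (Fin L.length) → MLam W := fun o =>
    o.elim (mkM W z) fun i => mkM W ((L.get i).map f)
  have hF : Function.Bijective F := by
    constructor
    · have h0 : ∀ i : Fin L.length, mkM W ((L.get i).map f) ≠ mkM W z := by
        intro i h
        have hi := hfac _ (L.get_mem i)
        rcases mkM_eq_iff.1 h with h | h
        · exact hz (fac_of_cls hi h.symm)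
        · exact h.1 hi
      rintro (_ | i) (_ | j) h
      · rfl
      · exact absurd h.symm (h0 j)
      · exact absurd h (h0 i)
      · rcases mkM_eq_iff.1 h with h | h
        · have h1 := invariant_eq_of_cls ha hb h
          rw [hfg _ (L.get_mem i), hfg _ (L.get_mem j)] at h1
          have h2 := List.nodup_iff_injective_get.1 hL
            (a₁ := i.cast (by simp)) (a₂ := j.cast (by simp)) (by simpa using h1)
          congr 1
          exact Fin.ext (by simpa using congrArg Fin.val h2)
        · exact absurd (hfac _ (L.get_mem i)) h.1
    · intro m
      obtain ⟨u, rfl⟩ := mkM_surjective m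
      by_cases hu : u ∈ Fac W
      · obtain ⟨w, hw, h⟩ := hall u hu
        obtain ⟨i, rfl⟩ := List.get_of_mem hw
        exact ⟨some i, mkM_eq fun _ => h.symm⟩
      · exact ⟨none, mkM_eq fun h => absurd h (by tauto)⟩
  rw [← Nat.card_eq_of_bijective F hF]
  simp

theorem cls_cap_two (p q : List ℕ) (c k : ℕ) :
    cls (p ++ (List.replicate k c ++ q)) = cls (p ++ (List.replicate (min k 2) c ++ q)) := by
  match k with
  | 0 => rfl
  | 1 => rfl
  | k + 2 =>
    rw [cls_append, cls_replicate_first, show min (k + 2) 2 = 2 by omega]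
    rfl

theorem cls_cap_one {p : List ℕ} {c : ℕ} (h : c ∈ p) (q : List ℕ) (k : ℕ) :
    cls (p ++ (List.replicate k c ++ q)) = cls (p ++ (List.replicate (min k 1) c ++ q)) := by
  match k with
  | 0 => rfl
  | k + 1 =>
    rw [cls_replicate h, show min (k + 1) 1 = 1 by omega]
    rfl

/-! ### Factors of the words `aⁱsbʲ` -/

section infixes

variable {a b s i j : ℕ} {l u r : List ℕ}

theorem prefix_cases (h : u ++ r = List.replicate i a ++ s :: List.replicate j b) :
    (∃ k, u = List.replicate k a) ∨ ∃ k, u = List.replicate i a ++ s :: List.replicate k b := by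
  rcases List.append_eq_append_iff.1 h with ⟨c, h1, -⟩ | ⟨c, rfl, h2⟩
  · exact Or.inl ⟨_, (List.append_eq_replicate_iff.1 h1.symm).2.1⟩
  · rcases c with _ | ⟨d, c⟩
    · exact Or.inl ⟨i, by simp⟩
    · simp only [List.cons_append, List.cons.injEq] at h2
      obtain ⟨rfl, h2⟩ := h2
      right
      exact ⟨c.length, by rw [← (List.append_eq_replicate_iff.1 h2.symm).2.1]⟩

theorem infix_cases (h : l ++ (u ++ r) = List.replicate i a ++ s :: List.replicate j b) :
    (∃ k, u = List.replicate k a) ∨ (∃ k m, u = List.replicate k a ++ s :: List.replicate m b) ∨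
      ∃ k, u = List.replicate k b := by
  rcases List.append_eq_append_iff.1 h with ⟨c, h1, h2⟩ | ⟨c, rfl, h2⟩
  · rw [(List.append_eq_replicate_iff.1 h1.symm).2.2] at h2
    rcases prefix_cases h2 with h | ⟨k, h⟩
    · exact Or.inl h
    · exact Or.inr (Or.inl ⟨_, k, h⟩)
  · rcases c with _ | ⟨d, c⟩
    · rcases prefix_cases (u := u) (i := 0) (a := a) (by simpa using h2.symm) with h | ⟨k, h⟩
      · exact Or.inl h
      · exact Or.inr (Or.inl ⟨_, k, h⟩)
    · simp only [List.cons_append, List.cons.injEq] at h2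
      have h3 := (List.append_eq_replicate_iff.1 h2.2.symm).2.2
      exact Or.inr (Or.inr ⟨_, (List.append_eq_replicate_iff.1 h3).2.1⟩)

end infixes

/-- Representatives of the `λ`-classes that are factors of `atba⁺sb⁺`, where the letters `a`, `b`,
`t`, `s` are coded by `0`, `1`, `2`, `3`. -/
def wordsJ : List (List ℕ) :=
  [[], [0], [0, 2], [0, 2, 1], [0, 2, 1, 0], [0, 2, 1, 0, 3], [0, 2, 1, 0, 3, 1],
    [2], [2, 1], [2, 1, 0], [2, 1, 0, 0], [2, 1, 0, 3], [2, 1, 0, 0, 3], [2, 1, 0, 3, 1],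
    [2, 1, 0, 0, 3, 1],
    [1], [1, 0], [1, 0, 0], [1, 0, 3], [1, 0, 0, 3], [1, 0, 3, 1], [1, 0, 0, 3, 1],
    [0, 0], [0, 3], [0, 0, 3], [0, 3, 1], [0, 0, 3, 1], [0, 3, 1, 1], [0, 0, 3, 1, 1],
    [3], [3, 1], [3, 1, 1], [1, 1]]

/-- Representatives of the `λ`-classes that are factors of `ba⁺sb⁺`. -/
def wordsI : List (List ℕ) :=
  [[], [1], [1, 0], [1, 0, 0], [1, 0, 0, 3], [1, 0, 0, 3, 1], [0], [0, 0], [0, 3], [0, 0, 3],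
    [0, 3, 1], [0, 0, 3, 1], [0, 3, 1, 1], [0, 0, 3, 1, 1], [3], [3, 1], [3, 1, 1], [1, 1]]

/-- The letters with codes `0`, `1`, `2`, `3`. -/
def decode (a b t s n : ℕ) : ℕ := [a, b, t, s].getD n 0

/-- The codes of letters. -/
def encode (a b t n : ℕ) : ℕ := if n = a then 0 else if n = b then 1 else if n = t then 2 else 3

section

variable {a b t s : ℕ}

theorem map_encode_decode (hab : a ≠ b) (hat : a ≠ t) (has : a ≠ s) (hbt : b ≠ t) (hbs : b ≠ s)
    (hts : t ≠ s) {w : List ℕ} (hw : ∀ n ∈ w, n < 4) :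
    (w.map (decode a b t s)).map (encode a b t) = w := by
  rw [List.map_map]
  refine (List.map_congr_left fun n hn => ?_).trans (List.map_id w)
  have := hw n hn
  interval_cases n
  · simp [decode, encode]
  · simp [decode, encode, hab.symm]
  · simp [decode, encode, hat.symm, hbt.symm]
  · simp [decode, encode, has.symm, hbs.symm, hts.symm]

theorem encode_eq_zero (n : ℕ) : encode a b t n = 0 ↔ n = a := by
  rw [encode]
  split_ifs <;> simp_all

theorem encode_eq_one (hab : a ≠ b) (n : ℕ) : encode a b t n = 1 ↔ n = b := by
  rw [encode]
  split_ifs <;> simp_all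

/-- In a factor of `aⁱsbʲ` both runs consist of first occurrences onward, so a run counts only as
empty, single, or of length at least two; this is why exponents below `3` suffice. -/
theorem exists_word_tail {L : List (List ℕ)} (h1 : ∀ k < 3, List.replicate k 0 ∈ L)
    (h2 : ∀ k < 3, ∀ m < 3, List.replicate k 0 ++ 3 :: List.replicate m 1 ∈ L)
    (h3 : ∀ k < 3, List.replicate k 1 ∈ L) {l u r : List ℕ} {i j : ℕ}
    (h : l ++ (u ++ r) = List.replicate i a ++ s :: List.replicate j b) :
    ∃ w ∈ L, cls u = cls (w.map (decode a b t s)) := by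
  have one : ∀ c k : ℕ, cls (List.replicate k c) = cls (List.replicate (min k 2) c) := fun c k => by
    simpa using cls_cap_two [] [] c k
  rcases infix_cases h with ⟨k, rfl⟩ | ⟨k, m, rfl⟩ | ⟨k, rfl⟩
  · refine ⟨_, h1 (min k 2) (by omega), ?_⟩
    rw [one, List.map_replicate]
    rfl
  · refine ⟨_, h2 (min k 2) (by omega) (min m 2) (by omega), ?_⟩
    rw [cls_append, one a k, show s :: List.replicate m b = [s] ++ List.replicate m b by rfl,
      cls_append [s], one b m, List.map_append, List.map_cons, List.map_replicate, List.map_replicate]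
    rfl
  · refine ⟨_, h3 (min k 2) (by omega), ?_⟩
    rw [one, List.map_replicate]
    rfl

theorem card_baas (hab : a ≠ b) (hat : a ≠ t) (has : a ≠ s) (hbt : b ≠ t) (hbs : b ≠ s)
    (hts : t ≠ s) : Nat.card (MLam {cls [b, a, a, s, b]}) = 19 := by
  -- The letter `s` is simple in every word of the class, so `ss` represents zero.
  refine card_of_list (L := wordsI) (f := decode a b t s) (g := encode a b t) (z := [s, s])
    encode_eq_zero (encode_eq_one hab) (fun w hw => ?_) (by decide) (fun w hw => ?_)
    (fun u hu => ?_) ?_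
  · have : ∀ w ∈ wordsI, ∀ n ∈ w, n < 4 := by decide
    exact map_encode_decode hab hat has hbt hbs hts (this w hw)
  · have h1 : ∀ w ∈ wordsI, w <:+: [1, 0, 0, 3, 1, 1] := by decide
    have e1 : cls [b, a, a, s, b, b] = cls [b, a, a, s, b] :=
      (cls_dup (p := [b, a, a, s]) (by simp) []).symm
    exact fac_of_infix (mem_fac_singleton.2 ⟨[], [], e1⟩) ((h1 w hw).map (decode a b t s))
  · obtain ⟨l, r, h⟩ := mem_fac_singleton.1 hu
    obtain ⟨i, j, h⟩ := (cls_eq_baas hab has hbs).1 h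
    rw [List.append_assoc] at h
    have m1 : ∀ k < 3, 1 :: List.replicate k 0 ∈ wordsI := by decide
    have m2 : ∀ k < 2, 1 :: (List.replicate 2 0 ++ 3 :: List.replicate k 1) ∈ wordsI := by decide
    rcases l with _ | ⟨c, l⟩
    · rcases u with _ | ⟨d, u⟩
      · exact ⟨[], by decide, rfl⟩
      simp only [List.nil_append, List.cons_append, List.cons.injEq] at h
      obtain ⟨rfl, h⟩ := h
      rcases prefix_cases h with ⟨k, rfl⟩ | ⟨k, rfl⟩
      · refine ⟨_, m1 (min k 2) (by omega), ?_⟩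
        have := cls_cap_two [d] [] a k
        simp only [List.append_nil, List.cons_append, List.nil_append] at this
        rw [this, List.map_cons, List.map_replicate]
        rfl
      · refine ⟨_, m2 (min k 1) (by omega), ?_⟩
        have e1 := cls_cap_two [d] (s :: List.replicate k d) a (i + 2)
        have e2 := cls_cap_one (p := d :: (List.replicate 2 a ++ [s])) (c := d) (by simp) [] k
        rw [show min (i + 2) 2 = 2 by omega] at e1
        simp only [List.append_nil, List.cons_append, List.nil_append, List.append_assoc] at e1 e2
        rw [e1, e2, List.map_cons, List.map_append, List.map_cons, List.map_replicate,
          List.map_replicate]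
        rfl
    · simp only [List.cons_append, List.cons.injEq] at h
      exact exists_word_tail (by decide) (by decide) (by decide) h.2
  · intro h
    have := count_le_one_of_mem_fac h (n := s) (by simp [has, hbs])
    simp at this

theorem card_atba (hab : a ≠ b) (hat : a ≠ t) (has : a ≠ s) (hbt : b ≠ t) (hbs : b ≠ s)
    (hts : t ≠ s) : Nat.card (MLam {cls [a, t, b, a, s, b]}) = 34 := by
  refine card_of_list (L := wordsJ) (f := decode a b t s) (g := encode a b t) (z := [s, s])
    encode_eq_zero (encode_eq_one hab) (fun w hw => ?_) (by decide) (fun w hw => ?_)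
    (fun u hu => ?_) ?_
  · have : ∀ w ∈ wordsJ, ∀ n ∈ w, n < 4 := by decide
    exact map_encode_decode hab hat has hbt hbs hts (this w hw)
  · have h1 : ∀ w ∈ wordsJ, w <:+: [0, 2, 1, 0, 3, 1, 1] ∨ w <:+: [0, 2, 1, 0, 0, 3, 1, 1] := by
      decide
    have e1 : cls [a, t, b, a, s, b, b] = cls [a, t, b, a, s, b] :=
      (cls_dup (p := [a, t, b, a, s]) (by simp) []).symm
    have e2 : cls [a, t, b, a, a, s, b, b] = cls [a, t, b, a, s, b, b] :=
      (cls_dup (p := [a, t, b]) (by simp) [s, b, b]).symm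
    rcases h1 w hw with h1 | h1
    · exact fac_of_infix (mem_fac_singleton.2 ⟨[], [], e1⟩) (h1.map (decode a b t s))
    · exact fac_of_infix (mem_fac_singleton.2 ⟨[], [], e2.trans e1⟩) (h1.map (decode a b t s))
  · obtain ⟨l, r, h⟩ := mem_fac_singleton.1 hu
    obtain ⟨i, j, h⟩ := (cls_eq_atba hab hat has hbt hbs hts).1 h
    rw [List.append_assoc] at h
    have m1 : ∀ k < 2, 0 :: 2 :: 1 :: List.replicate k 0 ∈ wordsJ := by decide
    have m2 : ∀ k < 2, 0 :: 2 :: 1 :: (List.replicate 1 0 ++ 3 :: List.replicate k 1) ∈ wordsJ := by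
      decide
    have m3 : ∀ k < 3, 2 :: 1 :: List.replicate k 0 ∈ wordsJ := by decide
    have m4 : ∀ n < 2, ∀ k < 2,
      2 :: 1 :: (List.replicate (n + 1) 0 ++ 3 :: List.replicate k 1) ∈ wordsJ := by decide
    have m5 : ∀ k < 3, 1 :: List.replicate k 0 ∈ wordsJ := by decide
    have m6 : ∀ n < 2, ∀ k < 2,
      1 :: (List.replicate (n + 1) 0 ++ 3 :: List.replicate k 1) ∈ wordsJ := by decide
    have c1 : ∀ (p : List ℕ) k, cls (p ++ List.replicate k a) =
        cls (p ++ List.replicate (min k 2) a) := fun p k => by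
      simpa using cls_cap_two p [] a k
    have c2 : ∀ (p : List ℕ) k, b ∈ p →
        cls (p ++ (List.replicate (i + 1) a ++ s :: List.replicate k b)) =
        cls (p ++ (List.replicate (min i 1 + 1) a ++ s :: List.replicate (min k 1) b)) := by
      intro p k hp
      have e1 := cls_cap_two p (s :: List.replicate k b) a (i + 1)
      have e2 := cls_cap_one (p := p ++ (List.replicate (min i 1 + 1) a ++ [s])) (c := b)
        (by simp [hp]) [] k
      rw [show min (i + 1) 2 = min i 1 + 1 by omega] at e1
      simp only [List.append_nil, List.cons_append, List.nil_append, List.append_assoc] at e1 e2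
      rw [e1, e2]
    -- The cases are how much of the initial `atb` is cut off by `l`, since the first occurrences
    -- that the factor retains decide which runs collapse to length one.
    rcases l with _ | ⟨c, _ | ⟨c', _ | ⟨c'', l⟩⟩⟩
    · rcases u with _ | ⟨d, _ | ⟨d', _ | ⟨d'', u⟩⟩⟩
      · exact ⟨[], by decide, rfl⟩
      · simp only [List.nil_append, List.cons_append, List.cons.injEq] at h
        obtain ⟨rfl, -⟩ := h
        exact ⟨[0], by decide, rfl⟩
      · simp only [List.nil_append, List.cons_append, List.cons.injEq] at h
        obtain ⟨rfl, rfl, -⟩ := h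
        exact ⟨[0, 2], by decide, rfl⟩
      · simp only [List.nil_append, List.cons_append, List.cons.injEq] at h
        obtain ⟨rfl, rfl, rfl, h⟩ := h
        rcases prefix_cases h with ⟨k, rfl⟩ | ⟨k, rfl⟩
        · refine ⟨_, m1 (min k 1) (by omega), ?_⟩
          have := cls_cap_one (p := [d, d', d'']) (c := d) (by simp) [] k
          simp only [List.append_nil, List.cons_append, List.nil_append] at this
          rw [this]
          simp only [List.map_cons, List.map_replicate]
          rfl
        · refine ⟨_, m2 (min k 1) (by omega), ?_⟩
          have e1 := c2 [d, d', d''] k (by simp)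
          -- The factor keeps the initial `a`, so the later run of `a` consists of nonfirst
          -- occurrences and shrinks to a single letter.
          have e2 := cls_cap_one (p := [d, d', d'']) (c := d) (by simp)
            (s :: List.replicate (min k 1) d'') (min i 1 + 1)
          rw [show min (min i 1 + 1) 1 = 1 by omega] at e2
          simp only [List.cons_append, List.nil_append] at e1 e2
          rw [e1, e2]
          simp only [List.map_cons, List.map_append, List.map_replicate]
          rfl
    · rcases u with _ | ⟨d', _ | ⟨d'', u⟩⟩
      · exact ⟨[], by decide, rfl⟩
      · simp only [List.nil_append, List.cons_append, List.cons.injEq] at h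
        obtain ⟨-, rfl, -⟩ := h
        exact ⟨[2], by decide, rfl⟩
      · simp only [List.nil_append, List.cons_append, List.cons.injEq] at h
        obtain ⟨-, rfl, rfl, h⟩ := h
        rcases prefix_cases h with ⟨k, rfl⟩ | ⟨k, rfl⟩
        · refine ⟨_, m3 (min k 2) (by omega), ?_⟩
          rw [show d' :: d'' :: List.replicate k a = [d', d''] ++ List.replicate k a by rfl, c1]
          simp only [List.map_cons, List.map_replicate]
          rfl
        · refine ⟨_, m4 (min i 1) (by omega) (min k 1) (by omega), ?_⟩
          refine (c2 [d', d''] k (by simp)).trans ?_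
          simp only [List.map_cons, List.map_append, List.map_replicate]
          rfl
    · rcases u with _ | ⟨d'', u⟩
      · exact ⟨[], by decide, rfl⟩
      · simp only [List.nil_append, List.cons_append, List.cons.injEq] at h
        obtain ⟨-, -, rfl, h⟩ := h
        rcases prefix_cases h with ⟨k, rfl⟩ | ⟨k, rfl⟩
        · refine ⟨_, m5 (min k 2) (by omega), ?_⟩
          rw [show d'' :: List.replicate k a = [d''] ++ List.replicate k a by rfl, c1]
          simp only [List.map_cons, List.map_replicate]
          rfl
        · refine ⟨_, m6 (min i 1) (by omega) (min k 1) (by omega), ?_⟩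
          refine (c2 [d''] k (by simp)).trans ?_
          simp only [List.map_cons, List.map_append, List.map_replicate]
          rfl
    · simp only [List.cons_append, List.cons.injEq] at h
      exact exists_word_tail (by decide) (by decide) (by decide) h.2.2.2
  · intro h
    have := count_le_one_of_mem_fac h (n := s) (by simp [has, hbs, hts])
    simp at this

end

end LimitVar

open LimitVar in
theorem theorem6p1 (a b t s : ℕ) (hab : a ≠ b) (hat : a ≠ t) (has : a ≠ s) (hbt : b ≠ t)
    (hbs : b ≠ s) (hts : t ≠ s) :
    {V : MonoidVariety.{u} | V ≤ varJ ∧ ¬ V ≤ varB0} =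
        {varF, varF ⊔ varE.dual, varH, varI, varJ} ∧
      (varF : MonoidVariety.{u}) =
        .var (MLam {letter a * letter t * plus a}) ∧
      (varF ⊔ varE.dual : MonoidVariety.{u}) =
        .var (MLam {letter a * letter t * plus a, plus a * letter t}) ∧
      (MonoidVariety.var (MLam {letter a * letter t * plus a, plus a * letter t}) :
          MonoidVariety.{u}) =
        .var (MLam {plus a * letter t * plus a}) ∧
      (varH : MonoidVariety.{u}) =
        .var (MLam {letter a * letter b * letter t * plus a * letter s * plus b}) ∧
      (Nat.card (MLam {letter b * plus a * letter s * plus b}) = 19 ∧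
        (varI : MonoidVariety.{u}) =
          .var (MLam {letter b * plus a * letter s * plus b})) ∧
      (Nat.card (MLam {letter a * letter t * letter b * plus a * letter s * plus b}) = 34 ∧
        (varJ : MonoidVariety.{u}) =
          .var (MLam {letter a * letter t * letter b * plus a * letter s * plus b})) := by
  -- After an earlier occurrence of the same letter, `n⁺` and `n` contribute the same `λ`-word; so
  -- each generator is the class of a word with as few repetitions as possible.
  have hF : letter a * letter t * plus a = cls [a, t, a] :=
    (cls_dup (p := [a, t]) (c := a) (by simp) []).symm
  have hL : plus a * letter t = cls [a, a, t] := rfl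
  have hE : plus a * letter t * plus a = cls [a, a, t, a] :=
    (cls_dup (p := [a, a, t]) (c := a) (by simp) []).symm
  have hH : letter a * letter b * letter t * plus a * letter s * plus b =
      cls [a, b, t, a, s, b] :=
    ((cls_dup (p := [a, b, t]) (c := a) (by simp) [s, b]).trans
      (cls_dup (p := [a, b, t, a, a, s]) (c := b) (by simp) [])).symm
  have hI : letter b * plus a * letter s * plus b = cls [b, a, a, s, b] :=
    (cls_dup (p := [b, a, a, s]) (c := b) (by simp) []).symm
  have hJ : letter a * letter t * letter b * plus a * letter s * plus b =
      cls [a, t, b, a, s, b] :=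
    ((cls_dup (p := [a, t, b]) (c := a) (by simp) [s, b]).trans
      (cls_dup (p := [a, t, b, a, a, s]) (c := b) (by simp) [])).symm
  rw [hF, hE, hH, hI, hJ, hL, varF_sup_dual_varE, ← varFE_eq hat, ← varFE_eq' hat]
  refine ⟨?_, varF_eq hat, rfl, rfl, varH_eq hab hat has hbt hbs hts,
    ⟨card_baas hab hat has hbt hbs hts, varI_eq hab hat has hbt hbs hts⟩,
    card_atba hab hat has hbt hbs hts, varJ_eq hab hat has hbt hbs hts⟩
  -- All five varieties contain `𝔽`, and this alone keeps them out of `𝔹₀`.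
  have hB : ∀ {V : MonoidVariety.{u}}, varF ≤ V → ¬ V ≤ varB0 := fun h k =>
    not_varF_le_varB0 (MonoidVariety.le_trans' h k)
  ext V
  simp only [Set.mem_ofPred_eq, Set.mem_insert_iff, Set.mem_singleton_iff]
  constructor
  · rintro ⟨hV, hV'⟩
    exact eq_of_le_varJ hV hV'
  · rintro (rfl | rfl | rfl | rfl | rfl)
    · exact ⟨varF_le_varJ, hB (MonoidVariety.le_refl' _)⟩
    · exact ⟨varFE_le_varJ, hB varF_le_varFE⟩
    · exact ⟨varH_le_varJ, hB varF_le_varH⟩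
    · exact ⟨varI_le_varJ, hB varF_le_varI⟩
    · exact ⟨MonoidVariety.le_refl' _, hB varF_le_varJ⟩
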